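/- **Proposition.** Let $k$ be an algebraically closed field of characteristic zero, let $U$ and $V$ be $k$-vector spaces of dimensions $m\le n$, let $1\le r\le m-1$, and let $\mathbb{G}=\mathbb{G}(U,r)$ be the Grassmannian of $r$-dimensional quotients of $U$, with universal sequence $0\to\mathcal U\to U\otimes\mathcal O_{\mathbb G}\to\mathcal Q\to 0$. Put $W=U\otimes V$ and let $\mathbb P(-)$ parametrize one-dimensional (rank one) quotients. Let $\mathcal X=\mathbb P(V\otimes\mathcal Q)$ and $\mathcal Y=\mathbb P(V^\vee\otimes\mathcal U^\vee)$, with their natural morphisms to $\mathbb PW$ and $\mathbb PW^\vee$. Let $L\subset W$ be a linear subspace of dimension $c$, let $L^\perp\subset W^\vee$ be its annihilator, and put $X_L=\mathcal X\times_{\mathbb PW}\mathbb P(W/L)$ and $Y_L=\mathcal Y\times_{\mathbb PW^\vee}\mathbb P(W^\vee/L^\perp)$. Let $M_L:L\otimes\mathcal O_{\mathbb G}\to V\otimes\mathcal Q$ and $M^L:L^\perp\otimes\mathcal O_{\mathbb G}\to V^\vee\otimes\mathcal U^\vee$ be the morphisms induced by $L\subset U\otimes V$ and $L^\perp\subset U^\vee\otimes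 V^\vee$. Assume $c=nr$, so that $M_L$ and $M^L$ are morphisms between bundles of the same rank, and let $D_L=\mathbb V(\det M_L)$ and $D^L=\mathbb V(\det M^L)$ be the corresponding closed subschemes of $\mathbb G$. 1. $D_L=D^L$ as closed subschemes of $\mathbb G$. 2. Suppose that $L$ is admissible, i.e. $\dim X_L=r(n+m-r)-c-1$ and $\dim Y_L=r(m-n-r)+c-1$ (both equal to $r(m-r)-1$), and, if this dimension is positive, that $X_L$ and $Y_L$ are irreducible. Then $X_L$ and $Y_L$ are both birational to $D_L=D^L$, and $X_L$ is birational to $Y_L$. Here two $k$-schemes are called birational if they have dense open subschemes that are isomorphic over $k$. -/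

import Mathlib

open CategoryTheory TensorProduct

universe u v w

namespace DetBirational

section Algebra

variable {k : Type u} [CommRing k] {M : Type v} [AddCommGroup M] [Module k M]
variable {A B : Type u} [CommRing A] [Algebra k A] [CommRing B] [Algebra k B] (f : A →ₐ[k] B)

/-- The map `A ⊗ M → B ⊗ M` induced by `f : A → B`. -/
noncomputable def scalarMap (M : Type v) [AddCommGroup M] [Module k M] :
    A ⊗[k] M →ₗ[k] B ⊗[k] M :=
  f.toLinearMap.rTensor M

@[simp] theorem scalarMap_tmul (a : A) (m : M) :
    scalarMap f M (a ⊗ₜ m) = f a ⊗ₜ m := rfl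

theorem scalarMap_smul (a : A) (x : A ⊗[k] M) :
    scalarMap f M (a • x) = f a • scalarMap f M x := by
  induction x with
  | zero => simp
  | tmul b m => simp [TensorProduct.smul_tmul']
  | add x y hx hy => simp [smul_add, hx, hy]

/-- The base change of a point of a Grassmannian is generated by the images of its elements. -/
theorem map_toSubmodule_eq_span {r : ℕ} (N : Module.Grassmannian A (A ⊗[k] M) r) :
    (Module.Grassmannian.map f N).toSubmodule =
      Submodule.span B (scalarMap f M '' (N.toSubmodule : Set (A ⊗[k] M))) := by
  let : Algebra A B := f.toAlgebra
  have : IsScalarTower k A B :=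
    IsScalarTower.of_algebraMap_eq' <| IsScalarTower.algebraMap_eq k A B
  have key : ∀ x : A ⊗[k] M,
      (AlgebraTensorModule.cancelBaseChange k A B B M).symm (scalarMap f M x) = 1 ⊗ₜ[A] x := by
    intro x
    induction x with
    | zero => simp
    | tmul a m =>
      rw [scalarMap_tmul, AlgebraTensorModule.cancelBaseChange_symm_tmul]
      have : f a = a • (1 : B) := by rw [Algebra.smul_def, mul_one]; rfl
      rw [this, TensorProduct.smul_tmul, TensorProduct.smul_tmul', smul_eq_mul, mul_one]
    | add x y hx hy => rw [map_add, map_add, hx, hy, TensorProduct.tmul_add]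
  rw [Module.Grassmannian.map_toSubmodule]
  apply le_antisymm
  · intro y hy
    have hy' : (N.toSubmodule.mkQ.lTensor B)
        ((AlgebraTensorModule.cancelBaseChange k A B B M).symm y) = 0 := hy
    rw [← LinearMap.mem_ker, lTensor_mkQ] at hy'
    obtain ⟨z, hz⟩ := hy'
    have : ∀ z : B ⊗[A] N.toSubmodule, (AlgebraTensorModule.cancelBaseChange k A B B M)
        (N.toSubmodule.subtype.lTensor B z) ∈
        Submodule.span B (scalarMap f M '' (N.toSubmodule : Set (A ⊗[k] M))) := by
      intro z
      induction z with
      | zero => simp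
      | tmul b x =>
        rw [LinearMap.lTensor_tmul]
        have : b ⊗ₜ[A] (x : A ⊗[k] M) = b • ((1 : B) ⊗ₜ[A] (x : A ⊗[k] M)) := by
          rw [TensorProduct.smul_tmul', smul_eq_mul, mul_one]
        rw [Submodule.subtype_apply, this, ← key, map_smul, LinearEquiv.apply_symm_apply]
        exact Submodule.smul_mem _ _ (Submodule.subset_span ⟨x, x.2, rfl⟩)
      | add x y hx hy => rw [map_add, map_add]; exact add_mem hx hy
    have h2 := this z
    rwa [hz, LinearEquiv.apply_symm_apply] at h2
  · rw [Submodule.span_le]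
    rintro _ ⟨x, hx, rfl⟩
    change (N.toSubmodule.mkQ.baseChange B)
        ((AlgebraTensorModule.cancelBaseChange k A B B M).symm (scalarMap f M x)) = 0
    rw [key, LinearMap.baseChange_tmul, Submodule.mkQ_apply,
      (Submodule.Quotient.mk_eq_zero _).2 hx, TensorProduct.tmul_zero]

theorem scalarMap_mem_map {r : ℕ} (N : Module.Grassmannian A (A ⊗[k] M) r) {x : A ⊗[k] M}
    (hx : x ∈ N.toSubmodule) : scalarMap f M x ∈ (Module.Grassmannian.map f N).toSubmodule := by
  rw [map_toSubmodule_eq_span]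
  exact Submodule.subset_span ⟨x, hx, rfl⟩

/-- If `φ` and `ψ` are linear maps over `A` and `B` related by an `f`-semilinear map of their
targets and `⋀ᵈ φ = 0`, then `⋀ᵈ ψ = 0`. -/
theorem exteriorPower_map_eq_zero {E F : Type*} [AddCommGroup E] [Module A E]
    [AddCommGroup F] [Module B F] (d : ℕ) (φ : A ⊗[k] M →ₗ[A] E) (ψ : B ⊗[k] M →ₗ[B] F)
    (j : E →ₛₗ[f.toRingHom] F) (hj : ∀ m : M, j (φ (1 ⊗ₜ m)) = ψ (1 ⊗ₜ m))
    (h : exteriorPower.map d φ = 0) : exteriorPower.map d ψ = 0 := by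
  let : Module A (⋀[B]^d F) := Module.compHom _ f.toRingHom
  let alt : E [⋀^Fin d]→ₗ[A] (⋀[B]^d F) :=
    { toFun := fun x => exteriorPower.ιMulti B d (fun i => j (x i))
      map_update_add' := by
        intro _ m i x y
        have e : ∀ z, (fun i' => j (Function.update m i z i')) =
            Function.update (fun i' => j (m i')) i (j z) := by
          intro z; ext i'; by_cases hi : i' = i
          · subst hi; simp
          · simp [hi]
        change exteriorPower.ιMulti B d (fun i' => j (Function.update m i (x + y) i')) =
          exteriorPower.ιMulti B d (fun i' => j (Function.update m i x i')) +
            exteriorPower.ιMulti B d (fun i' => j (Function.update m i y i'))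
        rw [e, e, e, map_add, AlternatingMap.map_update_add]
      map_update_smul' := by
        intro _ m i c x
        have e : ∀ z, (fun i' => j (Function.update m i z i')) =
            Function.update (fun i' => j (m i')) i (j z) := by
          intro z; ext i'; by_cases hi : i' = i
          · subst hi; simp
          · simp [hi]
        change exteriorPower.ιMulti B d (fun i' => j (Function.update m i (c • x) i')) =
          (f c : B) • exteriorPower.ιMulti B d (fun i' => j (Function.update m i x i'))
        have h3 : j (c • x) = (f c : B) • j x := j.map_smulₛₗ c x
        rw [e, e, h3, AlternatingMap.map_update_smul]
      map_eq_zero_of_eq' := fun x i i' hx hne =>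
        (exteriorPower.ιMulti B d).map_eq_zero_of_eq _ (by simp [hx]) hne }
  have hspan : Submodule.span B (Set.range fun m : M => (1 : B) ⊗ₜ[k] m) = ⊤ := by
    rw [eq_top_iff]
    intro x _
    induction x with
    | zero => simp
    | tmul b m =>
      have : b ⊗ₜ[k] m = b • ((1 : B) ⊗ₜ[k] m) := by
        rw [TensorProduct.smul_tmul', smul_eq_mul, mul_one]
      rw [this]
      exact Submodule.smul_mem _ _ (Submodule.subset_span ⟨m, rfl⟩)
    | add x y hx hy => exact add_mem (hx trivial) (hy trivial)
  refine LinearMap.ext_on (exteriorPower.ιMulti_span_of_span B d (B ⊗[k] M) hspan) ?_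
  rintro _ ⟨a, ha, rfl⟩
  choose m hm using fun i => ha ⟨i, rfl⟩
  have ha' : a = fun i => (1 : B) ⊗ₜ[k] m i := funext fun i => (hm i).symm
  rw [exteriorPower.map_apply_ιMulti, LinearMap.zero_apply, ha']
  have h1 : exteriorPower.ιMulti A d (fun i => φ (1 ⊗ₜ m i)) = 0 := by
    have := LinearMap.congr_fun h (exteriorPower.ιMulti A d (fun i => (1 : A) ⊗ₜ[k] m i))
    rwa [exteriorPower.map_apply_ιMulti] at this
  have h2 := exteriorPower.alternatingMapLinearEquiv_apply_ιMulti alt (fun i => φ (1 ⊗ₜ m i))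
  rw [h1, map_zero] at h2
  have h3 : exteriorPower.ιMulti B d (fun i => j (φ (1 ⊗ₜ m i))) = 0 := h2.symm
  simp only [hj] at h3
  exact h3

end Algebra

section Bundles

variable {k : Type u} [Field k] {U V : Type v} [AddCommGroup U] [Module k U]
  [AddCommGroup V] [Module k V]

/-- The `A`-linear map `A ⊗ U → A ⊗ (U ⊗ V)`, `x ↦ x ⊗ v`. -/
noncomputable def tensorVec (A : Type u) [CommRing A] [Algebra k A] (v : V) :
    A ⊗[k] U →ₗ[A] A ⊗[k] (U ⊗[k] V) :=
  ((TensorProduct.mk k U V).flip v).baseChange A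

@[simp] theorem tensorVec_tmul (A : Type u) [CommRing A] [Algebra k A] (v : V) (a : A) (x : U) :
    tensorVec A v (a ⊗ₜ x) = a ⊗ₜ[k] (x ⊗ₜ[k] v) := rfl

theorem tensorVec_scalarMap {A B : Type u} [CommRing A] [Algebra k A] [CommRing B] [Algebra k B]
    (f : A →ₐ[k] B) (v : V) (x : A ⊗[k] U) :
    tensorVec B v (scalarMap f U x) = scalarMap f (U ⊗[k] V) (tensorVec A v x) := by
  induction x with
  | zero => simp
  | tmul a x => simp
  | add x y hx hy => simp [hx, hy]

/-- The `A`-linear map `g ⊗ 1 : A ⊗ (U ⊗ V) = (A ⊗ U) ⊗ V → F ⊗ V`. -/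
noncomputable def tensorMap {A : Type u} [CommRing A] [Algebra k A] {F : Type*} [AddCommGroup F]
    [Module k F] [Module A F] [IsScalarTower k A F] (g : A ⊗[k] U →ₗ[A] F)
    (V : Type v) [AddCommGroup V] [Module k V] : A ⊗[k] (U ⊗[k] V) →ₗ[A] F ⊗[k] V :=
  (AlgebraTensorModule.map g LinearMap.id) ∘ₗ
    (AlgebraTensorModule.assoc k k A A U V).symm.toLinearMap

@[simp] theorem tensorMap_tmul {A : Type u} [CommRing A] [Algebra k A] {F : Type*}
    [AddCommGroup F] [Module k F] [Module A F] [IsScalarTower k A F] (g : A ⊗[k] U →ₗ[A] F)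
    (a : A) (x : U) (v : V) : tensorMap g V (a ⊗ₜ (x ⊗ₜ v)) = g (a ⊗ₜ x) ⊗ₜ v := rfl

/-- The canonical map `A ⊗ U^∨ → (A ⊗ U)^∨`. -/
noncomputable def dualEv (A : Type u) [CommRing A] [Algebra k A] :
    A ⊗[k] Module.Dual k U →ₗ[A] Module.Dual A (A ⊗[k] U) :=
  (Module.Dual.baseChange A).liftBaseChange A

@[simp] theorem dualEv_tmul (A : Type u) [CommRing A] [Algebra k A] (a b : A)
    (ξ : Module.Dual k U) (x : U) : dualEv A (a ⊗ₜ ξ) (b ⊗ₜ x) = a * (ξ x • b) := rfl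

theorem dualEv_scalarMap {A B : Type u} [CommRing A] [Algebra k A] [CommRing B] [Algebra k B]
    (f : A →ₐ[k] B) (ξ : A ⊗[k] Module.Dual k U) (x : A ⊗[k] U) :
    dualEv B (scalarMap f _ ξ) (scalarMap f U x) = f (dualEv A ξ x) := by
  induction ξ with
  | zero => simp
  | tmul a ξ =>
    induction x with
    | zero => simp
    | tmul b x => simp
    | add x y hx hy => simp only [map_add, hx, hy]
  | add ξ η hξ hη => simp only [map_add, LinearMap.add_apply, hξ, hη]

/-- For a submodule `N` of `A ⊗ U`, the restriction map `A ⊗ U^∨ → N^∨`. -/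
noncomputable def dualRestrict {A : Type u} [CommRing A] [Algebra k A]
    (N : Submodule A (A ⊗[k] U)) : A ⊗[k] Module.Dual k U →ₗ[A] Module.Dual A N :=
  N.subtype.dualMap ∘ₗ dualEv A

theorem dualRestrict_apply {A : Type u} [CommRing A] [Algebra k A]
    (N : Submodule A (A ⊗[k] U)) (ξ : A ⊗[k] Module.Dual k U) (x : N) :
    dualRestrict N ξ x = dualEv A ξ x := rfl

/-- A submodule with projective quotient is the kernel of an idempotent. -/
theorem exists_idem {A : Type u} [CommRing A] [Algebra k A] {r : ℕ}
    (N : Module.Grassmannian A (A ⊗[k] U) r) :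
    ∃ e : A ⊗[k] U →ₗ[A] A ⊗[k] U, (∀ x ∈ N.toSubmodule, e x = 0) ∧
      ∀ x, x - e x ∈ N.toSubmodule := by
  obtain ⟨s, hs⟩ := Module.projective_lifting_property N.toSubmodule.mkQ LinearMap.id
    N.toSubmodule.mkQ_surjective
  refine ⟨s ∘ₗ N.toSubmodule.mkQ, fun x hx => ?_, fun x => ?_⟩
  · rw [LinearMap.comp_apply, Submodule.mkQ_apply, (Submodule.Quotient.mk_eq_zero _).2 hx, map_zero]
  · rw [← Submodule.Quotient.mk_eq_zero, Submodule.Quotient.mk_sub]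
    have := LinearMap.congr_fun hs (N.toSubmodule.mkQ x)
    simp only [LinearMap.comp_apply, Submodule.mkQ_apply, LinearMap.id_apply] at this ⊢
    rw [this, sub_self]

section

variable {A B : Type u} [CommRing A] [Algebra k A] [CommRing B] [Algebra k B] (f : A →ₐ[k] B)

/-- The base change to `B` of a linear form on `A ⊗ U`. -/
noncomputable def formMap (η : Module.Dual A (A ⊗[k] U)) : Module.Dual B (B ⊗[k] U) :=
  LinearMap.liftBaseChange B
    (f.toLinearMap ∘ₗ η.restrictScalars k ∘ₗ TensorProduct.mk k A U 1)

theorem formMap_scalarMap (η : Module.Dual A (A ⊗[k] U)) (x : A ⊗[k] U) :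
    formMap f η (scalarMap f U x) = f (η x) := by
  induction x with
  | zero => simp
  | tmul a x =>
    have : a ⊗ₜ[k] x = a • ((1 : A) ⊗ₜ[k] x) := by
      rw [TensorProduct.smul_tmul', smul_eq_mul, mul_one]
    rw [this, scalarMap_smul, map_smul, map_smul, smul_eq_mul, smul_eq_mul, map_mul,
      scalarMap_tmul, map_one]
    simp [formMap]
  | add x y hx hy => simp only [map_add, hx, hy]

theorem exists_tensorMap {E F : Type*} [AddCommGroup E] [Module k E] [Module A E]
    [IsScalarTower k A E] [AddCommGroup F] [Module k F] [Module B F] [IsScalarTower k B F]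
    (j : E →ₛₗ[f.toRingHom] F) (g : A ⊗[k] U →ₗ[A] E) (g' : B ⊗[k] U →ₗ[B] F)
    (hj : ∀ x, j (g x) = g' (scalarMap f U x)) (V : Type v) [AddCommGroup V] [Module k V] :
    ∃ J : E ⊗[k] V →ₛₗ[f.toRingHom] F ⊗[k] V,
      ∀ x, J (tensorMap g V x) = tensorMap g' V (scalarMap f _ x) := by
  let j₀ : E →ₗ[k] F :=
    { toFun := j
      map_add' := map_add j
      map_smul' := fun c x => by
        have h : f.toRingHom (algebraMap k A c) = algebraMap k B c := f.commutes c
        rw [← algebraMap_smul A c x, LinearMap.map_smulₛₗ, h, algebraMap_smul, RingHom.id_apply] }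
  refine ⟨{ toFun := j₀.rTensor V, map_add' := map_add _, map_smul' := fun a x => ?_ }, fun x => ?_⟩
  · induction x with
    | zero => simp
    | tmul x v =>
      rw [TensorProduct.smul_tmul', LinearMap.rTensor_tmul, LinearMap.rTensor_tmul,
        TensorProduct.smul_tmul']
      exact congrArg (· ⊗ₜ[k] v) (j.map_smulₛₗ a x)
    | add x y hx hy => rw [smul_add, map_add, map_add, hx, hy, smul_add]
  · change j₀.rTensor V _ = _
    induction x with
    | zero => simp
    | tmul a w =>
      induction w with
      | zero => simp
      | tmul u v =>
        rw [tensorMap_tmul, LinearMap.rTensor_tmul, scalarMap_tmul, tensorMap_tmul]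
        exact congrArg (· ⊗ₜ[k] v) (hj (a ⊗ₜ u))
      | add x y hx hy => simp only [TensorProduct.tmul_add, map_add, hx, hy]
    | add x y hx hy => simp only [map_add, hx, hy]

theorem exists_quotMap {r : ℕ} (N : Module.Grassmannian A (A ⊗[k] U) r) :
    ∃ j : ((A ⊗[k] U) ⧸ N.toSubmodule) →ₛₗ[f.toRingHom]
        ((B ⊗[k] U) ⧸ (Module.Grassmannian.map f N).toSubmodule),
      ∀ x, j (N.toSubmodule.mkQ x) =
        (Module.Grassmannian.map f N).toSubmodule.mkQ (scalarMap f U x) := by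
  let g : A ⊗[k] U →ₛₗ[f.toRingHom] B ⊗[k] U :=
    { toFun := scalarMap f U
      map_add' := map_add _
      map_smul' := scalarMap_smul f }
  exact ⟨Submodule.mapQ _ _ g fun x hx => scalarMap_mem_map f N hx, fun x => rfl⟩

theorem exists_dualMap {r : ℕ} (N : Module.Grassmannian A (A ⊗[k] U) r) :
    ∃ j : Module.Dual A N.toSubmodule →ₛₗ[f.toRingHom]
        Module.Dual B (Module.Grassmannian.map f N).toSubmodule,
      ∀ ξ, j (dualRestrict N.toSubmodule ξ) =
        dualRestrict (Module.Grassmannian.map f N).toSubmodule (scalarMap f _ ξ) := by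
  obtain ⟨e, he, he'⟩ := exists_idem N
  let p : A ⊗[k] U →ₗ[A] N.toSubmodule := (LinearMap.id - e).codRestrict _ he'
  have hp : ∀ x : N.toSubmodule, p x = x := fun x => by
    apply Subtype.ext
    simp [p, he x x.2]
  have key : ∀ (φ ψ : Module.Dual B (Module.Grassmannian.map f N).toSubmodule),
      (∀ x (hx : x ∈ N.toSubmodule), φ ⟨_, scalarMap_mem_map f N hx⟩ =
        ψ ⟨_, scalarMap_mem_map f N hx⟩) → φ = ψ := by
    intro φ ψ h
    apply LinearMap.ext
    rintro ⟨y, hy⟩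
    have hy' := hy
    rw [map_toSubmodule_eq_span] at hy'
    induction hy' using Submodule.span_induction with
    | mem y hy' => obtain ⟨x, hx, rfl⟩ := hy'; exact h x hx
    | zero => exact (map_zero φ).trans (map_zero ψ).symm
    | add y z hy' hz' h1 h2 =>
      rw [← map_toSubmodule_eq_span] at hy' hz'
      have h3 := congrArg₂ (· + ·) (h1 hy') (h2 hz')
      exact (map_add φ ⟨y, hy'⟩ ⟨z, hz'⟩).trans (h3.trans (map_add ψ ⟨y, hy'⟩ ⟨z, hz'⟩).symm)
    | smul b y hy' h1 =>
      rw [← map_toSubmodule_eq_span] at hy'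
      have h3 := congrArg (b • ·) (h1 hy')
      exact (map_smul φ b ⟨y, hy'⟩).trans (h3.trans (map_smul ψ b ⟨y, hy'⟩).symm)
  let j : Module.Dual A N.toSubmodule →ₛₗ[f.toRingHom]
        Module.Dual B (Module.Grassmannian.map f N).toSubmodule :=
    { toFun := fun ξ => (formMap f (ξ ∘ₗ p)) ∘ₗ (Submodule.subtype _)
      map_add' := fun ξ η => key _ _ fun x hx => by
        simp [formMap_scalarMap]
      map_smul' := fun c ξ => key _ _ fun x hx => by
        simp [formMap_scalarMap] }
  refine ⟨j, fun ξ => key _ _ fun x hx => ?_⟩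
  change formMap f _ (scalarMap f U x) = dualEv B _ (scalarMap f U x)
  rw [formMap_scalarMap, dualEv_scalarMap, LinearMap.comp_apply]
  rw [show p x = ⟨x, hx⟩ from hp ⟨x, hx⟩]
  rfl

/-- The annihilator of a base change is generated by the annihilator. -/
theorem ker_dualRestrict_map_le [FiniteDimensional k U] {r : ℕ}
    (N : Module.Grassmannian A (A ⊗[k] U) r) :
    LinearMap.ker (dualRestrict (Module.Grassmannian.map f N).toSubmodule) ≤
      Submodule.span B (scalarMap f (Module.Dual k U) ''
        (LinearMap.ker (dualRestrict N.toSubmodule) : Set (A ⊗[k] Module.Dual k U))) := by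
  obtain ⟨e, he, he'⟩ := exists_idem N
  intro ξ hξ
  let b := Module.finBasis k U
  have hb : ∀ {C : Type u} [CommRing C] [Algebra k C] (ζ : C ⊗[k] Module.Dual k U),
      ζ = ∑ i, (dualEv C ζ (1 ⊗ₜ b i)) ⊗ₜ[k] b.coord i := by
    intro C _ _ ζ
    induction ζ with
    | zero => simp
    | tmul c ζ =>
      conv_lhs => rw [← b.sum_dual_apply_smul_coord ζ, TensorProduct.tmul_sum]
      simp [TensorProduct.smul_tmul']
    | add ζ η hζ hη =>
      conv_lhs => rw [hζ, hη]
      simp only [map_add, LinearMap.add_apply, TensorProduct.add_tmul, Finset.sum_add_distrib]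
  have hb' : ∀ x : A ⊗[k] U, x = ∑ i, (dualEv A (1 ⊗ₜ b.coord i) x) ⊗ₜ[k] b i := by
    intro x
    induction x with
    | zero => simp
    | tmul c x =>
      conv_lhs => rw [← b.sum_repr x, TensorProduct.tmul_sum]
      simp [TensorProduct.smul_tmul']
    | add x y hx hy =>
      conv_lhs => rw [hx, hy]
      simp only [map_add, TensorProduct.add_tmul, Finset.sum_add_distrib]
  let η : Fin (Module.finrank k U) → A ⊗[k] Module.Dual k U := fun j =>
    ∑ i, (dualEv A (1 ⊗ₜ b.coord j) (e (1 ⊗ₜ b i))) ⊗ₜ[k] b.coord i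
  have hη : ∀ j x, dualEv A (η j) x = dualEv A (1 ⊗ₜ b.coord j) (e x) := by
    intro j x
    have h1 : (dualEv A (1 ⊗ₜ b.coord j)) (e x) =
        ∑ i, (dualEv A (1 ⊗ₜ b.coord i) x) * (dualEv A (1 ⊗ₜ b.coord j)) (e (1 ⊗ₜ b i)) := by
      conv_lhs => rw [hb' x]
      rw [map_sum, map_sum]
      refine Finset.sum_congr rfl fun i _ => ?_
      have : ∀ a : A, a ⊗ₜ[k] b i = a • ((1 : A) ⊗ₜ[k] b i) := fun a => by
        rw [TensorProduct.smul_tmul', smul_eq_mul, mul_one]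
      rw [this, map_smul, map_smul, smul_eq_mul]
    rw [h1]
    simp only [η, map_sum, LinearMap.sum_apply]
    refine Finset.sum_congr rfl fun i _ => ?_
    have : ∀ a : A, a ⊗ₜ[k] b.coord i = a • ((1 : A) ⊗ₜ[k] b.coord i) := fun a => by
      rw [TensorProduct.smul_tmul', smul_eq_mul, mul_one]
    rw [this, map_smul, LinearMap.smul_apply, smul_eq_mul, mul_comm]
  have hηN : ∀ j, η j ∈ LinearMap.ker (dualRestrict N.toSubmodule) := by
    intro j
    rw [LinearMap.mem_ker]
    apply LinearMap.ext
    intro x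
    rw [dualRestrict_apply, hη, he x x.2, map_zero]
    rfl
  have hξN : ∀ x ∈ N.toSubmodule, dualEv B ξ (scalarMap f U x) = 0 := fun x hx =>
    LinearMap.congr_fun (LinearMap.mem_ker.1 hξ) ⟨_, scalarMap_mem_map f N hx⟩
  have h1 : ∀ i, dualEv B ξ (1 ⊗ₜ b i) =
      ∑ j, f (dualEv A (1 ⊗ₜ b.coord j) (e (1 ⊗ₜ b i))) * dualEv B ξ (1 ⊗ₜ b j) := by
    intro i
    have h2 := hξN _ (he' (1 ⊗ₜ b i))
    rw [map_sub, map_sub, sub_eq_zero, scalarMap_tmul, map_one] at h2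
    rw [h2]
    conv_lhs => rw [hb' (e (1 ⊗ₜ b i))]
    rw [map_sum, map_sum]
    refine Finset.sum_congr rfl fun j _ => ?_
    have : ∀ a : B, a ⊗ₜ[k] b j = a • ((1 : B) ⊗ₜ[k] b j) := fun a => by
      rw [TensorProduct.smul_tmul', smul_eq_mul, mul_one]
    rw [scalarMap_tmul, this, map_smul, smul_eq_mul]
  have h3 : ξ = ∑ j, dualEv B ξ (1 ⊗ₜ b j) • scalarMap f _ (η j) := by
    conv_lhs =>
      rw [hb ξ, Finset.sum_congr rfl fun i _ => congrArg (· ⊗ₜ[k] b.coord i) (h1 i)]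
    simp only [TensorProduct.sum_tmul]
    rw [Finset.sum_comm]
    refine Finset.sum_congr rfl fun j _ => ?_
    simp only [η, map_sum, Finset.smul_sum, scalarMap_tmul, TensorProduct.smul_tmul', smul_eq_mul]
    refine Finset.sum_congr rfl fun i _ => ?_
    rw [mul_comm]
  rw [h3]
  exact Submodule.sum_mem _ fun j _ =>
    Submodule.smul_mem _ _ (Submodule.subset_span ⟨_, hηN j, rfl⟩)

end

end Bundles

section Spaces

variable {k : Type u} [Field k]

/-!
Schemes over `k` are described by their functors of points on commutative `k`-algebras. The schemes
below are all of finite type over an algebraically closed field, so that the Zariski topology of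
such a scheme is faithfully recorded by the set of its `k`-points.
-/

/-- A subfunctor `S` of `F` is open if for every point `x` of `F` over an algebra `A`, the locus in
`Spec A` where `x` belongs to `S` is an open subscheme, namely the complement of the zero locus
of some ideal. -/
def IsOpenSub {F : CommAlgCat.{u} k ⥤ Type w} (S : Subfunctor F) : Prop :=
  ∀ (A : CommAlgCat.{u} k) (x : F.obj A), ∃ I : Ideal A,
    ∀ (B : CommAlgCat.{u} k) (f : A ⟶ B), F.map f x ∈ S.obj B ↔ I.map f.hom = ⊤

/-- The set of `k`-points of `F`. -/
def Points (F : CommAlgCat.{u} k ⥤ Type w) : Type w := F.obj (CommAlgCat.of k k)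

/-- The `k`-points of a subfunctor, as a set of `k`-points. -/
def pointsOf {F : CommAlgCat.{u} k ⥤ Type w} (S : Subfunctor F) : Set (Points F) :=
  S.obj (CommAlgCat.of k k)

/-- The Zariski topology on the `k`-points: the open sets are the sets of `k`-points of the open
subfunctors. -/
instance (F : CommAlgCat.{u} k ⥤ Type w) : TopologicalSpace (Points F) :=
  TopologicalSpace.generateFrom {s | ∃ S : Subfunctor F, IsOpenSub S ∧ s = pointsOf S}

/-- `F` and `G` are birational: a dense open subscheme of `F` is isomorphic, over `k`, to a dense
open subscheme of `G`. -/
def Birational (F G : CommAlgCat.{u} k ⥤ Type w) : Prop :=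
  ∃ (S : Subfunctor F) (T : Subfunctor G),
    (IsOpenSub S ∧ Dense (pointsOf S)) ∧ (IsOpenSub T ∧ Dense (pointsOf T)) ∧
      Nonempty (S.toFunctor ≅ T.toFunctor)

end Spaces

section Determinantal

variable {k : Type u} [Field k]

/-- The Grassmannian `𝔾(U, r)` of `r`-dimensional quotients of `U`. An `A`-point is the kernel `N` of
a quotient `A ⊗ U → Q` that is locally free of rank `r`: so `N` is the universal subbundle, and
`(A ⊗ U) ⧸ N` the universal quotient bundle. -/
noncomputable abbrev Gr (k : Type u) [Field k] (U : Type v) [AddCommGroup U] [Module k U] (r : ℕ) :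
    CommAlgCat.{u} k ⥤ Type (max u v) :=
  Module.Grassmannian.functor (R := k) (M := U) r

/-- An `A`-point of the Grassmannian, as a submodule of `A ⊗ U`. -/
def pt {U : Type v} [AddCommGroup U] [Module k U] {r : ℕ} {A : CommAlgCat.{u} k}
    (N : (Gr k U r).obj A) : Module.Grassmannian A (A ⊗[k] U) r := N

/-- The projective space `ℙ W` of one-dimensional quotients of `W`. -/
noncomputable abbrev ProjSpace (k : Type u) [Field k] (W : Type v) [AddCommGroup W] [Module k W] :
    CommAlgCat.{u} k ⥤ Type (max u v) :=
  Gr k W 1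

/-- The linear subspace `ℙ (W / L)` of `ℙ W`, whose equations are the elements of `L`. -/
def linearSubspace {W : Type v} [AddCommGroup W] [Module k W] (L : Submodule k W) :
    Subfunctor (ProjSpace k W) where
  obj A := {P | ∀ l ∈ L, (1 : A) ⊗ₜ[k] l ∈ (pt P).toSubmodule}
  map {A B} f P hP l hl := by
    have h := scalarMap_mem_map f.hom (pt P) (hP l hl)
    rwa [scalarMap_tmul, map_one] at h

variable {U V : Type v} [AddCommGroup U] [Module k U] [AddCommGroup V] [Module k V]

/-- The projective bundle `𝒳 = ℙ (V ⊗ 𝒬)` over `𝔾(U, r)`, embedded into `𝔾(U, r) × ℙ (U ⊗ V)`. Its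
`A`-points are pairs of a point `N` of the Grassmannian and a rank one quotient of `A ⊗ U ⊗ V` that
vanishes on `N ⊗ V`, that is, a rank one quotient of `((A ⊗ U) ⧸ N) ⊗ V`. -/
def bundleX (k : Type u) [Field k] (U V : Type v) [AddCommGroup U] [Module k U] [AddCommGroup V]
    [Module k V] (r : ℕ) :
    Subfunctor (FunctorToTypes.prod (Gr k U r) (ProjSpace k (U ⊗[k] V))) where
  obj A := {p | ∀ v : V, ∀ x ∈ (pt p.1).toSubmodule, tensorVec A v x ∈ (pt p.2).toSubmodule}
  map {A B} f p hp v y hy := by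
    change tensorVec B v y ∈ (Module.Grassmannian.map f.hom (pt p.2)).toSubmodule
    replace hy : y ∈ (Module.Grassmannian.map f.hom (pt p.1)).toSubmodule := hy
    rw [map_toSubmodule_eq_span] at hy
    induction hy using Submodule.span_induction with
    | mem y hy =>
      obtain ⟨x, hx, rfl⟩ := hy
      rw [tensorVec_scalarMap]
      exact scalarMap_mem_map f.hom (pt p.2) (hp v x hx)
    | zero => rw [map_zero]; exact Submodule.zero_mem _
    | add y z _ _ h1 h2 => rw [map_add]; exact Submodule.add_mem _ h1 h2
    | smul b y _ h1 => rw [map_smul]; exact Submodule.smul_mem _ b h1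

/-- The projective bundle `𝒴 = ℙ (V^∨ ⊗ 𝒰^∨)` over `𝔾(U, r)`, embedded into
`𝔾(U, r) × ℙ (U^∨ ⊗ V^∨)`. Its `A`-points are pairs of a point `N` of the Grassmannian and a rank one
quotient of `A ⊗ U^∨ ⊗ V^∨` that vanishes on `N^⊥ ⊗ V^∨`, where `N^⊥` is the kernel of the
surjection `A ⊗ U^∨ → N^∨`, that is, a rank one quotient of `N^∨ ⊗ V^∨`. -/
def bundleY (k : Type u) [Field k] (U V : Type v) [AddCommGroup U] [Module k U]
    [FiniteDimensional k U] [AddCommGroup V] [Module k V] (r : ℕ) :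
    Subfunctor (FunctorToTypes.prod (Gr k U r)
      (ProjSpace k (Module.Dual k U ⊗[k] Module.Dual k V))) where
  obj A := {p | ∀ φ : Module.Dual k V, ∀ ξ ∈ LinearMap.ker (dualRestrict (pt p.1).toSubmodule),
    tensorVec A φ ξ ∈ (pt p.2).toSubmodule}
  map {A B} f p hp φ ξ hξ := by
    change tensorVec B φ ξ ∈ (Module.Grassmannian.map f.hom (pt p.2)).toSubmodule
    replace hξ := ker_dualRestrict_map_le f.hom (pt p.1) hξ
    induction hξ using Submodule.span_induction with
    | mem y hy =>
      obtain ⟨x, hx, rfl⟩ := hy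
      rw [tensorVec_scalarMap]
      exact scalarMap_mem_map f.hom (pt p.2) (hp φ x hx)
    | zero => rw [map_zero]; exact Submodule.zero_mem _
    | add y z _ _ h1 h2 => rw [map_add]; exact Submodule.add_mem _ h1 h2
    | smul b y _ h1 => rw [map_smul]; exact Submodule.smul_mem _ b h1

/-- The orthogonal `L^⊥ ⊆ U^∨ ⊗ V^∨` of a subspace `L` of `U ⊗ V`. -/
noncomputable def orth (L : Submodule k (U ⊗[k] V)) :
    Submodule k (Module.Dual k U ⊗[k] Module.Dual k V) :=
  L.dualAnnihilator.comap (TensorProduct.dualDistrib k U V)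

/-- `X_L = 𝒳 ×_{ℙ W} ℙ (W / L)` for `W = U ⊗ V`. -/
noncomputable def linX (r : ℕ) (L : Submodule k (U ⊗[k] V)) :
    Subfunctor (FunctorToTypes.prod (Gr k U r) (ProjSpace k (U ⊗[k] V))) :=
  bundleX k U V r ⊓ (linearSubspace L).preimage FunctorToTypes.prod.snd

/-- `Y_L = 𝒴 ×_{ℙ W^∨} ℙ (W^∨ / L^⊥)` for `W^∨ = U^∨ ⊗ V^∨`. -/
noncomputable def linY [FiniteDimensional k U] (r : ℕ) (L : Submodule k (U ⊗[k] V)) :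
    Subfunctor (FunctorToTypes.prod (Gr k U r)
      (ProjSpace k (Module.Dual k U ⊗[k] Module.Dual k V))) :=
  bundleY k U V r ⊓ (linearSubspace (orth L)).preimage FunctorToTypes.prod.snd

/-- The morphism `L ⊗ 𝒪 → W ⊗ 𝒪 → F ⊗ V` induced by a subspace `L` of `W = U ⊗ V` and a morphism
`g : U ⊗ 𝒪 → F`. -/
noncomputable def sectionMap {A : Type u} [CommRing A] [Algebra k A] {F : Type*} [AddCommGroup F]
    [Module k F] [Module A F] [IsScalarTower k A F] (g : A ⊗[k] U →ₗ[A] F)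
    (L : Submodule k (U ⊗[k] V)) : A ⊗[k] L →ₗ[A] F ⊗[k] V :=
  tensorMap g V ∘ₗ L.subtype.baseChange A

/-- The exterior power of order `d` of `sectionMap g L` vanishes. If source and target have rank `d`,
this says that the determinant vanishes. -/
def DetVanishes {A : Type u} [CommRing A] [Algebra k A] {F : Type*} [AddCommGroup F]
    [Module k F] [Module A F] [IsScalarTower k A F] (d : ℕ) (g : A ⊗[k] U →ₗ[A] F)
    (L : Submodule k (U ⊗[k] V)) : Prop :=
  exteriorPower.map d (sectionMap g L) = 0

theorem DetVanishes.map {A B : Type u} [CommRing A] [Algebra k A] [CommRing B] [Algebra k B]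
    {f : A →ₐ[k] B} {E F : Type*} [AddCommGroup E] [Module k E] [Module A E]
    [IsScalarTower k A E] [AddCommGroup F] [Module k F] [Module B F] [IsScalarTower k B F]
    {j : E →ₛₗ[f.toRingHom] F} {g : A ⊗[k] U →ₗ[A] E} {g' : B ⊗[k] U →ₗ[B] F}
    (hj : ∀ x, j (g x) = g' (scalarMap f U x)) {L : Submodule k (U ⊗[k] V)} {d : ℕ}
    (h : DetVanishes d g L) : DetVanishes d g' L := by
  obtain ⟨J, hJ⟩ := exists_tensorMap f j g g' hj V
  refine exteriorPower_map_eq_zero f d _ _ J (fun l => ?_) h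
  simpa [sectionMap] using hJ ((1 : A) ⊗ₜ[k] (l : U ⊗[k] V))

/-- The closed subscheme `D_L = 𝕍(det M_L)` of `𝔾(U, r)`, for the morphism `M_L : L ⊗ 𝒪 → V ⊗ 𝒬` to a
bundle of rank `n r`. -/
def lowerD (r : ℕ) (L : Submodule k (U ⊗[k] V)) : Subfunctor (Gr k U r) where
  obj _ := {N | DetVanishes (Module.finrank k V * r) (pt N).toSubmodule.mkQ L}
  map f N hN := (exists_quotMap f.hom (pt N)).elim fun _ hj => DetVanishes.map hj hN

/-- The closed subscheme `D^L = 𝕍(det M^L)` of `𝔾(U, r)`, for the morphism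
`M^L : L^⊥ ⊗ 𝒪 → V^∨ ⊗ 𝒰^∨` to a bundle of rank `n (m - r)`. -/
def upperD (r : ℕ) (L : Submodule k (U ⊗[k] V)) : Subfunctor (Gr k U r) where
  obj _ := {N | DetVanishes (Module.finrank k V * (Module.finrank k U - r))
    (dualRestrict (pt N).toSubmodule) (orth L)}
  map f N hN := (exists_dualMap f.hom (pt N)).elim fun _ hj => DetVanishes.map hj hN

/-- `L` is admissible: `X_L` and `Y_L` have the expected dimensions `dim 𝒳 - dim L` and
`dim 𝒴 - dim L^⊥`, where `dim 𝒳 = r (n + m - r) - 1` and `dim 𝒴 = (m - r) (n + r) - 1`. -/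
def Admissible [FiniteDimensional k U] (r : ℕ) (L : Submodule k (U ⊗[k] V)) : Prop :=
  topologicalKrullDim (Points (linX r L).toFunctor) + ((Module.finrank k L + 1 : ℕ) : WithBot ℕ∞) =
      ((r * (Module.finrank k V + (Module.finrank k U - r)) : ℕ) : WithBot ℕ∞) ∧
    topologicalKrullDim (Points (linY r L).toFunctor) +
        ((Module.finrank k (orth L) + 1 : ℕ) : WithBot ℕ∞) =
      (((Module.finrank k U - r) * (Module.finrank k V + r) : ℕ) : WithBot ℕ∞)

end Determinantal

end DetBirational

namespace DetBirational

section LinearAlgebra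

variable {R : Type*} [CommRing R] {P : Type*} [AddCommGroup P] [Module R P]

/-- An alternating map that vanishes on a set vanishes on its span. -/
theorem alternatingMap_eq_zero_of_mem_span {ι : Type*} [Fintype ι] [DecidableEq ι]
    {N : Type*} [AddCommGroup N] [Module R N] (g : P [⋀^ι]→ₗ[R] N) (S : Set P)
    (h : ∀ y : ι → P, (∀ i, y i ∈ S) → g y = 0) (y : ι → P)
    (hy : ∀ i, y i ∈ Submodule.span R S) : g y = 0 := by
  have key : ∀ (t : Finset ι) (y : ι → P), (∀ i ∈ t, y i ∈ Submodule.span R S) →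
      (∀ i ∉ t, y i ∈ S) → g y = 0 := by
    intro t
    induction t using Finset.induction_on with
    | empty => exact fun y _ h2 => h y fun i => h2 i (Finset.notMem_empty i)
    | insert a t ha ih =>
      intro y h1 h2
      have h3 : ∀ z ∈ Submodule.span R S, g (Function.update y a z) = 0 := by
        intro z hz
        induction hz using Submodule.span_induction with
        | mem z hz =>
          refine ih _ (fun i hi => ?_) (fun i hi => ?_)
          · have e : i ≠ a := fun e => ha (by rwa [← e])
            rw [Function.update_of_ne e]
            exact h1 i (Finset.mem_insert_of_mem hi)
          · by_cases e : i = a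
            · subst e; simpa using hz
            · rw [Function.update_of_ne e]
              exact h2 i (by simp [e, hi])
        | zero => exact g.map_update_zero y a
        | add x z _ _ hx hz => rw [g.map_update_add, hx, hz, add_zero]
        | smul c x _ hx => rw [g.map_update_smul, hx, smul_zero]
      simpa using h3 (y a) (h1 a (Finset.mem_insert_self a t))
  exact key Finset.univ y (fun i _ => hy i) fun i hi => absurd (Finset.mem_univ i) hi

variable {ι : Type*} [Fintype ι] [DecidableEq ι]

/-- Cramer's rule. -/
theorem basis_det_smul (β : Module.Basis ι R P) (y : ι → P) (p : P) :
    β.det y • p = ∑ i, β.det (Function.update y i p) • y i := by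
  apply β.repr.injective
  ext l
  have h := congrFun (Matrix.mulVec_cramer (β.toMatrix y) (β.repr p)) l
  rw [map_smul, map_sum, Finsupp.smul_apply, Finsupp.finsetSum_apply, Module.Basis.det_apply]
  refine h.symm.trans ?_
  rw [Matrix.mulVec, dotProduct]
  refine Finset.sum_congr rfl fun i _ => ?_
  rw [Matrix.cramer_apply, map_smul, Finsupp.smul_apply, smul_eq_mul, mul_comm,
    Module.Basis.toMatrix_apply, Module.Basis.det_apply, Module.Basis.toMatrix_update]

theorem basis_det_smul_mem (β : Module.Basis ι R P) (y : ι → P) (J : Submodule R P)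
    (hy : ∀ i, y i ∈ J) (p : P) : β.det y • p ∈ J := by
  rw [basis_det_smul]
  exact J.sum_mem fun i _ => J.smul_mem _ (hy i)

/-- The zeroth Fitting ideal of `P ⧸ J` vanishes. -/
def FittingVanishes (β : Module.Basis ι R P) (J : Submodule R P) : Prop :=
  ∀ y : ι → P, (∀ i, y i ∈ J) → β.det y = 0

theorem FittingVanishes.change {β : Module.Basis ι R P} {J : Submodule R P}
    (h : FittingVanishes β J) (γ : Module.Basis ι R P) : FittingVanishes γ J := fun y hy => by
  rw [AlternatingMap.eq_smul_basis_det β γ.det, AlternatingMap.smul_apply, h y hy, smul_zero]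

theorem fittingVanishes_span_iff (β : Module.Basis ι R P) (z : ι → P) :
    FittingVanishes β (Submodule.span R (Set.range z)) ↔ β.det z = 0 := by
  refine ⟨fun h => h z fun i => Submodule.subset_span ⟨i, rfl⟩, fun h y hy => ?_⟩
  choose c hc using fun i => (Submodule.mem_span_range_iff_exists_fun R).1 (hy i)
  have : y = fun i => ((Matrix.toLin β β (Matrix.of fun a b => β.repr (z b) a)) ∘ₗ
      (Matrix.toLin β β (Matrix.of fun a b => c b a))) (β i) := by
    funext i
    rw [LinearMap.comp_apply, Matrix.toLin_self, map_sum, ← hc i]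
    refine Finset.sum_congr rfl fun j _ => ?_
    rw [map_smul, Matrix.toLin_self]
    simp [β.sum_repr]
  rw [this]
  have h2 := β.det_comp ((Matrix.toLin β β (Matrix.of fun a b => β.repr (z b) a)) ∘ₗ
      (Matrix.toLin β β (Matrix.of fun a b => c b a))) β
  simp only [Function.comp_def] at h2
  rw [h2, LinearMap.det_comp, LinearMap.det_toLin]
  have : (Matrix.of fun a b => β.repr (z b) a) = β.toMatrix z := rfl
  rw [this, ← Module.Basis.det_apply, h, zero_mul, zero_mul]

/-- If `β` and `ε` are bases indexed by `I ⊕ I'`, then the Fitting ideal of the quotient by the span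
of the first half of `ε` and the second half of `β` is generated by a block of the matrix of
base change. -/
theorem fittingVanishes_sup_iff {I I' : Type*} [Fintype I] [Fintype I'] [DecidableEq I]
    [DecidableEq I'] (γ β ε : Module.Basis (I ⊕ I') R P) :
    FittingVanishes γ (Submodule.span R (Set.range (ε ∘ Sum.inl)) ⊔
        Submodule.span R (Set.range (β ∘ Sum.inr))) ↔
      (Matrix.of fun i j => β.coord (Sum.inl i) (ε (Sum.inl j))).det = 0 := by
  have h1 : Submodule.span R (Set.range (ε ∘ Sum.inl)) ⊔
        Submodule.span R (Set.range (β ∘ Sum.inr)) =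
      Submodule.span R (Set.range (Sum.elim (ε ∘ Sum.inl) (β ∘ Sum.inr))) := by
    rw [Set.Sum.elim_range, Submodule.span_union]
  have h2 : β.toMatrix (Sum.elim (ε ∘ Sum.inl) (β ∘ Sum.inr)) =
      Matrix.fromBlocks (Matrix.of fun i j => β.coord (Sum.inl i) (ε (Sum.inl j))) 0
        (Matrix.of fun i j => β.coord (Sum.inr i) (ε (Sum.inl j))) 1 := by
    ext (i | i) (j | j)
    · simp [Module.Basis.toMatrix_apply]
    · simp [Module.Basis.toMatrix_apply]
    · simp [Module.Basis.toMatrix_apply]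
    · simp [Module.Basis.toMatrix_apply, Finsupp.single_apply, Matrix.one_apply, eq_comm]
  rw [h1]
  refine ⟨fun h => ?_, fun h => ?_⟩
  · have h3 := (fittingVanishes_span_iff β _).1 (h.change β)
    rwa [Module.Basis.det_apply, h2, Matrix.det_fromBlocks_zero₁₂, Matrix.det_one, mul_one] at h3
  · refine FittingVanishes.change ((fittingVanishes_span_iff β _).2 ?_) γ
    rw [Module.Basis.det_apply, h2, Matrix.det_fromBlocks_zero₁₂, h, zero_mul]

/-- A set of vectors that spans a vector space contains a basis. -/
theorem exists_basis_of_span_eq_top {K E : Type*} [Field K] [AddCommGroup E] [Module K E]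
    (β : Module.Basis ι K E) (S : Set E) (hS : Submodule.span K S = ⊤) :
    ∃ y : ι → E, (∀ i, y i ∈ S) ∧ β.det y ≠ 0 := by
  obtain ⟨b, hb, hspan, hli⟩ := exists_linearIndependent K S
  let e : Module.Basis b K E := Module.Basis.mk hli (by rw [Subtype.range_coe, hspan, hS])
  let e' := e.reindex (e.indexEquiv β)
  refine ⟨e', fun i => ?_, (β.isUnit_det e').ne_zero⟩
  have : e' i = ((e.indexEquiv β).symm i : E) := by simp [e', e]
  rw [this]
  exact hb (Subtype.coe_prop _)

end LinearAlgebra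

section BaseChange

variable {k : Type u} [CommRing k] {M : Type v} [AddCommGroup M] [Module k M]
variable {A B : Type u} [CommRing A] [Algebra k A] [CommRing B] [Algebra k B] (f : A →ₐ[k] B)

/-- The submodule of `B ⊗ M` generated by a submodule of `A ⊗ M`. -/
def spanMap (Y : Submodule A (A ⊗[k] M)) : Submodule B (B ⊗[k] M) :=
  Submodule.span B (scalarMap f M '' (Y : Set (A ⊗[k] M)))

theorem scalarMap_mem_spanMap {Y : Submodule A (A ⊗[k] M)} {x : A ⊗[k] M} (hx : x ∈ Y) :
    scalarMap f M x ∈ spanMap f Y := Submodule.subset_span ⟨x, hx, rfl⟩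

theorem spanMap_span (S : Set (A ⊗[k] M)) :
    spanMap f (Submodule.span A S) = Submodule.span B (scalarMap f M '' S) := by
  apply le_antisymm
  · refine Submodule.span_le.2 ?_
    rintro _ ⟨x, hx, rfl⟩
    change x ∈ Submodule.span A S at hx
    induction hx using Submodule.span_induction with
    | mem x hx => exact Submodule.subset_span ⟨x, hx, rfl⟩
    | zero => rw [map_zero]; exact zero_mem _
    | add x y _ _ hx hy => rw [map_add]; exact add_mem hx hy
    | smul a x _ hx => rw [scalarMap_smul]; exact Submodule.smul_mem _ _ hx
  · exact Submodule.span_mono (Set.image_mono Submodule.subset_span)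

theorem spanMap_sup (Y Z : Submodule A (A ⊗[k] M)) :
    spanMap f (Y ⊔ Z) = spanMap f Y ⊔ spanMap f Z := by
  conv_lhs => rw [← Submodule.span_eq Y, ← Submodule.span_eq Z, ← Submodule.span_union,
    spanMap_span, Set.image_union, Submodule.span_union]
  rfl

theorem spanMap_top : spanMap f (⊤ : Submodule A (A ⊗[k] M)) = ⊤ := by
  rw [eq_top_iff]
  intro x _
  induction x with
  | zero => exact zero_mem _
  | tmul b m =>
    have : b ⊗ₜ[k] m = b • scalarMap f M (1 ⊗ₜ m) := by
      rw [scalarMap_tmul, map_one, TensorProduct.smul_tmul', smul_eq_mul, mul_one]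
    rw [this]
    exact Submodule.smul_mem _ _ (scalarMap_mem_spanMap f trivial)
  | add x y hx hy => exact add_mem (hx trivial) (hy trivial)

theorem basis_repr_scalarMap {ι : Type*} (β : Module.Basis ι k M) (x : A ⊗[k] M) (i : ι) :
    (β.baseChange B).repr (scalarMap f M x) i = f ((β.baseChange A).repr x i) := by
  induction x with
  | zero => simp
  | tmul a m => simp
  | add x y hx hy => simp only [map_add, Finsupp.add_apply, hx, hy]

variable {ι : Type*} [Fintype ι] [DecidableEq ι]

theorem det_scalarMap (β : Module.Basis ι k M) (y : ι → A ⊗[k] M) :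
    (β.baseChange B).det (fun i => scalarMap f M (y i)) = f ((β.baseChange A).det y) := by
  rw [Module.Basis.det_apply, Module.Basis.det_apply, AlgHom.map_det]
  congr 1
  ext i j
  simp [Module.Basis.toMatrix_apply, basis_repr_scalarMap]

theorem FittingVanishes.spanMap {β : Module.Basis ι k M} {Y : Submodule A (A ⊗[k] M)}
    (h : FittingVanishes (β.baseChange A) Y) :
    FittingVanishes (β.baseChange B) (spanMap f Y) := fun y hy => by
  refine alternatingMap_eq_zero_of_mem_span _ _ (fun y hy => ?_) y hy
  choose x hx hxy using hy
  rw [← funext hxy, det_scalarMap, h x hx, map_zero]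

theorem exists_det_ne_zero_of_spanMap_eq_top {K : Type u} [Field K] [Algebra k K] (g : A →ₐ[k] K)
    (β : Module.Basis ι k M) {S : Set (A ⊗[k] M)}
    (h : Submodule.span K (scalarMap g M '' S) = ⊤) :
    ∃ y : ι → A ⊗[k] M, (∀ i, y i ∈ S) ∧ g ((β.baseChange A).det y) ≠ 0 := by
  obtain ⟨z, hz, hdet⟩ := exists_basis_of_span_eq_top (β.baseChange K) _ h
  choose y hy hyz using hz
  refine ⟨y, hy, ?_⟩
  rwa [← det_scalarMap, funext hyz]

theorem exists_mem_colon_of_spanMap_eq_top {K : Type u} [Field K] [Algebra k K] (g : A →ₐ[k] K)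
    (β : Module.Basis ι k M) {Y : Submodule A (A ⊗[k] M)} (h : spanMap g Y = ⊤) :
    ∃ a ∈ Y.colon Set.univ, g a ≠ 0 := by
  obtain ⟨y, hy, hdet⟩ := exists_det_ne_zero_of_spanMap_eq_top g β h
  exact ⟨_, Submodule.mem_colon.2 fun p _ => basis_det_smul_mem _ y Y hy p, hdet⟩

theorem scalarMap_comp {C : Type u} [CommRing C] [Algebra k C] (g : B →ₐ[k] C) (x : A ⊗[k] M) :
    scalarMap (g.comp f) M x = scalarMap g M (scalarMap f M x) := by
  induction x with
  | zero => simp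
  | tmul a m => simp
  | add x y hx hy => simp only [map_add, hx, hy]

theorem spanMap_comp {C : Type u} [CommRing C] [Algebra k C] (g : B →ₐ[k] C)
    (Y : Submodule A (A ⊗[k] M)) : spanMap (g.comp f) Y = spanMap g (spanMap f Y) := by
  change _ = spanMap g (Submodule.span B _)
  rw [spanMap_span, ← Set.image_comp, spanMap]
  congr 1
  exact Set.image_congr fun x _ => scalarMap_comp f g x

end BaseChange

section Grassmannian

variable {R : Type*} [CommRing R] {M : Type*} [AddCommGroup M] [Module R M] {r : ℕ}

theorem grassmannian_le_antisymm {N H : Module.Grassmannian R M r}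
    (h : N.toSubmodule ≤ H.toSubmodule) : N = H := by
  have hs : Function.Surjective (Submodule.factor h) := Submodule.factor_surjective h
  have hb := Module.bijective_of_surjective_of_rankAtStalk_eq hs fun m _ => by
    rw [N.rankAtStalk_eq, H.rankAtStalk_eq]
  refine Module.Grassmannian.ext (le_antisymm h fun x hx => ?_)
  rw [← Submodule.Quotient.mk_eq_zero] at hx ⊢
  exact hb.1 (by rw [map_zero]; exact hx)

/-- A locally free module of positive rank is faithful. -/
theorem grassmannian_faithful (N : Module.Grassmannian R M r) (hr : 0 < r) (a : R)
    (ha : ∀ x, a • x ∈ N.toSubmodule) : a = 0 := by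
  refine eq_zero_of_localization a fun m hm => ?_
  have : Module.Free (Localization.AtPrime m) (LocalizedModule m.primeCompl (M ⧸ N.toSubmodule)) :=
    Module.free_of_flat_of_isLocalRing
  have h1 : Module.finrank (Localization.AtPrime m)
      (LocalizedModule m.primeCompl (M ⧸ N.toSubmodule)) = r := N.rankAtStalk_eq ⟨m, inferInstance⟩
  let b := Module.finBasisOfFinrankEq _ _ h1
  have h2 : ∀ y : LocalizedModule m.primeCompl (M ⧸ N.toSubmodule),
      algebraMap R (Localization.AtPrime m) a • y = 0 := by
    intro y
    induction y using LocalizedModule.induction_on with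
    | h x t =>
      obtain ⟨x, rfl⟩ := N.toSubmodule.mkQ_surjective x
      rw [algebraMap_smul, LocalizedModule.smul'_mk, ← map_smul, Submodule.mkQ_apply,
        (Submodule.Quotient.mk_eq_zero _).2 (ha x), LocalizedModule.zero_mk]
  have h3 := congrArg (fun y => b.repr y ⟨0, hr⟩) (h2 (b ⟨0, hr⟩))
  rw [map_smul, Module.Basis.repr_self, Finsupp.smul_single, Finsupp.single_eq_same, smul_eq_mul,
    mul_one, map_zero, Finsupp.zero_apply] at h3
  exact h3

/-- The point of the Grassmannian defined by half of a basis. -/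
noncomputable def grassmannianOfBasis {κ : Type*} (b : Module.Basis (Fin r ⊕ κ) R M) :
    Module.Grassmannian R M r :=
  let p : M →ₗ[R] (Fin r → R) := LinearMap.pi fun i => b.coord (Sum.inl i)
  have hp : Function.Surjective p := fun c => ⟨∑ i, c i • b (Sum.inl i), by
    ext i
    rw [LinearMap.pi_apply, map_sum, Finset.sum_eq_single i] <;> simp +contextual⟩
  have hk : Submodule.span R (Set.range (b ∘ Sum.inr)) = LinearMap.ker p := by
    apply le_antisymm
    · rw [Submodule.span_le]
      rintro _ ⟨i, rfl⟩
      ext j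
      simp [p]
    · intro x hx
      rw [Set.range_comp, b.mem_span_image]
      intro i hi
      obtain i | i := i
      · exact absurd (congrFun hx i) (Finsupp.mem_support_iff.1 hi)
      · exact ⟨i, rfl⟩
  let e : (M ⧸ Submodule.span R (Set.range (b ∘ Sum.inr))) ≃ₗ[R] (Fin r → R) :=
    (Submodule.quotEquivOfEq _ _ hk).trans (p.quotKerEquivOfSurjective hp)
  { toSubmodule := Submodule.span R (Set.range (b ∘ Sum.inr))
    finite_quotient := Module.Finite.equiv e.symm
    projective_quotient := Module.Projective.of_equiv e.symm
    rankAtStalk_eq := fun p => by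
      have := p.nontrivial
      rw [Module.rankAtStalk_eq_of_equiv e, Module.rankAtStalk_eq_finrank_of_free]
      simp }

/-- A point of a Grassmannian over a local ring is defined by half of a basis. -/
theorem exists_adapted_basis [IsLocalRing R] [Module.Free R M] [Module.Finite R M]
    (N : Module.Grassmannian R M r) :
    ∃ b : Module.Basis (Fin r ⊕ Fin (Module.finrank R M - r)) R M,
      N.toSubmodule = Submodule.span R (Set.range (b ∘ Sum.inr)) := by
  obtain ⟨s, hs⟩ := Module.projective_lifting_property N.toSubmodule.mkQ LinearMap.id
    N.toSubmodule.mkQ_surjective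
  have hs' : ∀ y, N.toSubmodule.mkQ (s y) = y := fun y => LinearMap.congr_fun hs y
  let p : M →ₗ[R] N.toSubmodule := (LinearMap.id - s ∘ₗ N.toSubmodule.mkQ).codRestrict _ fun x => by
    rw [← Submodule.Quotient.mk_eq_zero, ← Submodule.mkQ_apply]
    simp only [LinearMap.sub_apply, LinearMap.id_apply, LinearMap.comp_apply, map_sub, hs',
      sub_self]
  have hp : p ∘ₗ N.toSubmodule.subtype = LinearMap.id := by
    ext x
    have : N.toSubmodule.mkQ (x : M) = 0 := (Submodule.Quotient.mk_eq_zero _).2 x.2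
    simp only [LinearMap.comp_apply, Submodule.subtype_apply, p, LinearMap.codRestrict_apply,
      LinearMap.sub_apply, this, map_zero, sub_zero]
    rfl
  have hfin : Module.Finite R N.toSubmodule := Module.Finite.of_surjective p fun x =>
    ⟨x, LinearMap.congr_fun hp x⟩
  have hproj : Module.Projective R N.toSubmodule := Module.Projective.of_split _ _ hp
  have : Module.Free R N.toSubmodule := Module.free_of_flat_of_isLocalRing
  have : Module.Free R (M ⧸ N.toSubmodule) := Module.free_of_flat_of_isLocalRing
  have hQ : Module.finrank R (M ⧸ N.toSubmodule) = r := by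
    have := N.rankAtStalk_eq (IsLocalRing.closedPoint R)
    rwa [Module.rankAtStalk_eq_finrank_of_free] at this
  have hps : ∀ y, p (s y) = 0 := fun y => by
    apply Subtype.ext
    simp only [p, LinearMap.codRestrict_apply, LinearMap.sub_apply, LinearMap.id_apply,
      LinearMap.comp_apply, hs', sub_self, ZeroMemClass.coe_zero]
  let e : ((M ⧸ N.toSubmodule) × N.toSubmodule) ≃ₗ[R] M :=
    LinearEquiv.ofLinearMap (LinearMap.coprod s N.toSubmodule.subtype)
      (LinearMap.prod N.toSubmodule.mkQ p) (by ext x; simp [p]) (by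
        apply LinearMap.prod_ext
        · refine LinearMap.ext fun y => Prod.ext ?_ ?_
          · simpa using hs' y
          · simpa using hps y
        · refine LinearMap.ext fun y => Prod.ext ?_ ?_
          · simp
          · simpa using LinearMap.congr_fun hp y)
  have hN : Module.finrank R N.toSubmodule = Module.finrank R M - r := by
    have := e.finrank_eq
    rw [Module.finrank_prod, hQ] at this
    omega
  let bQ := Module.finBasisOfFinrankEq R (M ⧸ N.toSubmodule) hQ
  let bN := Module.finBasisOfFinrankEq R N.toSubmodule hN
  refine ⟨(bQ.prod bN).map e, ?_⟩
  have : ((bQ.prod bN).map e) ∘ Sum.inr = N.toSubmodule.subtype ∘ bN := by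
    ext i; simp [e]
  rw [this, Set.range_comp, ← Submodule.map_span, bN.span_eq, Submodule.map_subtype_top]

end Grassmannian

section Exterior

/-- Over a finite projective module, the top exterior power of a map from a free module is detected
by determinants. -/
theorem exteriorPower_map_eq_zero_iff {A : Type*} [CommRing A] {I : Type*} [Fintype I]
    [DecidableEq I] {d : ℕ} (hd : Fintype.card I = d) {M E : Type*} [AddCommGroup M] [Module A M]
    [AddCommGroup E] [Module A E] [Module.Finite A E] [Module.Projective A E] (φ : M →ₗ[A] E)
    (l : Module.Basis I A M) :
    exteriorPower.map d φ = 0 ↔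
      ∀ lam : I → Module.Dual A E, (Matrix.of fun i j => lam i (φ (l j))).det = 0 := by
  have e : Fin d ≃ I := (Fintype.equivFinOfCardEq hd).symm
  constructor
  · intro h lam
    let alt : E [⋀^Fin d]→ₗ[A] A :=
      (Matrix.detRowAlternating (n := Fin d) (R := A)).compLinearMap
        (LinearMap.pi fun i => lam (e i))
    have h1 := exteriorPower.alternatingMapLinearEquiv_apply_ιMulti alt (fun i => φ (l (e i)))
    have h2 := LinearMap.congr_fun h (exteriorPower.ιMulti A d (fun i => l (e i)))
    rw [exteriorPower.map_apply_ιMulti, LinearMap.zero_apply] at h2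
    have h3 : exteriorPower.ιMulti A d (fun i => φ (l (e i))) = 0 := h2
    rw [h3, map_zero] at h1
    rw [← Matrix.det_submatrix_equiv_self e, ← Matrix.det_transpose]
    exact h1.symm
  · intro h
    obtain ⟨N, p, s, -, -, hs⟩ := Module.Finite.exists_comp_eq_id_of_projective A E
    apply exteriorPower.linearMap_ext
    refine Module.Basis.ext_alternating l fun v hv => ?_
    let v' : Fin d ≃ I := Equiv.ofBijective v
      ((Fintype.bijective_iff_injective_and_card v).2 ⟨hv, by simp [hd]⟩)
    have key : exteriorPower.ιMulti A d (fun i => φ (l (v i))) = 0 := by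
      apply exteriorPower.map_injective p hs
      rw [map_zero, exteriorPower.map_apply_ιMulti]
      apply ((Pi.basisFun A (Fin N)).exteriorPower d).repr.injective
      ext t
      rw [exteriorPower.basis_repr_apply, exteriorPower.ιMultiDual_apply_ιMulti, map_zero,
        Finsupp.zero_apply, ← Matrix.det_transpose]
      have := h fun i => (Pi.basisFun A (Fin N)).coord
        (Set.powersetCard.ofFinEmbEquiv.symm t (v'.symm i)) ∘ₗ s
      rw [← Matrix.det_submatrix_equiv_self v'] at this
      rw [← this]
      congr 1
      ext i j
      simp [v']
    simpa using key

variable {k : Type u} [Field k] {U V : Type v} [AddCommGroup U] [Module k U]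
  [AddCommGroup V] [Module k V] {A : Type u} [CommRing A] [Algebra k A]
  {F : Type*} [AddCommGroup F] [Module k F] [Module A F] [IsScalarTower k A F]

theorem tensorMap_tensorVec (g : A ⊗[k] U →ₗ[A] F) (v : V) (x : A ⊗[k] U) :
    tensorMap g V (tensorVec A v x) = g x ⊗ₜ v := by
  induction x with
  | zero => simp
  | tmul a x => simp
  | add x y hx hy => simp only [map_add, hx, hy, TensorProduct.add_tmul]

theorem tensorMap_surjective (g : A ⊗[k] U →ₗ[A] F) (hg : Function.Surjective g) :
    Function.Surjective (tensorMap g V) := by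
  intro z
  induction z with
  | zero => exact ⟨0, map_zero _⟩
  | tmul x v => obtain ⟨x, rfl⟩ := hg x; exact ⟨tensorVec A v x, tensorMap_tensorVec g v x⟩
  | add x y hx hy =>
    obtain ⟨x, rfl⟩ := hx
    obtain ⟨y, rfl⟩ := hy
    exact ⟨x + y, map_add _ _ _⟩

/-- The submodule `N ⊗ V` of `A ⊗ U ⊗ V`. -/
noncomputable def tensorSubmodule (V : Type v) [AddCommGroup V] [Module k V] (N : Submodule A
    (A ⊗[k] U)) :
    Submodule A (A ⊗[k] (U ⊗[k] V)) :=
  ⨆ v : V, N.map (tensorVec A v)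

theorem tensorVec_mem_tensorSubmodule {N : Submodule A (A ⊗[k] U)} {x : A ⊗[k] U} (hx : x ∈ N)
    (v : V) : tensorVec A v x ∈ tensorSubmodule V N :=
  Submodule.mem_iSup_of_mem v (Submodule.mem_map_of_mem hx)

theorem tensorSubmodule_le_iff {N : Submodule A (A ⊗[k] U)}
    {H : Submodule A (A ⊗[k] (U ⊗[k] V))} :
    tensorSubmodule V N ≤ H ↔ ∀ v : V, ∀ x ∈ N, tensorVec A v x ∈ H := by
  rw [tensorSubmodule, iSup_le_iff]
  exact forall_congr' fun v => Submodule.map_le_iff_le_comap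

theorem ker_tensorMap (g : A ⊗[k] U →ₗ[A] F) (hg : Function.Surjective g) :
    LinearMap.ker (tensorMap g V) = tensorSubmodule V (LinearMap.ker g) := by
  apply le_antisymm
  · intro z hz
    obtain ⟨y, rfl⟩ := (AlgebraTensorModule.assoc k k A A U V).surjective z
    have h1 : (g.restrictScalars k).rTensor V y = 0 := by
      have : tensorMap g V (AlgebraTensorModule.assoc k k A A U V y) = 0 := hz
      simp only [tensorMap, LinearMap.comp_apply, LinearEquiv.coe_coe,
        LinearEquiv.symm_apply_apply] at this
      exact this
    have hex : Function.Exact ((LinearMap.ker g).subtype.restrictScalars k)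
        (g.restrictScalars k) := fun x => by
      simp [LinearMap.mem_ker]
    have hex' : Function.Exact (((LinearMap.ker g).subtype.restrictScalars k).rTensor V)
        ((g.restrictScalars k).rTensor V) := by
      refine rTensor_exact (R := k) (M := LinearMap.ker g) V ?_ ?_
      · exact hex
      · exact hg
    obtain ⟨t, rfl⟩ := (hex' y).1 h1
    clear hz h1
    induction t with
    | zero => simp
    | tmul x v =>
      have h2 : (AlgebraTensorModule.assoc k k A A U V) (((LinearMap.ker g).subtype.restrictScalars
          k).rTensor V (x ⊗ₜ v)) = tensorVec A v x := by
        rw [LinearMap.rTensor_tmul, LinearMap.restrictScalars_apply, Submodule.subtype_apply]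
        generalize (x : A ⊗[k] U) = x
        induction x with
        | zero => simp
        | tmul a x => simp
        | add x y hx hy => simp only [map_add, hx, hy, TensorProduct.add_tmul]
      rw [h2]
      exact tensorVec_mem_tensorSubmodule x.2 v
    | add x y hx hy => rw [map_add, map_add]; exact add_mem hx hy
  · rw [tensorSubmodule_le_iff]
    intro v x hx
    rw [LinearMap.mem_ker, tensorMap_tensorVec, LinearMap.mem_ker.1 hx, TensorProduct.zero_tmul]

/-- All square matrices obtained by evaluating linear forms that vanish on `N ⊗ V` on a basis of `L`
are singular. -/
def PairingVanishes {I : Type*} [Fintype I] [DecidableEq I] {L : Submodule k (U ⊗[k] V)}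
    (l : Module.Basis I k L) (N : Submodule A (A ⊗[k] U)) : Prop :=
  ∀ lam : I → Module.Dual A (A ⊗[k] (U ⊗[k] V)),
    (∀ i, tensorSubmodule V N ≤ LinearMap.ker (lam i)) →
      (Matrix.of fun i j => lam i (1 ⊗ₜ (l j : U ⊗[k] V))).det = 0

theorem detVanishes_iff [FiniteDimensional k U] [FiniteDimensional k V] [Module.Finite A F]
    [Module.Projective A F]
    {I : Type*} [Fintype I] [DecidableEq I] {d : ℕ} (hd : Fintype.card I = d)
    (g : A ⊗[k] U →ₗ[A] F) (hg : Function.Surjective g) {L : Submodule k (U ⊗[k] V)}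
    (l : Module.Basis I k L) :
    DetVanishes d g L ↔ PairingVanishes l (LinearMap.ker g) := by
  have : Module.Finite A (F ⊗[k] V) := Module.Finite.of_surjective _ (tensorMap_surjective g hg)
  rw [DetVanishes, exteriorPower_map_eq_zero_iff hd _ (l.baseChange A)]
  have h1 : ∀ j, sectionMap g L (l.baseChange A j) = tensorMap g V (1 ⊗ₜ (l j : U ⊗[k] V)) := by
    intro j
    simp [sectionMap]
  simp only [h1]
  constructor
  · intro h lam hlam
    rw [← ker_tensorMap g hg] at hlam
    let e := (tensorMap g V).quotKerEquivOfSurjective (tensorMap_surjective g hg)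
    have := h fun i => (LinearMap.ker (tensorMap g V)).liftQ (lam i) (hlam i) ∘ₗ e.symm.toLinearMap
    convert this using 5 with i j
    have h2 : e.symm (tensorMap g V (1 ⊗ₜ (l j : U ⊗[k] V))) =
        Submodule.Quotient.mk (1 ⊗ₜ (l j : U ⊗[k] V)) := by
      rw [LinearEquiv.symm_apply_eq]; rfl
    simp [h2]
  · intro h lam
    refine h (fun i => lam i ∘ₗ tensorMap g V) fun i => ?_
    rw [← ker_tensorMap g hg]
    intro x hx
    rw [LinearMap.mem_ker, LinearMap.comp_apply, LinearMap.mem_ker.1 hx, map_zero]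

end Exterior

section Bases

variable {R : Type*} [CommRing R] {M P : Type*} [AddCommMonoid M] [Module R M] [AddCommMonoid P]
  [Module R P]

theorem repr_eq_of_pairing {ι κ : Type*} (Ψ : M →ₗ[R] Module.Dual R P) (b' : Module.Basis κ R M)
    (b : Module.Basis ι R P) (s : κ ≃ ι) (h : ∀ i, Ψ (b' i) = b.coord (s i)) (ξ : M) (i : κ) :
    b'.repr ξ i = Ψ ξ (b (s i)) := by
  have : b'.coord i = Ψ.flip (b (s i)) := b'.ext fun j => by
    classical
    simp only [Module.Basis.coord_apply, Module.Basis.repr_self, LinearMap.flip_apply, h,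
      Finsupp.single_apply, s.injective.eq_iff, eq_comm]
  exact LinearMap.congr_fun this ξ

theorem mem_span_range_inr_iff {ι κ : Type*} (b : Module.Basis (ι ⊕ κ) R M) (x : M) :
    x ∈ Submodule.span R (Set.range (b ∘ Sum.inr)) ↔ ∀ i, b.repr x (Sum.inl i) = 0 := by
  rw [Set.range_comp, b.mem_span_image]
  constructor
  · intro h i
    by_contra hi
    obtain ⟨j, hj⟩ := h (Finset.mem_coe.2 (Finsupp.mem_support_iff.2 hi))
    cases hj
  · intro h i hi
    obtain i | i := i
    · exact absurd (h i) (Finsupp.mem_support_iff.1 hi)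
    · exact ⟨i, rfl⟩

theorem mem_span_range_inl_iff {ι κ : Type*} (b : Module.Basis (ι ⊕ κ) R M) (x : M) :
    x ∈ Submodule.span R (Set.range (b ∘ Sum.inl)) ↔ ∀ i, b.repr x (Sum.inr i) = 0 := by
  have := mem_span_range_inr_iff (b.reindex (Equiv.sumComm ι κ)) x
  have h : (b.reindex (Equiv.sumComm ι κ)) ∘ Sum.inr = b ∘ Sum.inl := by ext i; simp
  rw [h] at this
  simp only [Module.Basis.repr_reindex_apply] at this
  exact this

theorem fittingVanishes_reindex {ι κ : Type*} [Fintype ι] [DecidableEq ι] [Fintype κ]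
    [DecidableEq κ] {E : Type*} [AddCommGroup E] [Module R E] (β : Module.Basis ι R E) (e : ι ≃ κ)
    (J : Submodule R E) :
    FittingVanishes (β.reindex e) J ↔ FittingVanishes β J := by
  refine ⟨fun h y hy => ?_, fun h y hy => ?_⟩
  · have := h (y ∘ e.symm) fun i => hy _
    rwa [Module.Basis.det_reindex, Function.comp_assoc, Equiv.symm_comp_self,
      Function.comp_id] at this
  · rw [Module.Basis.det_reindex]
    exact h _ fun i => hy _

end Bases

section Relations

variable {k : Type u} [Field k] {U V : Type v} [AddCommGroup U] [Module k U]
  [AddCommGroup V] [Module k V] {A : Type u} [CommRing A] [Algebra k A]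

/-- The submodule `A ⊗ L + N ⊗ V` of `A ⊗ U ⊗ V`. If `N` is the kernel of a surjection
`A ⊗ U → F`, the quotient by it is the cokernel of `A ⊗ L → F ⊗ V`. -/
noncomputable def relations (L : Submodule k (U ⊗[k] V)) (N : Submodule A (A ⊗[k] U)) :
    Submodule A (A ⊗[k] (U ⊗[k] V)) :=
  L.baseChange A ⊔ tensorSubmodule V N

theorem relations_le_iff {L : Submodule k (U ⊗[k] V)} {N : Submodule A (A ⊗[k] U)}
    {H : Submodule A (A ⊗[k] (U ⊗[k] V))} :
    relations L N ≤ H ↔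
      (∀ l ∈ L, (1 : A) ⊗ₜ[k] l ∈ H) ∧ ∀ v : V, ∀ x ∈ N, tensorVec A v x ∈ H := by
  rw [relations, sup_le_iff, tensorSubmodule_le_iff, Submodule.baseChange_eq_span,
    Submodule.span_le]
  refine and_congr_left fun _ => ⟨fun h l hl => h ⟨l, hl, rfl⟩, ?_⟩
  rintro h _ ⟨l, hl, rfl⟩
  exact h l hl

theorem spanMap_tensorSubmodule {B : Type u} [CommRing B] [Algebra k B] (f : A →ₐ[k] B)
    (N : Submodule A (A ⊗[k] U)) :
    spanMap f (tensorSubmodule V N) = tensorSubmodule V (spanMap f N) := by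
  have h : tensorSubmodule V N =
      Submodule.span A {z | ∃ (v : V), ∃ x ∈ N, tensorVec A v x = z} := by
    apply le_antisymm
    · rw [tensorSubmodule_le_iff]
      exact fun v x hx => Submodule.subset_span ⟨v, x, hx, rfl⟩
    · refine Submodule.span_le.2 ?_
      rintro _ ⟨v, x, hx, rfl⟩
      exact tensorVec_mem_tensorSubmodule hx v
  apply le_antisymm
  · rw [h, spanMap_span, Submodule.span_le]
    rintro _ ⟨_, ⟨v, x, hx, rfl⟩, rfl⟩
    rw [← tensorVec_scalarMap]
    exact tensorVec_mem_tensorSubmodule (scalarMap_mem_spanMap f hx) v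
  · rw [tensorSubmodule_le_iff]
    intro v x hx
    have : spanMap f N ≤ (spanMap f (tensorSubmodule V N)).comap (tensorVec B v) := by
      rw [spanMap, Submodule.span_le]
      rintro _ ⟨x, hx, rfl⟩
      rw [SetLike.mem_coe, Submodule.mem_comap, tensorVec_scalarMap]
      exact scalarMap_mem_spanMap f (tensorVec_mem_tensorSubmodule hx v)
    exact this hx

theorem spanMap_relations {B : Type u} [CommRing B] [Algebra k B] (f : A →ₐ[k] B)
    (L : Submodule k (U ⊗[k] V)) (N : Submodule A (A ⊗[k] U)) :
    spanMap f (relations L N) = relations L (spanMap f N) := by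
  rw [relations, spanMap_sup, spanMap_tensorSubmodule, relations]
  congr 1
  rw [Submodule.baseChange_eq_span, Submodule.baseChange_eq_span, spanMap_span]
  congr 1
  ext z
  simp

/-- The basis of `A ⊗ U ⊗ V` defined by a basis of `A ⊗ U` and a basis of `V`. -/
noncomputable def tensorBasis {ρ σ ν : Type*} (b : Module.Basis (ρ ⊕ σ) A (A ⊗[k] U))
    (c : Module.Basis ν k V) : Module.Basis (ρ × ν ⊕ σ × ν) A (A ⊗[k] (U ⊗[k] V)) :=
  ((b.tensorProduct c).map (AlgebraTensorModule.assoc k k A A U V)).reindex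
    (Equiv.sumProdDistrib ρ σ ν)

theorem assoc_tmul_eq_tensorVec (x : A ⊗[k] U) (v : V) :
    AlgebraTensorModule.assoc k k A A U V (x ⊗ₜ v) = tensorVec A v x := by
  induction x with
  | zero => simp
  | tmul a x => simp
  | add x y hx hy => simp only [map_add, TensorProduct.add_tmul, hx, hy]

theorem tensorBasis_inl {ρ σ ν : Type*} (b : Module.Basis (ρ ⊕ σ) A (A ⊗[k] U))
    (c : Module.Basis ν k V) (i : ρ × ν) :
    tensorBasis b c (Sum.inl i) = tensorVec A (c i.2) (b (Sum.inl i.1)) := by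
  rw [← assoc_tmul_eq_tensorVec]
  simp [tensorBasis, Equiv.sumProdDistrib, Module.Basis.tensorProduct_apply']

theorem tensorBasis_inr {ρ σ ν : Type*} (b : Module.Basis (ρ ⊕ σ) A (A ⊗[k] U))
    (c : Module.Basis ν k V) (i : σ × ν) :
    tensorBasis b c (Sum.inr i) = tensorVec A (c i.2) (b (Sum.inr i.1)) := by
  rw [← assoc_tmul_eq_tensorVec]
  simp [tensorBasis, Equiv.sumProdDistrib, Module.Basis.tensorProduct_apply']

theorem tensorBasis_repr_inl {ρ σ ν : Type*} (b : Module.Basis (ρ ⊕ σ) A (A ⊗[k] U))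
    (c : Module.Basis ν k V) (v : V) (x : A ⊗[k] U) (i : ρ) (j : ν) :
    (tensorBasis b c).repr (tensorVec A v x) (Sum.inl (i, j)) =
      c.repr v j • b.repr x (Sum.inl i) := by
  rw [← assoc_tmul_eq_tensorVec, tensorBasis, Module.Basis.repr_reindex_apply]
  simp [Equiv.sumProdDistrib]

theorem tensorBasis_repr_inr {ρ σ ν : Type*} (b : Module.Basis (ρ ⊕ σ) A (A ⊗[k] U))
    (c : Module.Basis ν k V) (v : V) (x : A ⊗[k] U) (i : σ) (j : ν) :
    (tensorBasis b c).repr (tensorVec A v x) (Sum.inr (i, j)) =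
      c.repr v j • b.repr x (Sum.inr i) := by
  rw [← assoc_tmul_eq_tensorVec, tensorBasis, Module.Basis.repr_reindex_apply]
  simp [Equiv.sumProdDistrib]

theorem tensorSubmodule_span {ν τ : Type*} (c : Module.Basis ν k V) (b : τ → A ⊗[k] U) :
    tensorSubmodule V (Submodule.span A (Set.range b)) =
      Submodule.span A (Set.range fun i : τ × ν => tensorVec A (c i.2) (b i.1)) := by
  apply le_antisymm
  · rw [tensorSubmodule_le_iff]
    intro v x hx
    have hv : v ∈ Submodule.span k (Set.range c) := by rw [c.span_eq]; trivial
    have hadd : ∀ v v' : V, tensorVec A (v + v') x = tensorVec A v x + tensorVec A v' x := by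
      intro v v'
      simp [← assoc_tmul_eq_tensorVec, TensorProduct.tmul_add]
    have hsmul : ∀ (a : k) (v : V), tensorVec A (a • v) x = algebraMap k A a • tensorVec A v x := by
      intro a v
      rw [← assoc_tmul_eq_tensorVec, ← assoc_tmul_eq_tensorVec, ← map_smul, algebraMap_smul,
        TensorProduct.tmul_smul]
    have hzero : tensorVec A (0 : V) x = 0 := by simp [← assoc_tmul_eq_tensorVec]
    induction hv using Submodule.span_induction with
    | mem v hv =>
      obtain ⟨j, rfl⟩ := hv
      have : Submodule.span A (Set.range b) ≤ (Submodule.span A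
          (Set.range fun i : τ × ν => tensorVec A (c i.2) (b i.1))).comap (tensorVec A (c j)) := by
        rw [Submodule.span_le]
        rintro _ ⟨i, rfl⟩
        exact Submodule.subset_span (Set.mem_range_self (i, j))
      exact this hx
    | zero => rw [hzero]; exact zero_mem _
    | add v v' _ _ h h' => rw [hadd]; exact add_mem h h'
    | smul a v _ h => rw [hsmul]; exact Submodule.smul_mem _ _ h
  · rw [Submodule.span_le]
    rintro _ ⟨i, rfl⟩
    exact tensorVec_mem_tensorSubmodule (Submodule.subset_span (Set.mem_range_self i.1)) _

/-- The matrix of `A ⊗ L → (A ⊗ U) / N ⊗ V` with respect to a basis of `A ⊗ U` adapted to `N` and a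
basis of `U ⊗ V` adapted to `L`. -/
noncomputable def adaptedMatrix {ρ σ ν : Type*} (b : Module.Basis (ρ ⊕ σ) A (A ⊗[k] U))
    (c : Module.Basis ν k V)
    (ε : Module.Basis (ρ × ν ⊕ σ × ν) k (U ⊗[k] V)) : Matrix (ρ × ν) (ρ × ν) A :=
  Matrix.of fun i j => (tensorBasis b c).coord (Sum.inl i) (1 ⊗ₜ ε (Sum.inl j))

theorem relations_eq_span {ρ σ ν : Type*} {N : Submodule A (A ⊗[k] U)} {b : Module.Basis (ρ ⊕ σ) A
    (A ⊗[k] U)}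
    (hb : N = Submodule.span A (Set.range (b ∘ Sum.inr))) (c : Module.Basis ν k V)
    {L : Submodule k (U ⊗[k] V)} {ε : Module.Basis (ρ × ν ⊕ σ × ν) k (U ⊗[k] V)}
    (hε : L = Submodule.span k (Set.range (ε ∘ Sum.inl))) :
    relations L N = Submodule.span A (Set.range (ε.baseChange A ∘ Sum.inl)) ⊔
      Submodule.span A (Set.range (tensorBasis b c ∘ Sum.inr)) := by
  rw [relations, hε, hb, tensorSubmodule_span c, Submodule.baseChange_span, ← Set.range_comp]
  congr 3
  · ext i; simp
  · ext i; simp [tensorBasis_inr]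

variable {ρ σ ν : Type*} [Fintype ρ] [Fintype σ] [Fintype ν] [DecidableEq ρ]
  [DecidableEq ν]

theorem fittingVanishes_relations_iff [DecidableEq σ] {N : Submodule A (A ⊗[k] U)}
    {b : Module.Basis (ρ ⊕ σ) A (A ⊗[k] U)}
    (hb : N = Submodule.span A (Set.range (b ∘ Sum.inr))) (c : Module.Basis ν k V)
    {L : Submodule k (U ⊗[k] V)} {ε : Module.Basis (ρ × ν ⊕ σ × ν) k (U ⊗[k] V)}
    (hε : L = Submodule.span k (Set.range (ε ∘ Sum.inl))) :
    FittingVanishes (ε.baseChange A) (relations L N) ↔ (adaptedMatrix b c ε).det = 0 := by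
  rw [relations_eq_span hb c hε, fittingVanishes_sup_iff]
  simp [adaptedMatrix]

theorem pairingVanishes_iff {N : Submodule A (A ⊗[k] U)}
    {b : Module.Basis (ρ ⊕ σ) A (A ⊗[k] U)}
    (hb : N = Submodule.span A (Set.range (b ∘ Sum.inr))) (c : Module.Basis ν k V)
    {L : Submodule k (U ⊗[k] V)} {ε : Module.Basis (ρ × ν ⊕ σ × ν) k (U ⊗[k] V)}
    (l : Module.Basis (ρ × ν) k L) (hl : ∀ i, ε (Sum.inl i) = l i) :
    PairingVanishes l N ↔ (adaptedMatrix b c ε).det = 0 := by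
  have hN : tensorSubmodule V N = Submodule.span A (Set.range (tensorBasis b c ∘ Sum.inr)) := by
    rw [hb, tensorSubmodule_span c]
    congr 2
    ext i; simp [tensorBasis_inr]
  rw [PairingVanishes, hN]
  constructor
  · intro h
    have := h (fun i => (tensorBasis b c).coord (Sum.inl i)) fun i => by
      rw [Submodule.span_le]
      rintro _ ⟨j, rfl⟩
      simp
    rw [← this]
    congr 1
    ext i j
    simp [adaptedMatrix, hl]
  · intro h lam hlam
    have : (Matrix.of fun i j => lam i (1 ⊗ₜ (l j : U ⊗[k] V))) =
        (Matrix.of fun i j => lam i (tensorBasis b c (Sum.inl j))) * adaptedMatrix b c ε := by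
      ext i j
      rw [Matrix.of_apply, ← hl]
      conv_lhs => rw [← (tensorBasis b c).sum_repr (1 ⊗ₜ[k] ε (Sum.inl j))]
      rw [map_sum, Fintype.sum_sum_type, Matrix.mul_apply]
      have h0 : ∀ t, lam i (tensorBasis b c (Sum.inr t)) = 0 := fun t =>
        hlam i (Submodule.subset_span ⟨t, rfl⟩)
      have h1 : ∀ t, lam i ((tensorBasis b c).repr (1 ⊗ₜ[k] ε (Sum.inl j)) (Sum.inr t) •
          tensorBasis b c (Sum.inr t)) = 0 := fun t => by rw [map_smul, h0, smul_zero]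
      rw [Finset.sum_eq_zero fun t _ => h1 t, add_zero]
      refine Finset.sum_congr rfl fun t _ => ?_
      rw [map_smul, smul_eq_mul, mul_comm]
      rfl
    rw [this, Matrix.det_mul, h, mul_zero]

/-- The pairing between `A ⊗ U^∨ ⊗ V^∨` and `A ⊗ U ⊗ V`. -/
noncomputable def dualEvTensor :
    A ⊗[k] (Module.Dual k U ⊗[k] Module.Dual k V) →ₗ[A] Module.Dual A (A ⊗[k] (U ⊗[k] V)) :=
  dualEv A ∘ₗ (TensorProduct.dualDistrib k U V).baseChange A

theorem dualEvTensor_tensorVec (φ : Module.Dual k V) (ξ : A ⊗[k] Module.Dual k U) (v : V)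
    (x : A ⊗[k] U) : dualEvTensor (tensorVec A φ ξ) (tensorVec A v x) = φ v • dualEv A ξ x := by
  induction ξ with
  | zero => simp
  | tmul a ξ =>
    induction x with
    | zero => simp
    | tmul b x => simp [dualEvTensor, mul_comm, smul_smul]
    | add x y hx hy => simp only [map_add, hx, hy, smul_add]
  | add ξ η hξ hη => simp only [map_add, LinearMap.add_apply, hξ, hη, smul_add]

end Relations

section Duality

variable {k : Type u} [Field k] {U V : Type v} [AddCommGroup U] [Module k U] [FiniteDimensional k U]
  [AddCommGroup V] [Module k V] {A : Type u} [CommRing A] [Algebra k A]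

/-- The isomorphism `A ⊗ U^∨ = (A ⊗ U)^∨`. -/
noncomputable def dualEvEquiv : A ⊗[k] Module.Dual k U ≃ₗ[A] Module.Dual A (A ⊗[k] U) :=
  LinearEquiv.ofBijective (dualEv A) (by
    let u := Module.finBasis k U
    let e := (u.dualBasis.baseChange A).equiv (u.baseChange A).dualBasis (Equiv.refl _)
    have : dualEv A = e.toLinearMap := by
      refine (u.dualBasis.baseChange A).ext fun i => (u.baseChange A).ext fun j => ?_
      rw [LinearEquiv.coe_coe, Module.Basis.equiv_apply]
      simp [Finsupp.single_apply]
    rw [this]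
    exact e.bijective)

theorem dualEvEquiv_apply (ξ : A ⊗[k] Module.Dual k U) : dualEvEquiv ξ = dualEv A ξ := rfl

variable {ρ σ ν : Type*} [Fintype ρ] [Fintype σ] [Fintype ν] [DecidableEq ρ] [DecidableEq σ]
  [DecidableEq ν]

/-- The basis of `A ⊗ U^∨` dual to a basis of `A ⊗ U`, with the two halves exchanged. -/
noncomputable def swapDualBasis (b : Module.Basis (ρ ⊕ σ) A (A ⊗[k] U)) :
    Module.Basis (σ ⊕ ρ) A (A ⊗[k] Module.Dual k U) :=
  (b.dualBasis.map dualEvEquiv.symm).reindex (Equiv.sumComm ρ σ)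

theorem dualEv_swapDualBasis (b : Module.Basis (ρ ⊕ σ) A (A ⊗[k] U)) (i : σ ⊕ ρ) :
    dualEv A (swapDualBasis b i) = b.coord i.swap := by
  rw [← dualEvEquiv_apply]
  simp [swapDualBasis]

theorem ker_dualRestrict_eq_span {N : Submodule A (A ⊗[k] U)}
    {b : Module.Basis (ρ ⊕ σ) A (A ⊗[k] U)}
    (hb : N = Submodule.span A (Set.range (b ∘ Sum.inr))) :
    LinearMap.ker (dualRestrict N) =
      Submodule.span A (Set.range (swapDualBasis b ∘ Sum.inr)) := by
  have hrepr := repr_eq_of_pairing (dualEv A) (swapDualBasis b) b (Equiv.sumComm σ ρ)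
    (dualEv_swapDualBasis b)
  ext ξ
  have h1 : ξ ∈ LinearMap.ker (dualRestrict N) ↔ ∀ j, dualEv A ξ (b (Sum.inr j)) = 0 := by
    rw [LinearMap.mem_ker]
    constructor
    · intro h j
      exact LinearMap.congr_fun h ⟨b (Sum.inr j), hb ▸ Submodule.subset_span ⟨j, rfl⟩⟩
    · intro h
      have : N ≤ LinearMap.ker (dualEv A ξ) := by
        rw [hb, Submodule.span_le]
        rintro _ ⟨j, rfl⟩
        exact h j
      exact LinearMap.ext fun x => this x.2
  rw [h1, mem_span_range_inr_iff]
  exact forall_congr' fun j => by rw [hrepr]; rfl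

theorem tensorBasis_dual (b : Module.Basis (ρ ⊕ σ) A (A ⊗[k] U)) (c : Module.Basis ν k V)
    (i : σ × ν ⊕ ρ × ν) :
    dualEvTensor (tensorBasis (swapDualBasis b) c.dualBasis i) =
      (tensorBasis b c).coord i.swap := by
  refine (tensorBasis b c).ext fun j => ?_
  obtain ⟨i, p⟩ | ⟨i, p⟩ := i <;> obtain ⟨j, q⟩ | ⟨j, q⟩ := j <;>
  simp only [tensorBasis_inl, tensorBasis_inr, dualEvTensor_tensorVec, dualEv_swapDualBasis,
    Module.Basis.coord_apply, Module.Basis.dualBasis_apply, Sum.swap_inl, Sum.swap_inr,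
    tensorBasis_repr_inl, tensorBasis_repr_inr]

variable [FiniteDimensional k V]

/-- The basis of `U^∨ ⊗ V^∨` dual to a basis of `U ⊗ V`, with the two halves exchanged. -/
noncomputable def swapDualBasisTensor {I J : Type*} [Fintype I] [Fintype J] [DecidableEq I]
    [DecidableEq J] (ε : Module.Basis (I ⊕ J) k (U ⊗[k] V)) :
    Module.Basis (J ⊕ I) k (Module.Dual k U ⊗[k] Module.Dual k V) :=
  (ε.dualBasis.map (TensorProduct.dualDistribEquiv k U V).symm).reindex (Equiv.sumComm I J)

theorem dualDistrib_swapDualBasisTensor {I J : Type*} [Fintype I] [Fintype J] [DecidableEq I]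
    [DecidableEq J] (ε : Module.Basis (I ⊕ J) k (U ⊗[k] V)) (i : J ⊕ I) :
    TensorProduct.dualDistrib k U V (swapDualBasisTensor ε i) = ε.coord i.swap := by
  change TensorProduct.dualDistribEquiv k U V _ = _
  rw [swapDualBasisTensor, Module.Basis.reindex_apply, Module.Basis.map_apply,
    LinearEquiv.apply_symm_apply, Module.Basis.coe_dualBasis]
  rfl

theorem orth_eq_span {I J : Type*} [Fintype I] [Fintype J] [DecidableEq I]
    [DecidableEq J] {L : Submodule k (U ⊗[k] V)} {ε : Module.Basis (I ⊕ J) k (U ⊗[k] V)}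
    (hε : L = Submodule.span k (Set.range (ε ∘ Sum.inl))) :
    orth L = Submodule.span k (Set.range (swapDualBasisTensor ε ∘ Sum.inl)) := by
  have hrepr := repr_eq_of_pairing (TensorProduct.dualDistrib k U V) (swapDualBasisTensor ε) ε
    (Equiv.sumComm J I) fun i => dualDistrib_swapDualBasisTensor ε i
  ext ξ
  have h1 : ξ ∈ orth L ↔ ∀ j, TensorProduct.dualDistrib k U V ξ (ε (Sum.inl j)) = 0 := by
    rw [orth, Submodule.mem_comap, Submodule.mem_dualAnnihilator]
    constructor
    · intro h j
      exact h _ (hε ▸ Submodule.subset_span ⟨j, rfl⟩)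
    · intro h
      have : L ≤ LinearMap.ker (TensorProduct.dualDistrib k U V ξ) := by
        rw [hε, Submodule.span_le]
        rintro _ ⟨j, rfl⟩
        exact h j
      exact this
  rw [h1, mem_span_range_inl_iff]
  exact forall_congr' fun j => by rw [hrepr]; rfl

/-- The Fitting ideals of the two cokernels vanish at the same time. -/
theorem fittingVanishes_dual_iff {N : Submodule A (A ⊗[k] U)}
    {b : Module.Basis (ρ ⊕ σ) A (A ⊗[k] U)}
    (hb : N = Submodule.span A (Set.range (b ∘ Sum.inr))) (c : Module.Basis ν k V)
    {L : Submodule k (U ⊗[k] V)} {ε : Module.Basis (ρ × ν ⊕ σ × ν) k (U ⊗[k] V)}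
    (hε : L = Submodule.span k (Set.range (ε ∘ Sum.inl))) :
    FittingVanishes ((swapDualBasisTensor ε).baseChange A)
        (relations (orth L) (LinearMap.ker (dualRestrict N))) ↔
      FittingVanishes (ε.baseChange A) (relations L N) := by
  rw [fittingVanishes_relations_iff hb c hε,
    relations_eq_span (ker_dualRestrict_eq_span hb) c.dualBasis (orth_eq_span hε), sup_comm]
  let ε' := ((swapDualBasisTensor ε).baseChange A).reindex (Equiv.sumComm _ _)
  let β' := (tensorBasis (swapDualBasis b) c.dualBasis).reindex (Equiv.sumComm _ _)
  have h1 : (tensorBasis (swapDualBasis b) c.dualBasis) ∘ Sum.inr = β' ∘ Sum.inl := by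
    ext i; simp [β']
  have h2 : ((swapDualBasisTensor ε).baseChange A) ∘ Sum.inl = ε' ∘ Sum.inr := by
    ext i; simp [ε']
  have hε' : ∀ i j, dualEvTensor (ε' i) (1 ⊗ₜ ε j) = if i = j then 1 else 0 := by
    intro i j
    simp only [ε', Module.Basis.reindex_apply, Module.Basis.baseChange_apply, dualEvTensor,
      LinearMap.comp_apply, LinearMap.baseChange_tmul, dualDistrib_swapDualBasisTensor]
    by_cases h : i = j
    · simp [h]
    · simp [h]
  have hcoord : ∀ i j, ε'.coord i (β' j) = (tensorBasis b c).coord j (1 ⊗ₜ ε i) := by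
    intro i j
    have : dualEvTensor (β' j) = (tensorBasis b c).coord j := by
      simp [β', tensorBasis_dual]
    rw [← this]
    exact repr_eq_of_pairing dualEvTensor ε' (ε.baseChange A) (Equiv.refl _) (fun i =>
      (ε.baseChange A).ext fun j => by
        rw [Module.Basis.baseChange_apply, hε']
        simp [Finsupp.single_apply, eq_comm]) (β' j) i |>.trans (by simp)
  rw [h1, h2]
  rw [← fittingVanishes_reindex _ (Equiv.sumComm (σ × ν) (ρ × ν)), fittingVanishes_sup_iff,
    ← Matrix.det_transpose]
  have h4 : (Matrix.of fun i j => ε'.coord (Sum.inl i) (β' (Sum.inl j))).transpose =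
      adaptedMatrix b c ε := by
    ext i j
    simp [adaptedMatrix, ← hcoord]
  rw [h4]

end Duality

section SubspaceBasis

variable {k : Type u} [Field k] {W : Type v} [AddCommGroup W] [Module k W]

theorem exists_basis_of_eq_span {I J : Type*} {L : Submodule k W}
    {ε : Module.Basis (I ⊕ J) k W}
    (hε : L = Submodule.span k (Set.range (ε ∘ Sum.inl))) :
    ∃ l : Module.Basis I k L, ∀ i, ε (Sum.inl i) = l i := by
  subst hε
  have hli : LinearIndependent k (ε ∘ Sum.inl) := ε.linearIndependent.comp _ Sum.inl_injective
  exact ⟨Module.Basis.span hli, fun i => (congrArg Subtype.val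
    (Module.Basis.span_apply hli i)).symm⟩

theorem exists_basis_extending [FiniteDimensional k W] (L : Submodule k W) {I J : Type*} [Fintype I]
    [Fintype J] (hI : Module.finrank k L = Fintype.card I)
    (hIJ : Module.finrank k W = Fintype.card I + Fintype.card J) :
    ∃ ε : Module.Basis (I ⊕ J) k W, L = Submodule.span k (Set.range (ε ∘ Sum.inl)) := by
  obtain ⟨C, hC⟩ := L.exists_isCompl
  have h2 : Module.finrank k C = Fintype.card J := by
    have := Submodule.finrank_add_eq_of_isCompl hC
    omega
  let bL := (Module.finBasisOfFinrankEq k L hI).reindex (Fintype.equivFin I).symm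
  let bC := (Module.finBasisOfFinrankEq k C h2).reindex (Fintype.equivFin J).symm
  refine ⟨(bL.prod bC).map (Submodule.prodEquivOfIsCompl L C hC), ?_⟩
  have : ((bL.prod bC).map (Submodule.prodEquivOfIsCompl L C hC)) ∘ Sum.inl = L.subtype ∘ bL := by
    ext i; simp
  rw [this, Set.range_comp, ← Submodule.map_span, bL.span_eq, Submodule.map_subtype_top]

end SubspaceBasis

section Localization

variable {k : Type u} [Field k] {U V : Type v} [AddCommGroup U] [Module k U]
  [AddCommGroup V] [Module k V] {A : Type u} [CommRing A] [Algebra k A]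

/-- The localization map as a homomorphism of `k`-algebras. -/
noncomputable def localizationHom (k : Type u) [Field k] {A : Type u} [CommRing A] [Algebra k A]
    (m : Ideal A) [m.IsPrime] : A →ₐ[k] Localization.AtPrime m :=
  IsScalarTower.toAlgHom k A (Localization.AtPrime m)

theorem FittingVanishes.of_localization {W : Type v} [AddCommGroup W] [Module k W] {ι : Type*}
    [Fintype ι] [DecidableEq ι] (ε : Module.Basis ι k W) (Y : Submodule A (A ⊗[k] W))
    (h : ∀ (m : Ideal A) [m.IsMaximal], FittingVanishes
      (ε.baseChange (Localization.AtPrime m)) (DetBirational.spanMap (localizationHom k m) Y)) :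
    FittingVanishes (ε.baseChange A) Y := by
  intro y hy
  refine eq_zero_of_localization _ fun m _ => ?_
  change localizationHom k m _ = 0
  rw [← det_scalarMap]
  exact h m _ fun i => scalarMap_mem_spanMap _ (hy i)

theorem fittingVanishes_of_localization_relations {ι : Type*} [Fintype ι] [DecidableEq ι]
    (ε : Module.Basis ι k (U ⊗[k] V)) (L : Submodule k (U ⊗[k] V)) (N : Submodule A (A ⊗[k] U))
    (h : ∀ (m : Ideal A) [m.IsMaximal], FittingVanishes
      (ε.baseChange (Localization.AtPrime m)) (relations L (spanMap (localizationHom k m) N))) :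
    FittingVanishes (ε.baseChange A) (relations L N) := by
  refine FittingVanishes.of_localization ε _ fun m _ => ?_
  rw [spanMap_relations]
  exact h m

theorem fittingVanishes_localization_relations {ι : Type*} [Fintype ι] [DecidableEq ι]
    {ε : Module.Basis ι k (U ⊗[k] V)} {L : Submodule k (U ⊗[k] V)} {N : Submodule A (A ⊗[k] U)}
    (h : FittingVanishes (ε.baseChange A) (relations L N)) (m : Ideal A) [m.IsMaximal] :
    FittingVanishes (ε.baseChange (Localization.AtPrime m))
      (relations L (spanMap (localizationHom k m) N)) := by
  rw [← spanMap_relations]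
  exact h.spanMap _

theorem PairingVanishes.of_localization {I : Type*} [Fintype I] [DecidableEq I]
    {L : Submodule k (U ⊗[k] V)} (l : Module.Basis I k L) (N : Submodule A (A ⊗[k] U))
    (h : ∀ (m : Ideal A) [m.IsMaximal], PairingVanishes l (spanMap (localizationHom k m) N)) :
    PairingVanishes l N := by
  intro lam hlam
  refine eq_zero_of_localization _ fun m _ => ?_
  change localizationHom k m _ = 0
  have := h m (fun i => formMap (localizationHom k m) (lam i)) fun i => by
    rw [← spanMap_tensorSubmodule, spanMap, Submodule.span_le]
    rintro _ ⟨x, hx, rfl⟩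
    rw [SetLike.mem_coe, LinearMap.mem_ker, formMap_scalarMap, LinearMap.mem_ker.1 (hlam i hx),
      map_zero]
  rw [AlgHom.map_det, ← this]
  congr 1
  ext i j
  rw [Matrix.of_apply, ← map_one (localizationHom k m), ← scalarMap_tmul, formMap_scalarMap]
  rfl

theorem spanMap_eq_map {B : Type u} [CommRing B] [Algebra k B] (f : A →ₐ[k] B) {r : ℕ}
    (N : Module.Grassmannian A (A ⊗[k] U) r) :
    spanMap f N.toSubmodule = (Module.Grassmannian.map f N).toSubmodule :=
  (map_toSubmodule_eq_span f N).symm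

theorem spanMap_ker_dualRestrict [FiniteDimensional k U] {B : Type u} [CommRing B] [Algebra k B]
    (f : A →ₐ[k] B) {r : ℕ} (N : Module.Grassmannian A (A ⊗[k] U) r) :
    spanMap f (LinearMap.ker (dualRestrict N.toSubmodule)) =
      LinearMap.ker (dualRestrict (Module.Grassmannian.map f N).toSubmodule) := by
  refine le_antisymm ?_ (ker_dualRestrict_map_le f N)
  rw [spanMap, Submodule.span_le]
  rintro _ ⟨ξ, hξ, rfl⟩
  obtain ⟨j, hj⟩ := exists_dualMap f N
  rw [SetLike.mem_coe, LinearMap.mem_ker, ← hj, LinearMap.mem_ker.1 hξ, map_zero]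

theorem exists_adapted_basis_tensor [FiniteDimensional k U] [IsLocalRing A] {r s : ℕ}
    (hs : Module.finrank k U - r = s) (N : Module.Grassmannian A (A ⊗[k] U) r) :
    ∃ b : Module.Basis (Fin r ⊕ Fin s) A (A ⊗[k] U),
      N.toSubmodule = Submodule.span A (Set.range (b ∘ Sum.inr)) := by
  subst hs
  rw [← Module.finrank_baseChange (R := A)]
  exact exists_adapted_basis N

theorem finite_grassmannian [FiniteDimensional k U] {r : ℕ}
    (N : Module.Grassmannian A (A ⊗[k] U) r) :
    Module.Finite A N.toSubmodule ∧ Module.Projective A N.toSubmodule ∧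
      Function.Surjective (dualRestrict N.toSubmodule) := by
  obtain ⟨e, he, he'⟩ := exists_idem N
  let p : A ⊗[k] U →ₗ[A] N.toSubmodule := (LinearMap.id - e).codRestrict _ he'
  have hp : ∀ x : N.toSubmodule, p x = x := fun x => by
    apply Subtype.ext
    simp [p, he x x.2]
  refine ⟨Module.Finite.of_surjective p fun x => ⟨x, hp x⟩,
    Module.Projective.of_split N.toSubmodule.subtype p (LinearMap.ext hp), fun φ => ?_⟩
  obtain ⟨ξ, hξ⟩ := dualEvEquiv.surjective (φ ∘ₗ p)
  refine ⟨ξ, LinearMap.ext fun x => ?_⟩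
  rw [dualRestrict_apply, ← dualEvEquiv_apply, hξ, LinearMap.comp_apply, hp]

end Localization

section DeterminantalLoci

variable {k : Type u} [Field k] {U V : Type v} [AddCommGroup U] [Module k U] [FiniteDimensional k U]
  [AddCommGroup V] [Module k V] [FiniteDimensional k V] {r s : ℕ} {L : Submodule k (U ⊗[k] V)}
  {ε : Module.Basis (Fin r × Fin (Module.finrank k V) ⊕ Fin s × Fin (Module.finrank k V)) k
    (U ⊗[k] V)}
  {A B : Type u} [CommRing A] [Algebra k A] [CommRing B] [Algebra k B]

theorem pairingVanishes_iff_fittingVanishes [IsLocalRing A]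
    (hs : Module.finrank k U - r = s) (hε : L = Submodule.span k (Set.range (ε ∘ Sum.inl)))
    (l : Module.Basis (Fin r × Fin (Module.finrank k V)) k L) (hl : ∀ i, ε (Sum.inl i) = l i)
    (N : Module.Grassmannian A (A ⊗[k] U) r) :
    PairingVanishes l N.toSubmodule ↔
      FittingVanishes (ε.baseChange A) (relations L N.toSubmodule) := by
  obtain ⟨b, hb⟩ := exists_adapted_basis_tensor hs N
  rw [pairingVanishes_iff hb (Module.finBasis k V) l hl,
    fittingVanishes_relations_iff hb (Module.finBasis k V) hε]

theorem pairingVanishes_iff_fittingVanishes_dual [IsLocalRing A]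
    (hs : Module.finrank k U - r = s) (hε : L = Submodule.span k (Set.range (ε ∘ Sum.inl)))
    (l : Module.Basis (Fin s × Fin (Module.finrank k V)) k (orth L))
    (hl : ∀ i, swapDualBasisTensor ε (Sum.inl i) = l i)
    (N : Module.Grassmannian A (A ⊗[k] U) r) :
    PairingVanishes l (LinearMap.ker (dualRestrict N.toSubmodule)) ↔
      FittingVanishes ((swapDualBasisTensor ε).baseChange A)
        (relations (orth L) (LinearMap.ker (dualRestrict N.toSubmodule))) := by
  obtain ⟨b, hb⟩ := exists_adapted_basis_tensor hs N
  rw [pairingVanishes_iff (ker_dualRestrict_eq_span hb) (Module.finBasis k V).dualBasis l hl,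
    fittingVanishes_relations_iff (ker_dualRestrict_eq_span hb) (Module.finBasis k V).dualBasis
      (orth_eq_span hε)]

theorem fittingVanishes_dual_iff_of_isLocalRing [IsLocalRing A]
    (hs : Module.finrank k U - r = s) (hε : L = Submodule.span k (Set.range (ε ∘ Sum.inl)))
    (N : Module.Grassmannian A (A ⊗[k] U) r) :
    FittingVanishes ((swapDualBasisTensor ε).baseChange A)
        (relations (orth L) (LinearMap.ker (dualRestrict N.toSubmodule))) ↔
      FittingVanishes (ε.baseChange A) (relations L N.toSubmodule) := by
  obtain ⟨b, hb⟩ := exists_adapted_basis_tensor hs N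
  rw [fittingVanishes_dual_iff hb (Module.finBasis k V) hε]

theorem detVanishes_mkQ_iff_pairingVanishes
    (l : Module.Basis (Fin r × Fin (Module.finrank k V)) k L)
    (N : Module.Grassmannian A (A ⊗[k] U) r) :
    DetVanishes (Module.finrank k V * r) N.toSubmodule.mkQ L ↔ PairingVanishes l N.toSubmodule := by
  have hd : Fintype.card (Fin r × Fin (Module.finrank k V)) = Module.finrank k V * r := by
    simp [mul_comm]
  have := detVanishes_iff hd N.toSubmodule.mkQ (Submodule.mkQ_surjective _) l
  rwa [Submodule.ker_mkQ] at this

/-- `D_L` is the zero locus of the Fitting ideal of the cokernel of `M_L`. -/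
theorem detVanishes_mkQ_iff
    (hs : Module.finrank k U - r = s) (hε : L = Submodule.span k (Set.range (ε ∘ Sum.inl)))
    (N : Module.Grassmannian A (A ⊗[k] U) r) :
    DetVanishes (Module.finrank k V * r) N.toSubmodule.mkQ L ↔
      FittingVanishes (ε.baseChange A) (relations L N.toSubmodule) := by
  obtain ⟨l, hl⟩ := exists_basis_of_eq_span hε
  constructor
  · intro h
    refine FittingVanishes.of_localization ε _ fun m _ => ?_
    obtain ⟨j, hj⟩ := exists_quotMap (localizationHom k m) N
    rw [spanMap_relations, spanMap_eq_map, ← pairingVanishes_iff_fittingVanishes hs hε l hl,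
      ← detVanishes_mkQ_iff_pairingVanishes]
    exact DetVanishes.map hj h
  · intro h
    rw [detVanishes_mkQ_iff_pairingVanishes l]
    refine PairingVanishes.of_localization l _ fun m _ => ?_
    rw [spanMap_eq_map, pairingVanishes_iff_fittingVanishes hs hε l hl, ← spanMap_eq_map,
      ← spanMap_relations]
    exact h.spanMap _

theorem detVanishes_dualRestrict_iff_pairingVanishes (hs : Module.finrank k U - r = s)
    (l : Module.Basis (Fin s × Fin (Module.finrank k V)) k (orth L))
    (N : Module.Grassmannian A (A ⊗[k] U) r) :
    DetVanishes (Module.finrank k V * (Module.finrank k U - r)) (dualRestrict N.toSubmodule)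
      (orth L) ↔ PairingVanishes l (LinearMap.ker (dualRestrict N.toSubmodule)) := by
  have hd : Fintype.card (Fin s × Fin (Module.finrank k V)) =
      Module.finrank k V * (Module.finrank k U - r) := by
    simp [mul_comm, hs]
  obtain ⟨hf, hp, hsurj⟩ := finite_grassmannian N
  exact detVanishes_iff hd (dualRestrict N.toSubmodule) hsurj l

/-- `D^L` is the zero locus of the Fitting ideal of the cokernel of `M^L`. -/
theorem detVanishes_dualRestrict_iff
    (hs : Module.finrank k U - r = s) (hε : L = Submodule.span k (Set.range (ε ∘ Sum.inl)))
    (N : Module.Grassmannian A (A ⊗[k] U) r) :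
    DetVanishes (Module.finrank k V * (Module.finrank k U - r)) (dualRestrict N.toSubmodule)
      (orth L) ↔ FittingVanishes ((swapDualBasisTensor ε).baseChange A)
        (relations (orth L) (LinearMap.ker (dualRestrict N.toSubmodule))) := by
  obtain ⟨l, hl⟩ := exists_basis_of_eq_span (W := Module.Dual k U ⊗[k] Module.Dual k V)
    (orth_eq_span hε)
  constructor
  · intro h
    refine fittingVanishes_of_localization_relations (swapDualBasisTensor ε) (orth L)
      (LinearMap.ker (dualRestrict N.toSubmodule)) fun m _ => ?_
    obtain ⟨j, hj⟩ := exists_dualMap (localizationHom k m) N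
    rw [spanMap_ker_dualRestrict, ← pairingVanishes_iff_fittingVanishes_dual hs hε l hl,
      ← detVanishes_dualRestrict_iff_pairingVanishes hs]
    exact DetVanishes.map hj h
  · intro h
    rw [detVanishes_dualRestrict_iff_pairingVanishes hs l]
    refine PairingVanishes.of_localization l _ fun m _ => ?_
    rw [spanMap_ker_dualRestrict, pairingVanishes_iff_fittingVanishes_dual hs hε l hl,
      ← spanMap_ker_dualRestrict]
    exact fittingVanishes_localization_relations h m

theorem fittingVanishes_orth_iff
    (hs : Module.finrank k U - r = s) (hε : L = Submodule.span k (Set.range (ε ∘ Sum.inl)))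
    (N : Module.Grassmannian A (A ⊗[k] U) r) :
    FittingVanishes ((swapDualBasisTensor ε).baseChange A)
        (relations (orth L) (LinearMap.ker (dualRestrict N.toSubmodule))) ↔
      FittingVanishes (ε.baseChange A) (relations L N.toSubmodule) := by
  have h2 : ∀ (m : Ideal A) [m.IsMaximal],
      FittingVanishes ((swapDualBasisTensor ε).baseChange (Localization.AtPrime m))
        (relations (orth L) (spanMap (localizationHom k m)
          (LinearMap.ker (dualRestrict N.toSubmodule)))) ↔
      FittingVanishes (ε.baseChange (Localization.AtPrime m))
        (relations L (spanMap (localizationHom k m) N.toSubmodule)) := by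
    intro m _
    rw [spanMap_ker_dualRestrict, spanMap_eq_map, fittingVanishes_dual_iff_of_isLocalRing hs hε]
  constructor
  · intro h
    refine fittingVanishes_of_localization_relations ε L N.toSubmodule fun m _ => ?_
    exact (h2 m).1 (fittingVanishes_localization_relations h m)
  · intro h
    refine fittingVanishes_of_localization_relations (swapDualBasisTensor ε) (orth L)
      (LinearMap.ker (dualRestrict N.toSubmodule)) fun m _ => ?_
    exact (h2 m).2 (fittingVanishes_localization_relations h m)

theorem mem_lowerD_iff
    (hs : Module.finrank k U - r = s) (hε : L = Submodule.span k (Set.range (ε ∘ Sum.inl)))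
    {C : CommAlgCat.{u} k} (N : (Gr k U r).obj C) : N ∈ (lowerD r L).obj C ↔
      FittingVanishes (ε.baseChange C) (relations L (pt N).toSubmodule) :=
  detVanishes_mkQ_iff hs hε (pt N)

theorem mem_upperD_iff
    (hs : Module.finrank k U - r = s) (hε : L = Submodule.span k (Set.range (ε ∘ Sum.inl)))
    {C : CommAlgCat.{u} k} (N : (Gr k U r).obj C) : N ∈ (upperD r L).obj C ↔
      FittingVanishes ((swapDualBasisTensor ε).baseChange C)
        (relations (orth L) (LinearMap.ker (dualRestrict (pt N).toSubmodule))) :=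
  detVanishes_dualRestrict_iff hs hε (pt N)

theorem lowerD_eq_upperD (hs : Module.finrank k U - r = s)
    (hε : L = Submodule.span k (Set.range (ε ∘ Sum.inl))) : lowerD r L = upperD r L := by
  ext C N
  rw [mem_lowerD_iff hs hε, mem_upperD_iff hs hε]
  exact (fittingVanishes_orth_iff hs hε (pt N)).symm

end DeterminantalLoci

section RankOne

variable {R : Type*} [CommRing R] {Q : Type*} [AddCommGroup Q] [Module R Q]

/-- A criterion for a module to be invertible. -/
theorem projective_and_rankAtStalk_eq_one [Module.Finite R Q] {T : Type*} (χ : T → Module.Dual R Q)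
    (w : T → Q)
    (hχ : ∀ t q, χ t (w t) • q = χ t q • w t)
    (h1 : Ideal.span (Set.range fun t => χ t (w t)) = ⊤) :
    Module.Projective R Q ∧ ∀ p, Module.rankAtStalk (R := R) Q p = 1 := by
  have hproj : Module.Projective R Q := by
    let φ : R →ₗ[R] Module.End R Q := LinearMap.toSpanSingleton R _ LinearMap.id
    have h2 : (LinearMap.range (dualTensorHom R Q Q)).comap φ = ⊤ := by
      rw [eq_top_iff, ← h1, Ideal.span, Submodule.span_le]
      rintro _ ⟨t, rfl⟩
      refine ⟨χ t ⊗ₜ w t, LinearMap.ext fun q => ?_⟩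
      simp [φ, hχ]
    obtain ⟨z, hz⟩ : φ 1 ∈ LinearMap.range (dualTensorHom R Q Q) := by
      rw [← Submodule.mem_comap, h2]; trivial
    obtain ⟨S, rfl⟩ := TensorProduct.exists_finset z
    refine Module.Projective.of_split (M := S → R) (LinearMap.pi fun i => i.1.1)
      (Fintype.linearCombination R fun i : S => i.1.2) ?_
    rw [map_sum] at hz
    refine LinearMap.ext fun q => ?_
    have := LinearMap.congr_fun hz q
    simp only [LinearMap.sum_apply, dualTensorHom_apply, φ, LinearMap.toSpanSingleton_apply,
      one_smul] at this
    rw [← this, LinearMap.comp_apply, Fintype.linearCombination_apply]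
    exact Finset.sum_coe_sort S fun i => i.1 q • i.2
  refine ⟨hproj, fun p => ?_⟩
  have : ∃ t, χ t (w t) ∉ p.asIdeal := by
    by_contra! h
    exact p.2.ne_top (top_le_iff.1 (h1 ▸ Ideal.span_le.2 (by rintro _ ⟨t, rfl⟩; exact h t)))
  obtain ⟨t, ht⟩ := this
  rw [Module.rankAtStalk_eq]
  have hu : algebraMap R p.asIdeal.ResidueField (χ t (w t)) ≠ 0 := by
    rwa [Ne, Ideal.algebraMap_residueField_eq_zero]
  have hn : (1 : p.asIdeal.ResidueField) ⊗ₜ[R] w t ≠ 0 := by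
    intro h
    apply hu
    have := congrArg (LinearMap.baseChange p.asIdeal.ResidueField (χ t)) h
    rw [LinearMap.baseChange_tmul, map_zero] at this
    have h2 := congrArg (TensorProduct.rid R p.asIdeal.ResidueField) this
    simpa [Algebra.smul_def] using h2
  refine finrank_eq_one (1 ⊗ₜ w t : p.asIdeal.ResidueField ⊗[R] Q) hn fun x => ?_
  induction x using TensorProduct.induction_on with
  | zero => exact ⟨0, zero_smul _ _⟩
  | tmul a q =>
    refine ⟨a * algebraMap R _ (χ t q) * (algebraMap R _ (χ t (w t)))⁻¹, ?_⟩
    have h3 : (algebraMap R p.asIdeal.ResidueField (χ t q)) • (1 ⊗ₜ w t) =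
        algebraMap R p.asIdeal.ResidueField (χ t (w t)) •
          ((1 : p.asIdeal.ResidueField) ⊗ₜ[R] q) := by
      rw [algebraMap_smul, algebraMap_smul, ← TensorProduct.tmul_smul, ← TensorProduct.tmul_smul,
        hχ]
    rw [mul_right_comm, mul_smul, h3, smul_smul, mul_assoc, inv_mul_cancel₀ hu, mul_one,
      TensorProduct.smul_tmul', smul_eq_mul, mul_one]
  | add x y hx hy =>
    obtain ⟨a, ha⟩ := hx
    obtain ⟨b, hb⟩ := hy
    exact ⟨a + b, by rw [add_smul, ha, hb]⟩

end RankOne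

section RankOneIdeal

variable {k : Type u} [Field k] {W : Type v} [AddCommGroup W] [Module k W]
  {A B : Type u} [CommRing A] [Algebra k A] [CommRing B] [Algebra k B] (f : A →ₐ[k] B)
  {ι : Type*} (ε : Module.Basis ι k W)

/-- An ideal defining the locus where the quotient by `J` is cyclic, generated by a basis element.
    -/
noncomputable def cyclicIdeal (J : Submodule A (A ⊗[k] W)) : Ideal A :=
  ⨆ i, (J ⊔ Submodule.span A {1 ⊗ₜ ε i}).colon Set.univ

theorem spanMap_sup_span (J : Submodule A (A ⊗[k] W)) (x : W) :
    spanMap f (J ⊔ Submodule.span A {1 ⊗ₜ x}) =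
      spanMap f J ⊔ Submodule.span B {1 ⊗ₜ x} := by
  rw [spanMap_sup, spanMap_span]
  simp

theorem map_colon_le (Y : Submodule A (A ⊗[k] W)) :
    (Y.colon Set.univ).map f ≤ (spanMap f Y).colon Set.univ := by
  rw [Ideal.map_le_iff_le_comap]
  intro a ha
  rw [Ideal.mem_comap, Submodule.mem_colon]
  intro x _
  have hx : x ∈ spanMap f (⊤ : Submodule A (A ⊗[k] W)) := by
    rw [spanMap_top]; trivial
  induction hx using Submodule.span_induction with
  | mem x hx =>
    obtain ⟨y, -, rfl⟩ := hx
    have := scalarMap_mem_spanMap f (Submodule.mem_colon.1 ha y (Set.mem_univ _))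
    rwa [scalarMap_smul] at this
  | zero => rw [smul_zero]; exact zero_mem _
  | add x y _ _ hx hy => rw [smul_add]; exact add_mem (hx trivial) (hy trivial)
  | smul b x _ hx => rw [smul_comm]; exact Submodule.smul_mem _ _ (hx trivial)

theorem map_cyclicIdeal_le (J : Submodule A (A ⊗[k] W)) :
    (cyclicIdeal ε J).map f ≤ cyclicIdeal ε (spanMap f J) := by
  rw [cyclicIdeal, Ideal.map_iSup]
  refine iSup_mono fun i => ?_
  rw [← spanMap_sup_span]
  exact map_colon_le f _

theorem colon_univ_eq_top {R M : Type*} [CommRing R] [AddCommGroup M] [Module R M]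
    (N : Submodule R M) : N.colon Set.univ = ⊤ ↔ N = ⊤ :=
  (Submodule.colon_eq_top_iff_subset (S := Set.univ)).trans
    (Set.univ_subset_iff.trans Submodule.coe_eq_univ)

variable {K : Type u} [Field K] [Algebra k K]

theorem cyclicIdeal_eq_top_iff (J : Submodule K (K ⊗[k] W)) :
    cyclicIdeal ε J = ⊤ ↔ ∃ i, J ⊔ Submodule.span K {1 ⊗ₜ ε i} = ⊤ := by
  constructor
  · intro h
    by_contra! h2
    have h3 : cyclicIdeal ε J = ⊥ := by
      rw [cyclicIdeal, iSup_eq_bot]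
      intro i
      refine (Ideal.eq_bot_or_top _).resolve_right fun h4 => h2 i ?_
      rwa [colon_univ_eq_top] at h4
    exact bot_ne_top (h3.symm.trans h)
  · rintro ⟨i, hi⟩
    rw [eq_top_iff, ← (colon_univ_eq_top _).2 hi]
    exact le_iSup (fun i => (J ⊔ Submodule.span K {1 ⊗ₜ ε i}).colon Set.univ) i

variable [Fintype ι]

theorem cyclicIdeal_eq_top_iff_finrank [Nonempty ι] (J : Submodule K (K ⊗[k] W)) :
    cyclicIdeal ε J = ⊤ ↔ Fintype.card ι ≤ Module.finrank K J + 1 := by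
  have hfr : Module.finrank K (K ⊗[k] W) = Fintype.card ι :=
    Module.finrank_eq_card_basis (ε.baseChange K)
  have : FiniteDimensional K (K ⊗[k] W) := (ε.baseChange K).finiteDimensional_of_finite
  rw [cyclicIdeal_eq_top_iff]
  constructor
  · rintro ⟨i, hi⟩
    rw [← hfr, ← finrank_top, ← hi]
    refine (Submodule.finrank_add_le_finrank_add_finrank _ _).trans ?_
    exact Nat.add_le_add_left ((finrank_span_le_card _).trans (by simp)) _
  · intro h
    by_cases hJ : J = ⊤
    · obtain ⟨i⟩ := ‹Nonempty ι›
      exact ⟨i, by rw [hJ, top_sup_eq]⟩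
    · have : ∃ i, (1 : K) ⊗ₜ ε i ∉ J := by
        by_contra! h2
        apply hJ
        rw [eq_top_iff, ← (ε.baseChange K).span_eq, Submodule.span_le]
        rintro _ ⟨i, rfl⟩
        rw [Module.Basis.baseChange_apply]
        exact h2 i
      obtain ⟨i, hi⟩ := this
      refine ⟨i, Submodule.eq_top_of_finrank_eq (le_antisymm (Submodule.finrank_le _) ?_)⟩
      have h3 : J < J ⊔ Submodule.span K {1 ⊗ₜ ε i} :=
        left_lt_sup.2 fun h => hi (h (Submodule.mem_span_singleton_self _))
      have := Submodule.finrank_lt_finrank_of_lt h3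
      omega

variable [DecidableEq ι]

theorem map_cyclicIdeal_eq_top_iff (J : Submodule A (A ⊗[k] W)) :
    (cyclicIdeal ε J).map f = ⊤ ↔ cyclicIdeal ε (spanMap f J) = ⊤ := by
  refine ⟨fun h => top_le_iff.1 (h ▸ map_cyclicIdeal_le f ε J), fun h => ?_⟩
  by_contra hne
  obtain ⟨q, hq, hle⟩ := Ideal.exists_le_maximal _ hne
  let := Ideal.Quotient.field q
  have h2 : cyclicIdeal ε (spanMap ((Ideal.Quotient.mkₐ k q).comp f) J) = ⊤ := by
    rw [spanMap_comp]
    refine top_le_iff.1 (le_trans ?_ (map_cyclicIdeal_le _ ε _))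
    rw [h, Ideal.map_top]
  rw [cyclicIdeal_eq_top_iff] at h2
  obtain ⟨i, hi⟩ := h2
  rw [← spanMap_sup_span] at hi
  obtain ⟨a, ha, hfa⟩ := exists_mem_colon_of_spanMap_eq_top _ ε hi
  refine hfa (Ideal.Quotient.eq_zero_iff_mem.2 (hle (Ideal.mem_map_of_mem f ?_)))
  exact Submodule.mem_iSup_of_mem i ha

/-- The quotient by `J` is cyclic if it is cyclic at all residue fields. -/
theorem cyclicIdeal_eq_top_iff_forall (J : Submodule A (A ⊗[k] W)) :
    cyclicIdeal ε J = ⊤ ↔ ∀ (K : Type u) [Field K] [Algebra k K] (g : A →ₐ[k] K),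
      cyclicIdeal ε (spanMap g J) = ⊤ := by
  constructor
  · intro h K _ _ g
    rw [← map_cyclicIdeal_eq_top_iff, h, Ideal.map_top]
  · intro h
    by_contra hne
    obtain ⟨q, hq, hle⟩ := Ideal.exists_le_maximal _ hne
    let := Ideal.Quotient.field q
    have := h (A ⧸ q) (Ideal.Quotient.mkₐ k q)
    rw [← map_cyclicIdeal_eq_top_iff] at this
    refine bot_ne_top ((le_bot_iff.1 ?_).symm.trans this)
    rw [Ideal.map_le_iff_le_comap]
    intro a ha
    exact Ideal.Quotient.eq_zero_iff_mem.2 (hle ha)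

/-- If the zeroth Fitting ideal of the quotient by `J` vanishes and the quotient is locally cyclic,
then it is invertible. -/
theorem exists_grassmannian_of_cyclicIdeal {J : Submodule A (A ⊗[k] W)}
    (hJ : FittingVanishes (ε.baseChange A) J) (h1 : cyclicIdeal ε J = ⊤) :
    ∃ H : Module.Grassmannian A (A ⊗[k] W) 1, H.toSubmodule = J := by
  let β := ε.baseChange A
  let T := {y : ι → A ⊗[k] W // ∀ i, y i ∈ J} × ι × ι
  have hlift : ∀ t : T, J ≤ LinearMap.ker (β.det.toMultilinearMap.toLinearMap t.1.1 t.2.1) := by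
    intro t x hx
    rw [LinearMap.mem_ker]
    refine hJ _ fun i => ?_
    by_cases hi : i = t.2.1
    · subst hi; simpa using hx
    · simpa [hi] using t.1.2 i
  let χ : T → Module.Dual A ((A ⊗[k] W) ⧸ J) := fun t => J.liftQ _ (hlift t)
  let w : T → (A ⊗[k] W) ⧸ J := fun t => J.mkQ (β t.2.2)
  have hχ : ∀ t p, χ t (J.mkQ p) = β.det (Function.update t.1.1 t.2.1 p) := fun t p => rfl
  have hχw : ∀ t q, χ t (w t) • q = χ t q • w t := by
    intro t q
    obtain ⟨p, rfl⟩ := J.mkQ_surjective q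
    rw [hχ, hχ, ← map_smul, basis_det_smul, map_sum, Finset.sum_eq_single t.2.1]
    · simp [w]
    · intro i _ hi
      rw [map_smul, Function.update_of_ne hi, Submodule.mkQ_apply,
        (Submodule.Quotient.mk_eq_zero _).2 (t.1.2 i), smul_zero]
    · simp
  have hspan : Ideal.span (Set.range fun t => χ t (w t)) = ⊤ := by
    by_contra hne
    obtain ⟨q, hq, hle⟩ := Ideal.exists_le_maximal _ hne
    let := Ideal.Quotient.field q
    obtain ⟨i, hi⟩ := (cyclicIdeal_eq_top_iff ε _).1
      ((cyclicIdeal_eq_top_iff_forall ε J).1 h1 (A ⧸ q) (Ideal.Quotient.mkₐ k q))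
    rw [← spanMap_sup_span, ← Submodule.span_eq J, ← Submodule.span_union, spanMap_span] at hi
    obtain ⟨y, hy, hdet⟩ := exists_det_ne_zero_of_spanMap_eq_top _ ε hi
    obtain ⟨l, hl⟩ : ∃ l, y l ∉ J := by
      by_contra! h
      exact hdet (by rw [hJ y h, map_zero])
    have hyl : ∀ l, y l ∉ J → y l = 1 ⊗ₜ ε i := fun l h => (hy l).resolve_left h
    have hy' : ∀ j, Function.update y l 0 j ∈ J := by
      intro j
      by_cases hj : j = l
      · subst hj; simp
      · rw [Function.update_of_ne hj]
        by_contra h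
        refine hdet ?_
        rw [((ε.baseChange A).det).map_eq_zero_of_eq y ((hyl j h).trans (hyl l hl).symm) hj,
          map_zero]
    refine hdet (Ideal.Quotient.eq_zero_iff_mem.2 (hle (Ideal.subset_span
      ⟨⟨⟨Function.update y l 0, hy'⟩, l, i⟩, ?_⟩)))
    have h3 : β i = y l := by rw [hyl l hl, Module.Basis.baseChange_apply]
    change χ _ (J.mkQ (β i)) = _
    rw [hχ, h3]
    simp [β]
  have hfin : Module.Finite A (A ⊗[k] W) := Module.Finite.of_basis β
  obtain ⟨hp, hr⟩ := projective_and_rankAtStalk_eq_one χ w hχw hspan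
  exact ⟨⟨J, inferInstance, hp, hr⟩, rfl⟩

end RankOneIdeal

section Corank

variable {K : Type*} [Field K] {E E' : Type*} [AddCommGroup E] [Module K E] [AddCommGroup E']
  [Module K E'] {I J : Type*} [Fintype I] [Fintype J] [DecidableEq I] [DecidableEq J]

theorem map_span_inl_eq_dualAnnihilator (Φ : E' →ₗ[K] Module.Dual K E)
    (e : Module.Basis (I ⊕ J) K E) (e' : J ⊕ I → E') (h : ∀ i, Φ (e' i) = e.coord i.swap) :
    (Submodule.span K (Set.range (e' ∘ Sum.inl))).map Φ =
      (Submodule.span K (Set.range (e ∘ Sum.inl))).dualAnnihilator := by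
  rw [Submodule.map_span, ← Set.range_comp]
  have h1 : Φ ∘ e' ∘ Sum.inl = e.dualBasis ∘ Sum.inr := by
    ext1 i
    simp [h]
  rw [h1]
  ext η
  rw [mem_span_range_inr_iff, Submodule.mem_dualAnnihilator]
  have h2 : ∀ i, e.dualBasis.repr η i = η (e i) := fun i => by
    rw [Module.Basis.dualBasis_repr]
  constructor
  · intro h w hw
    induction hw using Submodule.span_induction with
    | mem w hw =>
      obtain ⟨i, rfl⟩ := hw
      exact (h2 _).symm.trans (h i)
    | zero => exact map_zero _
    | add x y _ _ hx hy => rw [map_add, hx, hy, add_zero]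
    | smul a x _ hx => rw [map_smul, hx, smul_zero]
  · intro h i
    rw [h2]
    exact h _ (Submodule.subset_span ⟨i, rfl⟩)

theorem map_span_inr_eq_dualAnnihilator (Φ : E' →ₗ[K] Module.Dual K E)
    (e : Module.Basis (I ⊕ J) K E) (e' : J ⊕ I → E') (h : ∀ i, Φ (e' i) = e.coord i.swap) :
    (Submodule.span K (Set.range (e' ∘ Sum.inr))).map Φ =
      (Submodule.span K (Set.range (e ∘ Sum.inr))).dualAnnihilator := by
  have := map_span_inl_eq_dualAnnihilator Φ (e.reindex (Equiv.sumComm I J)) (e' ∘ Sum.swap)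
    fun i => by
      rw [Function.comp_apply, h]
      obtain i | i := i <;> exact e.ext fun j => by
        obtain j | j := j <;> simp [Finsupp.mapDomain_single, Finsupp.single_apply]
  have h1 : (e.reindex (Equiv.sumComm I J)) ∘ Sum.inl = e ∘ Sum.inr := by ext i; simp
  rwa [h1] at this

/-- The sum of two subspaces of complementary dimensions and the sum of their annihilators have the
same dimension. -/
theorem finrank_sup_dual (Φ : E' →ₗ[K] Module.Dual K E) (hΦ : Function.Injective Φ)
    (e g : Module.Basis (I ⊕ J) K E) (e' g' : J ⊕ I → E') (he : ∀ i, Φ (e' i) = e.coord i.swap)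
    (hg : ∀ i, Φ (g' i) = g.coord i.swap) :
    Module.finrank K ↥(Submodule.span K (Set.range (e' ∘ Sum.inl)) ⊔
        Submodule.span K (Set.range (g' ∘ Sum.inr))) =
      Module.finrank K ↥(Submodule.span K (Set.range (e ∘ Sum.inl)) ⊔
        Submodule.span K (Set.range (g ∘ Sum.inr))) := by
  have : FiniteDimensional K E := e.finiteDimensional_of_finite
  rw [(Submodule.equivMapOfInjective Φ hΦ _).finrank_eq, Submodule.map_sup,
    map_span_inl_eq_dualAnnihilator Φ e e' he, map_span_inr_eq_dualAnnihilator Φ g g' hg,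
    ← Subspace.dualAnnihilator_inf_eq]
  have h1 := Subspace.finrank_add_finrank_dualAnnihilator_eq
    (Submodule.span K (Set.range (e ∘ Sum.inl)) ⊓ Submodule.span K (Set.range (g ∘ Sum.inr)))
  have h2 := Submodule.finrank_sup_add_finrank_inf_eq
    (Submodule.span K (Set.range (e ∘ Sum.inl))) (Submodule.span K (Set.range (g ∘ Sum.inr)))
  rw [finrank_span_eq_card (e.linearIndependent.comp _ Sum.inl_injective),
    finrank_span_eq_card (g.linearIndependent.comp _ Sum.inr_injective)] at h2
  rw [Module.finrank_eq_card_basis e, Fintype.card_sum] at h1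
  omega

end Corank

section Cyclic

variable {k : Type u} [Field k] {U V : Type v} [AddCommGroup U] [Module k U] [FiniteDimensional k U]
  [AddCommGroup V] [Module k V] [FiniteDimensional k V] {r s : ℕ} {L : Submodule k (U ⊗[k] V)}
  {ε : Module.Basis (Fin r × Fin (Module.finrank k V) ⊕ Fin s × Fin (Module.finrank k V)) k
    (U ⊗[k] V)}

theorem finrank_relations_orth {K : Type u} [Field K] [Algebra k K]
    (hs : Module.finrank k U - r = s) (hε : L = Submodule.span k (Set.range (ε ∘ Sum.inl)))
    (N : Module.Grassmannian K (K ⊗[k] U) r) :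
    Module.finrank K (relations (orth L) (LinearMap.ker (dualRestrict N.toSubmodule))) =
      Module.finrank K (relations L N.toSubmodule) := by
  obtain ⟨b, hb⟩ := exists_adapted_basis_tensor hs N
  let c := Module.finBasis k V
  rw [relations_eq_span hb c hε,
    relations_eq_span (ker_dualRestrict_eq_span hb) c.dualBasis (orth_eq_span hε)]
  refine finrank_sup_dual dualEvTensor ?_ (ε.baseChange K) (tensorBasis b c) _ _ (fun i => ?_)
    (tensorBasis_dual b c)
  · have h1 : Function.Injective ((TensorProduct.dualDistrib k U V).baseChange K) := by
      have : TensorProduct.dualDistrib k U V =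
        (TensorProduct.dualDistribEquiv k U V).toLinearMap := rfl
      rw [this]
      exact ((TensorProduct.dualDistribEquiv k U V).baseChange k K _ _).injective
    exact (dualEvEquiv (A := K) (U := U ⊗[k] V)).injective.comp h1
  · refine (ε.baseChange K).ext fun j => ?_
    rw [Module.Basis.baseChange_apply, Module.Basis.baseChange_apply, dualEvTensor,
      LinearMap.comp_apply, LinearMap.baseChange_tmul, dualDistrib_swapDualBasisTensor]
    simp

theorem cyclicIdeal_orth_eq_top_iff {A : Type u} [CommRing A] [Algebra k A]
    (hs : Module.finrank k U - r = s) (hrs : 0 < r * Module.finrank k V)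
    (hε : L = Submodule.span k (Set.range (ε ∘ Sum.inl)))
    (N : Module.Grassmannian A (A ⊗[k] U) r) :
    cyclicIdeal (swapDualBasisTensor ε)
        (relations (orth L) (LinearMap.ker (dualRestrict N.toSubmodule))) = ⊤ ↔
      cyclicIdeal ε (relations L N.toSubmodule) = ⊤ := by
  have hr : 0 < r := Nat.pos_of_mul_pos_right hrs
  have hn : 0 < Module.finrank k V := Nat.pos_of_mul_pos_left hrs
  let i₀ : Fin r × Fin (Module.finrank k V) := (⟨0, hr⟩, ⟨0, hn⟩)
  have : Nonempty (Fin r × Fin (Module.finrank k V) ⊕ Fin s × Fin (Module.finrank k V)) :=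
    ⟨Sum.inl i₀⟩
  have : Nonempty (Fin s × Fin (Module.finrank k V) ⊕ Fin r × Fin (Module.finrank k V)) :=
    ⟨Sum.inr i₀⟩
  rw [cyclicIdeal_eq_top_iff_forall, cyclicIdeal_eq_top_iff_forall]
  refine forall_congr' fun K => forall_congr' fun _ => forall_congr' fun _ =>
    forall_congr' fun g => ?_
  rw [spanMap_relations, spanMap_relations, spanMap_ker_dualRestrict, spanMap_eq_map,
    cyclicIdeal_eq_top_iff_finrank, cyclicIdeal_eq_top_iff_finrank, finrank_relations_orth hs hε]
  simp only [Fintype.card_sum]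
  rw [add_comm]

end Cyclic

section Incidence

variable {k : Type u} [Field k] {W : Type v} [AddCommGroup W] [Module k W]
  {G : CommAlgCat.{u} k ⥤ Type (max u v)}

theorem IsOpenSub.preimage {F F' : CommAlgCat.{u} k ⥤ Type w} {T : Subfunctor F}
    (hT : IsOpenSub T) (p : F' ⟶ F) : IsOpenSub (T.preimage p) := by
  intro A x
  obtain ⟨I, hI⟩ := hT A (p.app A x)
  refine ⟨I, fun B f => ?_⟩
  rw [← hI B f, ← NatTrans.naturality_apply]
  rfl

/-- A family of submodules of `A ⊗ W`, indexed by the `A`-points of `G`, that is compatible with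
base change: the relations of a coherent sheaf on `G` presented as a quotient of `W ⊗ 𝒪`. -/
structure SheafRelations (G : CommAlgCat.{u} k ⥤ Type (max u v)) (W : Type v) [AddCommGroup W]
    [Module k W] where
  /-- The relations at a point. -/
  rel : ∀ A : CommAlgCat.{u} k, G.obj A → Submodule A (A ⊗[k] W)
  rel_map : ∀ {A B : CommAlgCat.{u} k} (f : A ⟶ B) (x : G.obj A),
    rel B (G.map f x) = spanMap f.hom (rel A x)

variable (J : SheafRelations G W) {ι : Type} [Fintype ι] [DecidableEq ι] (ε : Module.Basis ι k W)

/-- The support of a coherent sheaf, defined by the zeroth Fitting ideal. -/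
def SheafRelations.support : Subfunctor G where
  obj A := {x | FittingVanishes (P := A ⊗[k] W) (ε.baseChange A) (J.rel A x)}
  map {A B} f x hx := by
    change FittingVanishes (P := B ⊗[k] W) _ (J.rel _ _)
    rw [J.rel_map]
    exact FittingVanishes.spanMap _ hx

/-- The projectivization of a coherent sheaf. -/
def SheafRelations.proj : Subfunctor (FunctorToTypes.prod G (ProjSpace k W)) where
  obj A := {p | J.rel A p.1 ≤ (pt p.2).toSubmodule}
  map {A B} f p hp := by
    change J.rel B (G.map f p.1) ≤ (Module.Grassmannian.map f.hom (pt p.2)).toSubmodule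
    rw [J.rel_map, ← spanMap_eq_map]
    exact Submodule.span_mono (Set.image_mono hp)

/-- The part of a subfunctor where the sheaf is locally cyclic. -/
def SheafRelations.cyclicLocus (D : Subfunctor G) : Subfunctor D.toFunctor where
  obj A := {x | cyclicIdeal ε (J.rel A x.1) = ⊤}
  map {A B} f x hx := by
    change cyclicIdeal ε (J.rel B (G.map f x.1)) = ⊤
    rw [J.rel_map, ← map_cyclicIdeal_eq_top_iff, show cyclicIdeal ε (J.rel A x.1) = ⊤ from hx,
      Ideal.map_top]

theorem SheafRelations.isOpenSub_cyclicLocus (D : Subfunctor G) :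
    IsOpenSub (J.cyclicLocus ε D) := by
  intro A x
  refine ⟨cyclicIdeal ε (J.rel A x.1), fun B f => ?_⟩
  rw [map_cyclicIdeal_eq_top_iff, ← J.rel_map]
  rfl

variable {J} in
theorem SheafRelations.mem_support_of_mem_proj {A : CommAlgCat.{u} k}
    {p : (FunctorToTypes.prod G (ProjSpace k W)).obj A} (hp : p ∈ J.proj.obj A) :
    p.1 ∈ (J.support ε).obj A := fun y hy =>
  grassmannian_faithful (pt p.2) one_pos _ fun x => hp (basis_det_smul_mem _ y _ hy x)

variable {ε} {D : Subfunctor G} (hD : D = J.support ε)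

/-- The morphism from the projectivization of a coherent sheaf to its support. -/
def SheafRelations.projHom : J.proj.toFunctor ⟶ D.toFunctor where
  app _ := TypeCat.ofHom fun p => ⟨p.1.1, hD ▸ mem_support_of_mem_proj ε p.2⟩
  naturality _ _ _ := rfl

theorem SheafRelations.projHom_bijective (A : CommAlgCat.{u} k) :
    Function.Bijective fun p : ((J.cyclicLocus ε D).preimage (J.projHom hD)).toFunctor.obj A =>
      (⟨(J.projHom hD).app A p.1, p.2⟩ : (J.cyclicLocus ε D).toFunctor.obj A) := by
  have key : ∀ p : ((J.cyclicLocus ε D).preimage (J.projHom hD)).toFunctor.obj A,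
      J.rel A p.1.1.1 = (pt p.1.1.2).toSubmodule := by
    intro p
    obtain ⟨H, hH⟩ := exists_grassmannian_of_cyclicIdeal ε
      (mem_support_of_mem_proj ε p.1.2) p.2
    have h1 : J.rel A p.1.1.1 ≤ (pt p.1.1.2).toSubmodule := p.1.2
    rw [← hH] at h1 ⊢
    rw [grassmannian_le_antisymm h1]
  constructor
  · intro p q hpq
    have h1 : p.1.1.1 = q.1.1.1 := congrArg (fun x => x.1.1) hpq
    have h2 : p.1.1.2 = q.1.1.2 := by
      refine Module.Grassmannian.ext (N₁ := pt p.1.1.2) (N₂ := pt q.1.1.2) ?_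
      rw [← key p, ← key q, h1]
    exact Subtype.ext (Subtype.ext (Prod.ext h1 h2))
  · rintro ⟨⟨x, hx⟩, hx'⟩
    have hx2 : x ∈ (J.support ε).obj A := hD ▸ hx
    obtain ⟨H, hH⟩ := exists_grassmannian_of_cyclicIdeal ε hx2 hx'
    exact ⟨⟨⟨(x, H), hH.ge⟩, hx'⟩, rfl⟩

/-- The projectivization of a coherent sheaf is isomorphic to the support over the locus where the
sheaf is locally cyclic. -/
noncomputable def SheafRelations.projIso :
    ((J.cyclicLocus ε D).preimage (J.projHom hD)).toFunctor ≅ (J.cyclicLocus ε D).toFunctor :=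
  NatIso.ofComponents (fun A => (Equiv.ofBijective _ (J.projHom_bijective hD A)).toIso)
    fun _ => rfl

end Incidence

section Birational

variable {k : Type u} [Field k]

theorem Birational.of_isOpenSub {F G H : CommAlgCat.{u} k ⥤ Type w} {T : Subfunctor G}
    (hT : IsOpenSub T) (hT' : Dense (pointsOf T)) (p : F ⟶ G) (q : H ⟶ G)
    (ep : (T.preimage p).toFunctor ≅ T.toFunctor) (eq : (T.preimage q).toFunctor ≅ T.toFunctor)
    (hp : Dense (pointsOf (T.preimage p))) (hq : Dense (pointsOf (T.preimage q))) :
    Birational F G ∧ Birational H G ∧ Birational F H :=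
  ⟨⟨_, _, ⟨hT.preimage p, hp⟩, ⟨hT, hT'⟩, ⟨ep⟩⟩, ⟨_, _, ⟨hT.preimage q, hq⟩, ⟨hT, hT'⟩, ⟨eq⟩⟩,
    ⟨_, _, ⟨hT.preimage p, hp⟩, ⟨hT.preimage q, hq⟩, ⟨ep.trans eq.symm⟩⟩⟩

theorem IsOpenSub.isOpen {F : CommAlgCat.{u} k ⥤ Type w} {S : Subfunctor F} (hS : IsOpenSub S) :
    IsOpen (pointsOf S) := TopologicalSpace.isOpen_generateFrom_of_mem ⟨S, hS, rfl⟩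

theorem IsOpenSub.inf {F : CommAlgCat.{u} k ⥤ Type w} {S T : Subfunctor F} (hS : IsOpenSub S)
    (hT : IsOpenSub T) : IsOpenSub (S ⊓ T) := by
  intro A x
  obtain ⟨I, hI⟩ := hS A x
  obtain ⟨I', hI'⟩ := hT A x
  refine ⟨I * I', fun B f => ?_⟩
  rw [Ideal.map_mul, ← Ideal.isUnit_iff, IsUnit.mul_iff, Ideal.isUnit_iff, Ideal.isUnit_iff]
  exact and_congr (hI B f) (hI' B f)

theorem isTopologicalBasis_points (F : CommAlgCat.{u} k ⥤ Type w) :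
    TopologicalSpace.IsTopologicalBasis
      {s : Set (Points F) | ∃ S : Subfunctor F, IsOpenSub S ∧ s = pointsOf S} where
  exists_subset_inter := by
    rintro _ ⟨S, hS, rfl⟩ _ ⟨T, hT, rfl⟩ x hx
    exact ⟨_, ⟨S ⊓ T, hS.inf hT, rfl⟩, hx, subset_rfl⟩
  sUnion_eq := by
    refine Set.eq_univ_of_forall fun x => ?_
    refine ⟨_, ⟨⊤, fun A x => ⟨⊤, fun B f => ?_⟩, rfl⟩, trivial⟩
    rw [Ideal.map_top]
    exact iff_of_true trivial rfl
  eq_generateFrom := rfl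

end Birational

section Determinantal

variable {k : Type u} [Field k] {U V : Type v} [AddCommGroup U] [Module k U] [AddCommGroup V]
  [Module k V] (r : ℕ) (L : Submodule k (U ⊗[k] V))

/-- The cokernel of `L ⊗ 𝒪 → V ⊗ 𝒬`, as a quotient of `U ⊗ V ⊗ 𝒪`. -/
noncomputable def relX : SheafRelations.{u, v} (Gr k U r) (U ⊗[k] V) where
  rel _ N := relations L (pt N).toSubmodule
  rel_map f N := by
    rw [spanMap_relations]
    exact congrArg _ (spanMap_eq_map f.hom (pt N)).symm

theorem linX_eq_proj : linX r L = (relX r L).proj := by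
  ext A p
  exact and_comm.trans (relations_le_iff (N := (pt p.1).toSubmodule)).symm

variable [FiniteDimensional k U]

/-- The cokernel of `L^⊥ ⊗ 𝒪 → V^∨ ⊗ 𝒰^∨`, as a quotient of `U^∨ ⊗ V^∨ ⊗ 𝒪`. -/
noncomputable def relY :
    SheafRelations.{u, max u v} (Gr k U r) (Module.Dual k U ⊗[k] Module.Dual k V) where
  rel _ N := relations (orth L) (LinearMap.ker (dualRestrict (pt N).toSubmodule))
  rel_map f N := by
    rw [spanMap_relations]
    exact congrArg _ (spanMap_ker_dualRestrict f.hom (pt N)).symm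

theorem linY_eq_proj : linY r L = (relY r L).proj := by
  ext A p
  exact and_comm.trans
    (relations_le_iff (N := LinearMap.ker (dualRestrict (pt p.1).toSubmodule))).symm

variable [FiniteDimensional k V] {r L} {s : ℕ}
  {ε : Module.Basis (Fin r × Fin (Module.finrank k V) ⊕ Fin s × Fin (Module.finrank k V)) k
    (U ⊗[k] V)}

theorem lowerD_eq_support_relX (hs : Module.finrank k U - r = s)
    (hε : L = Submodule.span k (Set.range (ε ∘ Sum.inl))) :
    lowerD r L = (relX r L).support ε := by
  ext C N
  exact mem_lowerD_iff hs hε N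

theorem lowerD_eq_support_relY (hs : Module.finrank k U - r = s)
    (hε : L = Submodule.span k (Set.range (ε ∘ Sum.inl))) :
    lowerD r L = (relY r L).support (swapDualBasisTensor ε) := by
  rw [lowerD_eq_upperD hs hε]
  ext C N
  exact mem_upperD_iff hs hε N

theorem cyclicLocus_relY (hs : Module.finrank k U - r = s) (hrs : 0 < r * Module.finrank k V)
    (hε : L = Submodule.span k (Set.range (ε ∘ Sum.inl))) :
    (relY r L).cyclicLocus (swapDualBasisTensor ε) (lowerD r L) =
      (relX r L).cyclicLocus ε (lowerD r L) := by
  ext C N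
  exact cyclicIdeal_orth_eq_top_iff hs hrs hε (pt N.1)

end Determinantal

section CommutativeAlgebra

variable {k : Type u} [Field k]

/-- A form of the Nullstellensatz. -/
theorem exists_algHom_ne_zero [IsAlgClosed k] {C : Type w} [CommRing C] [Algebra k C]
    [Algebra.FiniteType k C] (q : Ideal C) [q.IsPrime] {h : C} (hq : h ∉ q) :
    ∃ φ : C →ₐ[k] k, (∀ x ∈ q, φ x = 0) ∧ φ h ≠ 0 := by
  let h' : C ⧸ q := Ideal.Quotient.mk q h
  have hh' : h' ≠ 0 := fun h0 => hq (Ideal.Quotient.eq_zero_iff_mem.1 h0)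
  let S := Localization.Away h'
  have : Nontrivial S :=
    (IsLocalization.injective S (powers_le_nonZeroDivisors_of_noZeroDivisors hh')).nontrivial
  obtain ⟨m, hm⟩ := Ideal.exists_maximal S
  let := Ideal.Quotient.field m
  have : Algebra.FiniteType k S := inferInstance
  have : Module.Finite k (S ⧸ m) := finite_of_finite_type_of_isJacobsonRing k (S ⧸ m)
  let ψ : C →ₐ[k] S ⧸ m := ((Ideal.Quotient.mkₐ k m).comp
    (IsScalarTower.toAlgHom k (C ⧸ q) S)).comp (Ideal.Quotient.mkₐ k q)
  let χ : (S ⧸ m) →ₐ[k] k := (AlgEquiv.ofBijective (Algebra.ofId k (S ⧸ m))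
    IsAlgClosed.algebraMap_bijective_of_isIntegral).symm
  refine ⟨χ.comp ψ, fun x hx => ?_, ?_⟩
  · have : ψ x = 0 := by
      simp [ψ, Ideal.Quotient.eq_zero_iff_mem.2 hx]
    rw [AlgHom.comp_apply, this, map_zero]
  · have : IsUnit (χ.comp ψ h) := by
      have h1 : IsUnit (algebraMap (C ⧸ q) S h') := IsLocalization.Away.algebraMap_isUnit h'
      exact (h1.map (Ideal.Quotient.mkₐ k m)).map χ
    exact this.ne_zero

theorem exists_ltSeries_of_isIntegral {R S : Type*} [CommRing R] [CommRing S] [Algebra R S]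
    [Algebra.IsIntegral R S] (hinj : Function.Injective (algebraMap R S))
    (l : LTSeries (PrimeSpectrum R)) : ∃ l' : LTSeries (PrimeSpectrum S), l'.length = l.length := by
  suffices H : ∃ l' : LTSeries (PrimeSpectrum S), l'.length = l.length ∧
      l'.last.comap (algebraMap R S) = l.last from H.imp fun _ h => h.1
  induction l using RelSeries.inductionOn' with
  | singleton p =>
    obtain ⟨Q, -, hQ, hQp⟩ := Ideal.exists_ideal_over_prime_of_isIntegral p.asIdeal (⊥ : Ideal S)
      (by rw [Ideal.comap_bot_of_injective _ hinj]; exact bot_le)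
    exact ⟨RelSeries.singleton _ ⟨Q, hQ⟩, rfl, PrimeSpectrum.ext hQp⟩
  | snoc l p hp ih =>
    obtain ⟨l', hl', hlast⟩ := ih
    have hlt : l.last < p := hp
    obtain ⟨Q, hle, hQ, hQp⟩ := Ideal.exists_ideal_over_prime_of_isIntegral p.asIdeal
      l'.last.asIdeal (by
        have := congrArg PrimeSpectrum.asIdeal hlast
        rw [PrimeSpectrum.comap_asIdeal] at this
        rw [this]
        exact hlt.le)
    have hlt' : l'.last < ⟨Q, hQ⟩ := by
      refine lt_of_le_of_ne hle fun h => hlt.ne ?_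
      rw [← hlast, h]
      exact PrimeSpectrum.ext hQp
    refine ⟨l'.snoc ⟨Q, hQ⟩ hlt', by simp [hl'], ?_⟩
    rw [RelSeries.last_snoc, RelSeries.last_snoc]
    exact PrimeSpectrum.ext hQp

/-- The Krull dimension of a finitely generated domain is at least its transcendence degree. -/
theorem le_ringKrullDim_of_algebraicIndependent {C : Type u} [CommRing C] [IsDomain C] [Algebra k C]
    [Algebra.FiniteType k C] {I : Type} [Fintype I] {x : I → C} (hx : AlgebraicIndependent k x) :
    (Fintype.card I : WithBot ℕ∞) ≤ ringKrullDim C := by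
  obtain ⟨e, g, hinj, hint⟩ := exists_integral_inj_algHom_of_fg k C
  have h1 : Fintype.card I ≤ e := by
    let s := Set.range (g ∘ MvPolynomial.X)
    have hs : Algebra.adjoin k s = g.range := by
      rw [Algebra.adjoin_range_eq_range_aeval, ← MvPolynomial.aeval_unique]
    have : Algebra.IsAlgebraic (Algebra.adjoin k s) C := by
      have : Algebra.IsIntegral (Algebra.adjoin k s) C := ⟨fun c => by
        obtain ⟨p, hp, hpc⟩ := hint c
        refine ⟨p.map (g.rangeRestrict.toRingHom.comp (RingHom.id _)) |>.map
          (Subalgebra.equivOfEq _ _ hs.symm).toRingHom, ?_, ?_⟩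
        · exact (hp.map _).map _
        · rw [Polynomial.eval₂_map, Polynomial.eval₂_map]
          exact hpc⟩
      infer_instance
    have h2 := Algebra.IsAlgebraic.trdeg_le_cardinalMk k s
    have h3 := hx.lift_cardinalMk_le_trdeg
    have h4 : Cardinal.mk s ≤ e := by
      have := Cardinal.mk_range_le_lift (f := g ∘ MvPolynomial.X)
      simpa using this
    have h5 : Algebra.trdeg k C ≤ e := h2.trans h4
    rw [Cardinal.mk_fintype, Cardinal.lift_natCast] at h3
    have h6 := h3.trans (Cardinal.lift_le.2 h5)
    simpa using h6
  refine (Nat.cast_le.2 h1).trans ?_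
  have h2 : ringKrullDim (MvPolynomial (Fin e) k) = e := by
    rw [MvPolynomial.ringKrullDim_of_isNoetherianRing, ringKrullDim_eq_zero_of_field]
    simp
  obtain ⟨l, hl⟩ := Order.le_krullDim_iff.1 h2.ge
  let := g.toRingHom.toAlgebra
  have : Algebra.IsIntegral (MvPolynomial (Fin e) k) C := ⟨hint⟩
  obtain ⟨l', hl'⟩ := exists_ltSeries_of_isIntegral hinj l
  exact Order.le_krullDim_iff.2 ⟨l', hl'.trans hl⟩

end CommutativeAlgebra

section Dimension

variable {k : Type u} [Field k] {F : CommAlgCat.{u} k ⥤ Type w}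

/-- The `k`-point obtained from a `C`-point by a homomorphism `C → k`. -/
def specialize {C : CommAlgCat.{u} k} (ξ : F.obj C) (φ : C →ₐ[k] k) : Points F :=
  F.map (Y := CommAlgCat.of k k) (CommAlgCat.ofHom φ) ξ

/-- A family of points of `F` over a finitely generated algebra `C` that embeds `Spec C` into `F`
bounds the dimension of `F` from below. -/
theorem ringKrullDim_le_topologicalKrullDim [IsAlgClosed k] (C : CommAlgCat.{u} k)
    [Algebra.FiniteType k C]
    (ξ : F.obj C) (hS : ∀ h : C, ∃ S : Subfunctor F, IsOpenSub S ∧ ∀ φ : C →ₐ[k] k,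
      specialize ξ φ ∈ pointsOf S ↔ φ h ≠ 0) :
    ringKrullDim C ≤ topologicalKrullDim (Points F) := by
  let Φ : (C →ₐ[k] k) → Points F := specialize ξ
  let Z : PrimeSpectrum C → Set (Points F) := fun q => Φ '' {φ | ∀ x ∈ q.asIdeal, φ x = 0}
  have hΦ : ∀ S : Subfunctor F, IsOpenSub S → ∃ I : Ideal C, ∀ φ, Φ φ ∈ pointsOf S ↔
      ∃ a ∈ I, φ a ≠ 0 := by
    intro S hS
    obtain ⟨I, hI⟩ := hS C ξ
    refine ⟨I, fun φ => (hI (CommAlgCat.of k k) (CommAlgCat.ofHom φ)).trans ?_⟩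
    constructor
    · intro h
      by_contra! h2
      refine bot_ne_top (α := Ideal k) ((le_bot_iff.1 ?_).symm.trans h)
      exact Ideal.map_le_iff_le_comap.2 fun a ha => h2 a ha
    · rintro ⟨a, ha, hne⟩
      exact Ideal.eq_top_of_isUnit_mem _ (Ideal.mem_map_of_mem _ ha) (isUnit_iff_ne_zero.2 hne)
  have hirr : ∀ q, IsIrreducible (Z q) := by
    intro q
    refine ⟨?_, ?_⟩
    · obtain ⟨φ, hφ, -⟩ := exists_algHom_ne_zero (k := k) q.asIdeal
        ((Ideal.ne_top_iff_one _).1 q.2.ne_top)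
      exact ⟨_, φ, hφ, rfl⟩
    · intro O O' hO hO' ⟨z, hz, hzO⟩ ⟨z', hz', hzO'⟩
      obtain ⟨_, ⟨S, hS, rfl⟩, hzS, hSO⟩ :=
        (isTopologicalBasis_points F).exists_subset_of_mem_open hzO hO
      obtain ⟨_, ⟨S', hS', rfl⟩, hzS', hSO'⟩ :=
        (isTopologicalBasis_points F).exists_subset_of_mem_open hzO' hO'
      obtain ⟨φ, hφ, rfl⟩ := hz
      obtain ⟨φ', hφ', rfl⟩ := hz'
      obtain ⟨I, hI⟩ := hΦ S hS
      obtain ⟨I', hI'⟩ := hΦ S' hS'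
      obtain ⟨a, ha, hφa⟩ := (hI φ).1 hzS
      obtain ⟨a', ha', hφa'⟩ := (hI' φ').1 hzS'
      have haq : a * a' ∉ q.asIdeal := fun h =>
        (q.2.mem_or_mem h).elim (fun h => hφa (hφ a h)) fun h => hφa' (hφ' a' h)
      obtain ⟨ψ, hψ, hψa⟩ := exists_algHom_ne_zero (k := k) q.asIdeal haq
      rw [map_mul] at hψa
      exact ⟨Φ ψ, ⟨ψ, hψ, rfl⟩, hSO ((hI ψ).2 ⟨a, ha, left_ne_zero_of_mul hψa⟩),
        hSO' ((hI' ψ).2 ⟨a', ha', right_ne_zero_of_mul hψa⟩)⟩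
  let T : (PrimeSpectrum C)ᵒᵈ → TopologicalSpace.IrreducibleCloseds (Points F) := fun q =>
    ⟨closure (Z (OrderDual.ofDual q)), (hirr _).closure, isClosed_closure⟩
  have hT : StrictMono T := by
    intro q' q hlt'
    have hlt : OrderDual.ofDual q < OrderDual.ofDual q' := hlt'
    have hle : (OrderDual.ofDual q).asIdeal ≤ (OrderDual.ofDual q').asIdeal := hlt.le
    obtain ⟨h, hh, hhq⟩ := SetLike.not_le_iff_exists.1 (show ¬ (OrderDual.ofDual q').asIdeal ≤
      (OrderDual.ofDual q).asIdeal from hlt.not_ge)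
    obtain ⟨φ, hφ, hφh⟩ := exists_algHom_ne_zero (k := k) (OrderDual.ofDual q).asIdeal hhq
    obtain ⟨S, hSo, hS⟩ := hS h
    refine lt_of_le_of_ne (closure_mono (Set.image_mono fun φ hφ x hx => hφ x (hle hx)))
      fun heq => ?_
    have h1 : Φ φ ∈ closure (Z (OrderDual.ofDual q')) := by
      have : closure (Z (OrderDual.ofDual q')) = closure (Z (OrderDual.ofDual q)) :=
        congrArg TopologicalSpace.IrreducibleCloseds.carrier heq
      rw [this]
      exact subset_closure ⟨φ, hφ, rfl⟩
    obtain ⟨z, hzS, ψ, hψ, rfl⟩ := mem_closure_iff.1 h1 _ hSo.isOpen ((hS φ).2 hφh)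
    exact (hS ψ).1 hzS (hψ h hh)
  rw [ringKrullDim, ← Order.krullDim_orderDual]
  exact Order.krullDim_le_of_strictMono T hT

/-- The points of `F` whose specializations to fields satisfy a condition. -/
def fieldwise (P : ∀ (K : Type u) [Field K] [Algebra k K], F.obj (CommAlgCat.of k K) → Prop) :
    Subfunctor F where
  obj A := {x | ∀ (K : Type u) [Field K] [Algebra k K] (f : A ⟶ CommAlgCat.of k K),
    P K (F.map f x)}
  map {A B} g x hx K _ _ f := by
    rw [← Functor.map_comp_apply]
    exact hx K (g ≫ f)

variable {P : ∀ (K : Type u) [Field K] [Algebra k K], F.obj (CommAlgCat.of k K) → Prop}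

theorem isOpenSub_fieldwise
    (hP : ∀ (A : CommAlgCat.{u} k) (x : F.obj A) (K : Type u) [Field K] [Algebra k K]
      (f : A →ₐ[k] K), P K (F.map (Y := CommAlgCat.of k K) (CommAlgCat.ofHom f) x) →
      ∃ a : A, f a ≠ 0 ∧ ∀ (K' : Type u) [Field K'] [Algebra k K'] (g : A →ₐ[k] K'), g a ≠ 0 →
        P K' (F.map (Y := CommAlgCat.of k K') (CommAlgCat.ofHom g) x)) :
    IsOpenSub (fieldwise P) := by
  intro A x
  refine ⟨Ideal.span {a | ∀ (K' : Type u) [Field K'] [Algebra k K'] (g : A →ₐ[k] K'), g a ≠ 0 →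
    P K' (F.map (Y := CommAlgCat.of k K') (CommAlgCat.ofHom g) x)}, fun B f => ⟨fun h => ?_,
    fun h K _ _ g => ?_⟩⟩
  · by_contra hne
    obtain ⟨q, hq, hle⟩ := Ideal.exists_le_maximal _ hne
    let := Ideal.Quotient.field q
    have h1 := h (B ⧸ q) (CommAlgCat.ofHom (Ideal.Quotient.mkₐ k q))
    rw [← Functor.map_comp_apply] at h1
    obtain ⟨a, ha, haP⟩ := hP A x (B ⧸ q) ((Ideal.Quotient.mkₐ k q).comp f.hom) h1
    exact ha (Ideal.Quotient.eq_zero_iff_mem.2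
      (hle (Ideal.mem_map_of_mem _ (Ideal.subset_span haP))))
  · rw [← Functor.map_comp_apply]
    by_contra h2
    have h3 : (Ideal.span {a : A | ∀ (K' : Type u) [Field K'] [Algebra k K'] (g : A →ₐ[k] K'),
        g a ≠ 0 → P K' (F.map (Y := CommAlgCat.of k K') (CommAlgCat.ofHom g) x)}).map f.hom ≤
        RingHom.ker g.hom := by
      rw [Ideal.map_le_iff_le_comap, Ideal.span_le]
      intro a ha
      by_contra h4
      exact h2 (ha K (g.hom.comp f.hom) h4)
    rw [h] at h3
    exact RingHom.ker_ne_top g.hom (top_le_iff.1 h3)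

/-- For an open condition on field-valued points, membership may be checked over the base field. -/
theorem mem_pointsOf_fieldwise
    (hP : ∀ (A : CommAlgCat.{u} k) (x : F.obj A) (K : Type u) [Field K] [Algebra k K]
      (f : A →ₐ[k] K), P K (F.map (Y := CommAlgCat.of k K) (CommAlgCat.ofHom f) x) →
      ∃ a : A, f a ≠ 0 ∧ ∀ (K' : Type u) [Field K'] [Algebra k K'] (g : A →ₐ[k] K'), g a ≠ 0 →
        P K' (F.map (Y := CommAlgCat.of k K') (CommAlgCat.ofHom g) x)) (x : Points F) :
    x ∈ pointsOf (fieldwise P) ↔ P k x := by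
  have hid : F.map (Y := CommAlgCat.of k k) (CommAlgCat.ofHom (AlgHom.id k k)) x = x :=
    Functor.map_id_apply F (CommAlgCat.of k k) x
  constructor
  · intro h
    have := h k (CommAlgCat.ofHom (AlgHom.id k k))
    rwa [hid] at this
  · intro h K _ _ g
    obtain ⟨a, ha, haP⟩ := hP (CommAlgCat.of k k) x k (AlgHom.id k k) (by rwa [hid])
    exact haP K g.hom ((map_ne_zero g.hom).2 ha)

end Dimension

section Chart

variable {k : Type u} [Field k] {U : Type v} [AddCommGroup U] [Module k U]
  {A B : Type u} [CommRing A] [Algebra k A] [CommRing B] [Algebra k B] {r s : ℕ}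

/-- The endomorphism of `A ⊗ U` with block matrix `x`. -/
noncomputable def blockMap (b : Module.Basis (Fin r ⊕ Fin s) k U) (x : Fin r × Fin s → A) :
    A ⊗[k] U →ₗ[A] A ⊗[k] U :=
  (b.baseChange A).constr A (Sum.elim 0 fun j => ∑ i, x (i, j) • (1 ⊗ₜ[k] b (Sum.inl i)))

theorem blockMap_inl (b : Module.Basis (Fin r ⊕ Fin s) k U) (x : Fin r × Fin s → A) (i : Fin r) :
    blockMap b x (1 ⊗ₜ b (Sum.inl i)) = 0 := by
  rw [← Module.Basis.baseChange_apply, blockMap, Module.Basis.constr_basis]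
  rfl

theorem blockMap_inr (b : Module.Basis (Fin r ⊕ Fin s) k U) (x : Fin r × Fin s → A) (j : Fin s) :
    blockMap b x (1 ⊗ₜ b (Sum.inr j)) = ∑ i, x (i, j) • (1 ⊗ₜ[k] b (Sum.inl i)) := by
  rw [← Module.Basis.baseChange_apply, blockMap, Module.Basis.constr_basis]
  rfl

theorem blockMap_comp_self (b : Module.Basis (Fin r ⊕ Fin s) k U) (x : Fin r × Fin s → A) :
    blockMap b x ∘ₗ blockMap b x = 0 := by
  refine (b.baseChange A).ext fun t => ?_
  rw [Module.Basis.baseChange_apply, LinearMap.comp_apply]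
  obtain i | j := t
  · simp [blockMap_inl]
  · simp [blockMap_inr, blockMap_inl]

/-- The basis of `A ⊗ U` obtained from a basis of `U` by a unipotent matrix. -/
noncomputable def chartBasis (b : Module.Basis (Fin r ⊕ Fin s) k U) (x : Fin r × Fin s → A) :
    Module.Basis (Fin r ⊕ Fin s) A (A ⊗[k] U) :=
  (b.baseChange A).map (LinearEquiv.ofLinearMap (LinearMap.id + blockMap b x)
    (LinearMap.id - blockMap b x)
    (by
      have := blockMap_comp_self b x
      simp only [LinearMap.add_comp, LinearMap.comp_sub, LinearMap.id_comp, LinearMap.comp_id, this]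
      abel)
    (by
      have := blockMap_comp_self b x
      simp only [LinearMap.sub_comp, LinearMap.comp_add, LinearMap.id_comp, LinearMap.comp_id, this]
      abel))

theorem chartBasis_inl (b : Module.Basis (Fin r ⊕ Fin s) k U) (x : Fin r × Fin s → A) (i : Fin r) :
    chartBasis b x (Sum.inl i) = 1 ⊗ₜ b (Sum.inl i) := by
  simp [chartBasis, blockMap_inl]

theorem chartBasis_inr (b : Module.Basis (Fin r ⊕ Fin s) k U) (x : Fin r × Fin s → A) (j : Fin s) :
    chartBasis b x (Sum.inr j) =
      1 ⊗ₜ b (Sum.inr j) + ∑ i, x (i, j) • (1 ⊗ₜ[k] b (Sum.inl i)) := by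
  simp [chartBasis, blockMap_inr]

/-- The points of a standard chart of the Grassmannian. -/
noncomputable def chartPt (b : Module.Basis (Fin r ⊕ Fin s) k U) (x : Fin r × Fin s → A) :
    Module.Grassmannian A (A ⊗[k] U) r :=
  grassmannianOfBasis (chartBasis b x)

theorem chartPt_toSubmodule (b : Module.Basis (Fin r ⊕ Fin s) k U) (x : Fin r × Fin s → A) :
    (chartPt b x).toSubmodule = Submodule.span A (Set.range (chartBasis b x ∘ Sum.inr)) := rfl

theorem scalarMap_chartBasis_inr (b : Module.Basis (Fin r ⊕ Fin s) k U) (x : Fin r × Fin s → A)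
    (f : A →ₐ[k] B) (j : Fin s) :
    scalarMap f U (chartBasis b x (Sum.inr j)) = chartBasis b (f ∘ x) (Sum.inr j) := by
  simp [chartBasis_inr, scalarMap_smul]

theorem map_chartPt (b : Module.Basis (Fin r ⊕ Fin s) k U) (x : Fin r × Fin s → A)
    (f : A →ₐ[k] B) : Module.Grassmannian.map f (chartPt b x) = chartPt b (f ∘ x) := by
  refine Module.Grassmannian.ext ?_
  rw [← spanMap_eq_map, chartPt_toSubmodule, chartPt_toSubmodule, spanMap_span, ← Set.range_comp]
  congr 2
  ext j
  exact scalarMap_chartBasis_inr b x f j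

theorem chartPt_injective (b : Module.Basis (Fin r ⊕ Fin s) k U) {x y : Fin r × Fin s → A}
    (h : chartPt b x = chartPt b y) : x = y := by
  funext ⟨i, j⟩
  have h1 : chartBasis b x (Sum.inr j) ∈ (chartPt b y).toSubmodule := by
    rw [← h]
    exact Submodule.subset_span ⟨j, rfl⟩
  have h2 : chartBasis b y (Sum.inr j) ∈ (chartPt b y).toSubmodule :=
    Submodule.subset_span ⟨j, rfl⟩
  have h3 := (mem_span_range_inr_iff _ _).1 (sub_mem h1 h2) i
  rw [chartBasis_inr, chartBasis_inr, add_sub_add_left_eq_sub] at h3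
  simp only [← chartBasis_inl b y] at h3
  rw [map_sub, map_sum, map_sum] at h3
  simpa [Finsupp.single_apply, sub_eq_zero] using h3

theorem chartPt_eq_of_mem (b : Module.Basis (Fin r ⊕ Fin s) k U) {x : Fin r × Fin s → A}
    {N : Module.Grassmannian A (A ⊗[k] U) r}
    (h : ∀ j, 1 ⊗ₜ b (Sum.inr j) + ∑ i, x (i, j) • (1 ⊗ₜ[k] b (Sum.inl i)) ∈ N.toSubmodule) :
    chartPt b x = N := by
  refine grassmannian_le_antisymm (Submodule.span_le.2 ?_)
  rintro _ ⟨j, rfl⟩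
  rw [Function.comp_apply, chartBasis_inr]
  exact h j

/-- Every point of the Grassmannian over a field is the origin of a chart. -/
theorem exists_chartPt_zero [FiniteDimensional k U] (hs : Module.finrank k U - r = s)
    (N : Module.Grassmannian k (k ⊗[k] U) r) :
    ∃ b : Module.Basis (Fin r ⊕ Fin s) k U, chartPt b (0 : Fin r × Fin s → k) = N := by
  obtain ⟨b, hb⟩ := exists_adapted_basis_tensor hs N
  refine ⟨b.map (TensorProduct.lid k U), chartPt_eq_of_mem _ fun j => ?_⟩
  have : (1 : k) ⊗ₜ[k] (TensorProduct.lid k U) (b (Sum.inr j)) = b (Sum.inr j) :=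
    (TensorProduct.lid k U).symm_apply_apply _
  simp only [Module.Basis.map_apply, this, Pi.zero_apply, zero_smul, Finset.sum_const_zero,
    add_zero, hb]
  exact Submodule.subset_span ⟨j, rfl⟩

end Chart

section Hyperplane

variable {k : Type u} [Field k] {W : Type v} [AddCommGroup W] [Module k W]
  {A B : Type u} [CommRing A] [Algebra k A] [CommRing B] [Algebra k B] {ι : Type*}

/-- The linear form on `A ⊗ W` with coefficients `y`. -/
noncomputable def coeffForm (ε : Module.Basis ι k W) (y : ι → A) : Module.Dual A (A ⊗[k] W) :=
  (ε.baseChange A).constr A y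

@[simp] theorem coeffForm_apply (ε : Module.Basis ι k W) (y : ι → A) (l : ι) :
    coeffForm ε y (1 ⊗ₜ ε l) = y l := by
  rw [← Module.Basis.baseChange_apply, coeffForm, Module.Basis.constr_basis]

theorem coeffForm_scalarMap (ε : Module.Basis ι k W) (y : ι → A) (f : A →ₐ[k] B)
    (x : A ⊗[k] W) : coeffForm ε (f ∘ y) (scalarMap f W x) = f (coeffForm ε y x) := by
  have : formMap f (coeffForm ε y) = coeffForm ε (f ∘ y) := by
    refine (ε.baseChange B).ext fun l => ?_
    have := formMap_scalarMap f (coeffForm ε y) (1 ⊗ₜ ε l)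
    rw [scalarMap_tmul, map_one] at this
    simp [this]
  rw [← this, formMap_scalarMap]

/-- The point of projective space with homogeneous coordinates `y`. -/
noncomputable def hyperplane (ε : Module.Basis ι k W) (y : ι → A) (l₀ : ι) (hy : y l₀ = 1) :
    Module.Grassmannian A (A ⊗[k] W) 1 :=
  have hsurj : Function.Surjective (coeffForm ε y) := fun a =>
    ⟨a • (1 ⊗ₜ ε l₀), by rw [map_smul, coeffForm_apply, hy, smul_eq_mul, mul_one]⟩
  let e := (coeffForm ε y).quotKerEquivOfSurjective hsurj
  { toSubmodule := LinearMap.ker (coeffForm ε y)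
    finite_quotient := Module.Finite.equiv e.symm
    projective_quotient := Module.Projective.of_equiv e.symm
    rankAtStalk_eq := fun p => by
      have := p.nontrivial
      rw [Module.rankAtStalk_eq_of_equiv e, Module.rankAtStalk_self]
      rfl }

theorem hyperplane_toSubmodule (ε : Module.Basis ι k W) (y : ι → A) (l₀ : ι) (hy : y l₀ = 1) :
    (hyperplane ε y l₀ hy).toSubmodule = LinearMap.ker (coeffForm ε y) := rfl

theorem sub_mem_hyperplane (ε : Module.Basis ι k W) (y : ι → A) (l₀ : ι) (hy : y l₀ = 1) (l : ι) :
    1 ⊗ₜ ε l - y l • (1 ⊗ₜ[k] ε l₀) ∈ (hyperplane ε y l₀ hy).toSubmodule := by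
  rw [hyperplane_toSubmodule, LinearMap.mem_ker, map_sub, map_smul, coeffForm_apply,
    coeffForm_apply, hy, smul_eq_mul, mul_one, sub_self]

theorem map_hyperplane (ε : Module.Basis ι k W) (y : ι → A) (l₀ : ι) (hy : y l₀ = 1)
    (f : A →ₐ[k] B) : Module.Grassmannian.map f (hyperplane ε y l₀ hy) =
      hyperplane ε (f ∘ y) l₀ (by simp [hy]) := by
  refine grassmannian_le_antisymm ?_
  rw [← spanMap_eq_map, spanMap, Submodule.span_le]
  rintro _ ⟨x, hx, rfl⟩
  rw [SetLike.mem_coe, hyperplane_toSubmodule, LinearMap.mem_ker, coeffForm_scalarMap,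
    LinearMap.mem_ker.1 hx, map_zero]

end Hyperplane

section Submodule

variable {R M : Type*} [CommRing R] [AddCommGroup M] [Module R M] {N : Submodule R M}

theorem exists_add_sum_mem_of_mem_sup {I : Type*} [Fintype I] {v : I → M} {x : M}
    (h : x ∈ N ⊔ Submodule.span R (Set.range v)) : ∃ c : I → R, x + ∑ i, c i • v i ∈ N := by
  obtain ⟨n, hn, m, hm, rfl⟩ := Submodule.mem_sup.1 h
  obtain ⟨c, rfl⟩ := (Submodule.mem_span_range_iff_exists_fun R).1 hm
  exact ⟨-c, by simpa using hn⟩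

theorem exists_sub_smul_mem_of_mem_sup {v x : M} (h : x ∈ N ⊔ Submodule.span R {v}) :
    ∃ c : R, x - c • v ∈ N := by
  obtain ⟨n, hn, m, hm, rfl⟩ := Submodule.mem_sup.1 h
  obtain ⟨c, rfl⟩ := Submodule.mem_span_singleton.1 hm
  exact ⟨c, by simpa using hn⟩

theorem eq_of_sub_smul_mem {K E : Type*} [Field K] [AddCommGroup E] [Module K E]
    {H : Submodule K E} {x v : E} (hv : v ∉ H) {c d : K} (hc : x - c • v ∈ H)
    (hd : x - d • v ∈ H) : c = d := by
  have h := sub_mem hd hc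
  rw [sub_sub_sub_cancel_left, ← sub_smul] at h
  by_contra hne
  have h' := H.smul_mem (c - d)⁻¹ h
  rw [smul_smul, inv_mul_cancel₀ (sub_ne_zero.2 hne), one_smul] at h'
  exact hv h'

end Submodule

section CoordinateOpen

variable {k : Type u} [Field k]

/-- A polynomial in fractions with denominator `z` is a fraction with denominator a power of `z`. -/
theorem exists_aeval_div {A : Type u} [CommRing A] [Algebra k A] {τ : Type*} (u : τ → A) (z : A)
    (p : MvPolynomial τ k) : ∃ (e : A) (n : ℕ), ∀ (K : Type u) [Field K] [Algebra k K]
      (g : A →ₐ[k] K), g z ≠ 0 →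
        MvPolynomial.aeval (fun t => g (u t) / g z) p * g z ^ n = g e := by
  induction p using MvPolynomial.induction_on with
  | C c => exact ⟨algebraMap k A c, 0, fun K _ _ g _ => by simp⟩
  | add p q hp hq =>
    obtain ⟨e, n, he⟩ := hp
    obtain ⟨e', n', he'⟩ := hq
    refine ⟨e * z ^ n' + e' * z ^ n, n + n', fun K _ _ g hg => ?_⟩
    rw [map_add, map_add, map_mul, map_mul, ← he K g hg, ← he' K g hg, map_pow, map_pow]
    ring
  | mul_X p t hp =>
    obtain ⟨e, n, he⟩ := hp
    refine ⟨e * u t, n + 1, fun K _ _ g hg => ?_⟩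
    rw [map_mul, map_mul, ← he K g hg, MvPolynomial.aeval_X]
    field_simp
    ring

variable {U W : Type v} [AddCommGroup U] [Module k U] [AddCommGroup W] [Module k W] {r s : ℕ}
  {ι : Type}

/-- The points of a product of charts of the Grassmannian and of projective space where a polynomial
in the coordinates does not vanish. -/
def CoordinateNonvanishing (b : Module.Basis (Fin r ⊕ Fin s) k U) (ε : Module.Basis ι k W) (l₀ : ι)
    (p : MvPolynomial ((Fin r × Fin s) ⊕ ι) k) (K : Type u) [Field K] [Algebra k K]
    (z : (FunctorToTypes.prod (Gr k U r) (ProjSpace k W)).obj (CommAlgCat.of k K)) : Prop :=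
  ∃ (x : Fin r × Fin s → K) (y : ι → K), chartPt b x = pt z.1 ∧
    (∀ l, 1 ⊗ₜ ε l - y l • (1 ⊗ₜ[k] ε l₀) ∈ (pt z.2).toSubmodule) ∧
      MvPolynomial.aeval (Sum.elim x y) p ≠ 0

theorem one_tmul_notMem_of_sub_mem {K : Type u} [Field K] [Algebra k K] {ε : Module.Basis ι k W}
    {l₀ : ι} {y : ι → K} {H : Module.Grassmannian K (K ⊗[k] W) 1}
    (h : ∀ l, 1 ⊗ₜ ε l - y l • (1 ⊗ₜ[k] ε l₀) ∈ H.toSubmodule) : 1 ⊗ₜ ε l₀ ∉ H.toSubmodule := by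
  intro h0
  refine one_ne_zero (α := K) (grassmannian_faithful H one_pos 1 fun x => ?_)
  have : H.toSubmodule = ⊤ := by
    rw [eq_top_iff, ← (ε.baseChange K).span_eq, Submodule.span_le]
    rintro _ ⟨l, rfl⟩
    rw [Module.Basis.baseChange_apply]
    have := add_mem (h l) (Submodule.smul_mem _ (y l) h0)
    rwa [sub_add_cancel] at this
  rw [this]
  trivial

variable [Fintype ι] [DecidableEq ι]

theorem coordinateNonvanishing_open (b : Module.Basis (Fin r ⊕ Fin s) k U)
    (ε : Module.Basis ι k W) (l₀ : ι) (p : MvPolynomial ((Fin r × Fin s) ⊕ ι) k)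
    (A : CommAlgCat.{u} k) (z : (FunctorToTypes.prod (Gr k U r) (ProjSpace k W)).obj A)
    (K : Type u) [Field K] [Algebra k K] (f : A →ₐ[k] K)
    (hz : CoordinateNonvanishing b ε l₀ p K ((FunctorToTypes.prod (Gr k U r) (ProjSpace k W)).map
      (Y := CommAlgCat.of k K) (CommAlgCat.ofHom f) z)) :
    ∃ a : A, f a ≠ 0 ∧ ∀ (K' : Type u) [Field K'] [Algebra k K'] (g : A →ₐ[k] K'), g a ≠ 0 →
      CoordinateNonvanishing b ε l₀ p K' ((FunctorToTypes.prod (Gr k U r) (ProjSpace k W)).map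
        (Y := CommAlgCat.of k K') (CommAlgCat.ofHom g) z) := by
  obtain ⟨x, y, hx, hy, hp⟩ := hz
  let N := pt z.1
  let H := pt z.2
  replace hx : chartPt b x = Module.Grassmannian.map f N := hx
  replace hy : ∀ l, 1 ⊗ₜ ε l - y l • (1 ⊗ₜ[k] ε l₀) ∈
    (Module.Grassmannian.map f H).toSubmodule := hy
  have h1 : spanMap f (N.toSubmodule ⊔
      Submodule.span A (Set.range fun i => 1 ⊗ₜ[k] b (Sum.inl i))) = ⊤ := by
    rw [spanMap_sup, spanMap_eq_map, spanMap_span, ← hx, eq_top_iff, ← (chartBasis b x).span_eq,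
      Submodule.span_le]
    rintro _ ⟨i | j, rfl⟩
    · refine Submodule.mem_sup_right (Submodule.subset_span ⟨_, ⟨i, rfl⟩, ?_⟩)
      rw [scalarMap_tmul, map_one, chartBasis_inl]
    · exact Submodule.mem_sup_left (Submodule.subset_span ⟨j, rfl⟩)
  have h2 : spanMap f (H.toSubmodule ⊔ Submodule.span A {1 ⊗ₜ[k] ε l₀}) = ⊤ := by
    rw [spanMap_sup_span, spanMap_eq_map, eq_top_iff, ← (ε.baseChange K).span_eq,
      Submodule.span_le]
    rintro _ ⟨l, rfl⟩
    rw [Module.Basis.baseChange_apply, ← sub_add_cancel (1 ⊗ₜ ε l) (y l • (1 ⊗ₜ[k] ε l₀))]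
    exact Submodule.add_mem_sup (hy l)
      (Submodule.smul_mem _ _ (Submodule.mem_span_singleton_self _))
  obtain ⟨a, ha, hfa⟩ := exists_mem_colon_of_spanMap_eq_top f b h1
  obtain ⟨d, hd, hfd⟩ := exists_mem_colon_of_spanMap_eq_top f ε h2
  have hX : ∀ j, ∃ c : Fin r → A, (a * d) • (1 ⊗ₜ[k] b (Sum.inr j)) +
      ∑ i, c i • (1 ⊗ₜ[k] b (Sum.inl i)) ∈ N.toSubmodule := by
    intro j
    exact exists_add_sum_mem_of_mem_sup
      (Submodule.mem_colon.1 (Ideal.mul_mem_right d _ ha) (1 ⊗ₜ[k] b (Sum.inr j)) trivial)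
  have hY : ∀ l, ∃ c : A, (a * d) • (1 ⊗ₜ[k] ε l) - c • (1 ⊗ₜ[k] ε l₀) ∈ H.toSubmodule := by
    intro l
    exact exists_sub_smul_mem_of_mem_sup
      (Submodule.mem_colon.1 (Ideal.mul_mem_left _ a hd) (1 ⊗ₜ[k] ε l) trivial)
  choose X hX using hX
  choose Y hY using hY
  obtain ⟨e, n, he⟩ := exists_aeval_div (Sum.elim (fun i => X i.2 i.1) Y) (a * d) p
  have key : ∀ (K' : Type u) [Field K'] [Algebra k K'] (g : A →ₐ[k] K'), g (a * d) ≠ 0 →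
      chartPt b (fun i => g (X i.2 i.1) / g (a * d)) = Module.Grassmannian.map g N ∧
      (∀ l, 1 ⊗ₜ ε l - (g (Y l) / g (a * d)) • (1 ⊗ₜ[k] ε l₀) ∈
        (Module.Grassmannian.map g H).toSubmodule) ∧
      MvPolynomial.aeval (Sum.elim (fun i => g (X i.2 i.1) / g (a * d))
        fun l => g (Y l) / g (a * d)) p * g (a * d) ^ n = g e := by
    intro K' _ _ g hg
    refine ⟨chartPt_eq_of_mem b fun j => ?_, fun l => ?_, ?_⟩
    · have := Submodule.smul_mem _ (g (a * d))⁻¹ (scalarMap_mem_map g N (hX j))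
      simpa only [map_add, scalarMap_smul, map_sum, scalarMap_tmul, map_one, smul_add, smul_smul,
        inv_mul_cancel₀ hg, one_smul, Finset.smul_sum, div_eq_inv_mul] using this
    · have := Submodule.smul_mem _ (g (a * d))⁻¹ (scalarMap_mem_map g H (hY l))
      simpa only [map_sub, scalarMap_smul, scalarMap_tmul, map_one, smul_sub, smul_smul,
        inv_mul_cancel₀ hg, one_smul, div_eq_inv_mul] using this
    · rw [← he K' g hg]
      congr 3
      funext t
      obtain t | t := t <;> rfl
  have hfz : f (a * d) ≠ 0 := by rw [map_mul]; exact mul_ne_zero hfa hfd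
  refine ⟨a * d * e, ?_, fun K' _ _ g hg => ?_⟩
  · obtain ⟨k1, k2, k3⟩ := key K f hfz
    have hxx := chartPt_injective b (k1.trans hx.symm)
    have hyy : (fun l => f (Y l) / f (a * d)) = y :=
      funext fun l => eq_of_sub_smul_mem (one_tmul_notMem_of_sub_mem hy) (k2 l) (hy l)
    rw [hxx, hyy] at k3
    rw [map_mul, ← k3]
    exact mul_ne_zero hfz (mul_ne_zero hp (pow_ne_zero _ hfz))
  · rw [map_mul] at hg
    have hgz := left_ne_zero_of_mul hg
    obtain ⟨k1, k2, k3⟩ := key K' g hgz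
    exact ⟨_, _, k1, k2, fun h0 => right_ne_zero_of_mul hg (by rw [← k3, h0, zero_mul])⟩

end CoordinateOpen

section Pencil

variable {k : Type u} [Field k] {W : Type v} [AddCommGroup W] [Module k W]
  {A B : Type u} [CommRing A] [Algebra k A] [CommRing B] [Algebra k B] {ι : Type}

/-- The coefficients of the pencil spanned by two linear forms. -/
noncomputable def pencil {K : Type u} [Field K] [Algebra k K] (ε : Module.Basis ι k W)
    (ψ₁ ψ₂ : Module.Dual K (K ⊗[k] W)) (l : ι) : Polynomial K :=
  Polynomial.C (ψ₂ (1 ⊗ₜ ε l)) * Polynomial.X + Polynomial.C (ψ₁ (1 ⊗ₜ ε l))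

theorem coeffForm_pencil {K : Type u} [Field K] [Algebra k K] (ε : Module.Basis ι k W)
    (ψ₁ ψ₂ : Module.Dual K (K ⊗[k] W)) (x : K ⊗[k] W) :
    coeffForm ε (pencil ε ψ₁ ψ₂) (scalarMap (Polynomial.CAlgHom (R := k) (A := K)) W x) =
      Polynomial.C (ψ₂ x) * Polynomial.X + Polynomial.C (ψ₁ x) := by
  let i : K →ₐ[k] Polynomial K := Polynomial.CAlgHom
  have : coeffForm ε (pencil ε ψ₁ ψ₂) = (Polynomial.X : Polynomial K) • formMap i ψ₂ +
      formMap i ψ₁ := by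
    refine (ε.baseChange (Polynomial K)).ext fun l => ?_
    have h1 := formMap_scalarMap i ψ₁ (1 ⊗ₜ ε l)
    have h2 := formMap_scalarMap i ψ₂ (1 ⊗ₜ ε l)
    rw [scalarMap_tmul, map_one] at h1 h2
    rw [Module.Basis.baseChange_apply, coeffForm_apply, LinearMap.add_apply, LinearMap.smul_apply,
      h1, h2, smul_eq_mul, mul_comm]
    rfl
  rw [this, LinearMap.add_apply, LinearMap.smul_apply, formMap_scalarMap, formMap_scalarMap,
    smul_eq_mul, mul_comm]
  rfl

theorem le_ker_coeffForm_of_injective {f : A →ₐ[k] B} (hf : Function.Injective f)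
    (ε : Module.Basis ι k W) (y : ι → A) {N : Submodule A (A ⊗[k] W)}
    (h : spanMap f N ≤ LinearMap.ker (coeffForm ε (f ∘ y))) : N ≤ LinearMap.ker
      (coeffForm ε y) := by
  intro w hw
  rw [LinearMap.mem_ker]
  apply hf
  rw [← coeffForm_scalarMap, map_zero]
  exact LinearMap.mem_ker.1 (h (scalarMap_mem_spanMap f hw))

variable [Fintype ι] [DecidableEq ι]

/-- If the quotient by `J` is nowhere cyclic, then its fibre at the generic point admits two
independent linear forms. -/
theorem exists_forms_of_cyclicIdeal_eq_bot [Nonempty ι] (ε : Module.Basis ι k W)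
    {J : Submodule A (A ⊗[k] W)} (hJ : cyclicIdeal ε J = ⊥) {K : Type u} [Field K] [Algebra k K]
    (g : A →ₐ[k] K) :
    ∃ (ψ₁ ψ₂ : Module.Dual K (K ⊗[k] W)) (l₀ l₁ : ι), (∀ x ∈ J, ψ₁ (scalarMap g W x) = 0) ∧
      (∀ x ∈ J, ψ₂ (scalarMap g W x) = 0) ∧ ψ₁ (1 ⊗ₜ ε l₀) = 1 ∧ ψ₂ (1 ⊗ₜ ε l₀) = 0 ∧
        ψ₂ (1 ⊗ₜ ε l₁) ≠ 0 := by
  have h1 : ∀ i, spanMap g J ⊔ Submodule.span K {1 ⊗ₜ ε i} ≠ ⊤ := by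
    intro i h
    rw [← spanMap_sup_span] at h
    obtain ⟨a, ha, hga⟩ := exists_mem_colon_of_spanMap_eq_top g ε h
    have h2 : a ∈ cyclicIdeal ε J := Submodule.mem_iSup_of_mem i ha
    rw [hJ, Ideal.mem_bot] at h2
    exact hga (by rw [h2, map_zero])
  have h2 : ∀ M : Submodule K (K ⊗[k] W), M ≠ ⊤ → ∃ i, 1 ⊗ₜ ε i ∉ M := by
    intro M hM
    by_contra! h
    apply hM
    rw [eq_top_iff, ← (ε.baseChange K).span_eq, Submodule.span_le]
    rintro _ ⟨i, rfl⟩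
    rw [Module.Basis.baseChange_apply]
    exact h i
  obtain ⟨i⟩ := ‹Nonempty ι›
  obtain ⟨l₀, hl₀⟩ := h2 (spanMap g J) fun h => h1 i (by rw [h, top_sup_eq])
  obtain ⟨l₁, hl₁⟩ := h2 _ (h1 l₀)
  obtain ⟨ψ₁, hψ₁, hψ₁J⟩ := Submodule.exists_le_ker_of_notMem hl₀
  obtain ⟨ψ₂, hψ₂, hψ₂J⟩ := Submodule.exists_le_ker_of_notMem hl₁
  refine ⟨(ψ₁ (1 ⊗ₜ ε l₀))⁻¹ • ψ₁, ψ₂, l₀, l₁, fun x hx => ?_, fun x hx => ?_, ?_, ?_, hψ₂⟩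
  · rw [LinearMap.smul_apply, LinearMap.mem_ker.1 (hψ₁J (scalarMap_mem_spanMap g hx)), smul_zero]
  · exact hψ₂J (Submodule.mem_sup_left (scalarMap_mem_spanMap g hx))
  · rw [LinearMap.smul_apply, smul_eq_mul, inv_mul_cancel₀ hψ₁]
  · exact hψ₂J (Submodule.mem_sup_right (Submodule.mem_span_singleton_self _))

end Pencil

section DimensionBound

variable {k : Type u} [Field k] {U W : Type v} [AddCommGroup U] [Module k U]
  [AddCommGroup W] [Module k W] {r s : ℕ} {ι : Type}

theorem SheafRelations.spanMap_rel_chartPt (J : SheafRelations (Gr k U r) W)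
    (b : Module.Basis (Fin r ⊕ Fin s) k U) {A B : Type u} [CommRing A] [Algebra k A] [CommRing B]
    [Algebra k B] (f : A →ₐ[k] B) (x : Fin r × Fin s → A) :
    spanMap f (J.rel (CommAlgCat.of k A) (chartPt b x)) =
      J.rel (CommAlgCat.of k B) (chartPt b (f ∘ x)) := by
  rw [← map_chartPt]
  exact (J.rel_map (CommAlgCat.ofHom f) _).symm

variable [IsAlgClosed k] [Fintype ι] [DecidableEq ι]

/-- A family of points in charts of the Grassmannian and of projective space, parametrized by the
algebra of its coordinates, bounds the dimension from below. -/
theorem ringKrullDim_le_of_coordinates (b : Module.Basis (Fin r ⊕ Fin s) k U)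
    (ε : Module.Basis ι k W) {X : Subfunctor (FunctorToTypes.prod (Gr k U r) (ProjSpace k W))}
    {C : Type u} [CommRing C] [Algebra k C] (x : Fin r × Fin s → C) (y : ι → C) (l₀ : ι)
    (hy : y l₀ = 1) (hsurj : Function.Surjective (MvPolynomial.aeval (R := k) (Sum.elim x y)))
    (hX : (chartPt b x, hyperplane ε y l₀ hy) ∈ X.obj (CommAlgCat.of k C)) :
    ringKrullDim C ≤ topologicalKrullDim (Points X.toFunctor) := by
  have : Algebra.FiniteType k C := Algebra.FiniteType.of_surjective _ hsurj
  refine ringKrullDim_le_topologicalKrullDim (F := X.toFunctor) (CommAlgCat.of k C) ⟨_, hX⟩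
    fun h => ?_
  obtain ⟨p, rfl⟩ := hsurj h
  have hopen := coordinateNonvanishing_open b ε l₀ p
  refine ⟨(fieldwise (CoordinateNonvanishing b ε l₀ p)).preimage X.ι,
    (isOpenSub_fieldwise hopen).preimage _, fun φ => ?_⟩
  have hx' : pt (A := CommAlgCat.of k k) (X.ι.app _ (specialize (F := X.toFunctor)
      (C := CommAlgCat.of k C) ⟨_, hX⟩ φ)).1 = chartPt b (φ ∘ x) := map_chartPt b x φ
  have hy' : pt (A := CommAlgCat.of k k) (X.ι.app _ (specialize (F := X.toFunctor)
      (C := CommAlgCat.of k C) ⟨_, hX⟩ φ)).2 = hyperplane ε (φ ∘ y) l₀ (by simp [hy]) :=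
    map_hyperplane ε y l₀ hy φ
  have hp : MvPolynomial.aeval (Sum.elim (φ ∘ x) (φ ∘ y)) p =
      φ (MvPolynomial.aeval (Sum.elim x y) p) := by
    rw [← Sum.comp_elim]
    exact (MvPolynomial.comp_aeval_apply _ φ p).symm
  refine (mem_pointsOf_fieldwise hopen (X.ι.app _ (specialize (F := X.toFunctor)
      (C := CommAlgCat.of k C) ⟨_, hX⟩ φ))).trans ⟨?_, fun h => ?_⟩
  · rintro ⟨x', y', h1, h2, h3⟩
    rw [hx'] at h1
    rw [hy'] at h2
    have hyy : y' = φ ∘ y := funext fun l =>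
      eq_of_sub_smul_mem (one_tmul_notMem_of_sub_mem h2) (h2 l) (sub_mem_hyperplane ε _ l₀ _ l)
    rwa [chartPt_injective b h1, hyy, hp] at h3
  · refine ⟨φ ∘ x, φ ∘ y, hx'.symm, fun l => ?_, by rwa [hp]⟩
    rw [hy']
    exact sub_mem_hyperplane ε _ l₀ _ l

/-- A family of points of the projectivization of a coherent sheaf on the Grassmannian bounds its
dimension by the number of algebraically independent coordinates. -/
theorem SheafRelations.card_le_topologicalKrullDim (b : Module.Basis (Fin r ⊕ Fin s) k U)
    (ε : Module.Basis ι k W) (J : SheafRelations (Gr k U r) W) {P : Type u} [CommRing P]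
    [IsDomain P] [Algebra k P] (x : Fin r × Fin s → P) (y : ι → P) (l₀ : ι) (hy : y l₀ = 1)
    (hJ : J.rel (CommAlgCat.of k P) (chartPt b x) ≤ LinearMap.ker (coeffForm ε y))
    {I : Type} [Fintype I] (t : I → (Fin r × Fin s) ⊕ ι)
    (ht : AlgebraicIndependent k (Sum.elim x y ∘ t)) :
    (Fintype.card I : WithBot ℕ∞) ≤ topologicalKrullDim (Points J.proj.toFunctor) := by
  let C := (MvPolynomial.aeval (R := k) (Sum.elim x y)).range
  let z : (Fin r × Fin s) ⊕ ι → C := fun j =>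
    ⟨Sum.elim x y j, MvPolynomial.X j, MvPolynomial.aeval_X _ _⟩
  have hz : Sum.elim (z ∘ Sum.inl) (z ∘ Sum.inr) = z := Sum.elim_comp_inl_inr z
  have hsurj : Function.Surjective
      (MvPolynomial.aeval (R := k) (Sum.elim (z ∘ Sum.inl) (z ∘ Sum.inr))) := by
    rintro ⟨_, p, rfl⟩
    refine ⟨p, Subtype.ext ?_⟩
    rw [hz]
    exact MvPolynomial.comp_aeval_apply _ C.val p
  have : Algebra.FiniteType k C := Algebra.FiniteType.of_surjective _ hsurj
  have hX : J.rel (CommAlgCat.of k C) (chartPt b (z ∘ Sum.inl)) ≤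
      LinearMap.ker (coeffForm ε (z ∘ Sum.inr)) := by
    refine le_ker_coeffForm_of_injective (f := C.val) Subtype.val_injective ε _ ?_
    rw [J.spanMap_rel_chartPt]
    exact hJ
  refine (le_ringKrullDim_of_algebraicIndependent (k := k) (x := z ∘ t) ?_).trans
    (ringKrullDim_le_of_coordinates b ε _ _ l₀ (Subtype.ext hy) hsurj hX)
  exact AlgebraicIndependent.of_comp C.val ht

/-- If a coherent sheaf on the Grassmannian is nowhere cyclic along a subvariety of a chart, then
the dimension of its projectivization exceeds the dimension of the subvariety. -/
theorem SheafRelations.card_lt_topologicalKrullDim [Nonempty ι]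
    (b : Module.Basis (Fin r ⊕ Fin s) k U) (ε : Module.Basis ι k W)
    (J : SheafRelations (Gr k U r) W) {A : Type u} [CommRing A] [IsDomain A] [Algebra k A]
    (x : Fin r × Fin s → A) (hJ : cyclicIdeal ε (J.rel (CommAlgCat.of k A) (chartPt b x)) = ⊥)
    {I : Type} [Fintype I] (t : I → Fin r × Fin s) (ht : AlgebraicIndependent k (x ∘ t)) :
    ((Fintype.card I + 1 : ℕ) : WithBot ℕ∞) ≤ topologicalKrullDim (Points J.proj.toFunctor) := by
  let K := FractionRing A
  let g : A →ₐ[k] K := IsScalarTower.toAlgHom k A K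
  have hg : Function.Injective g := IsFractionRing.injective A K
  obtain ⟨ψ₁, ψ₂, l₀, l₁, h1, h2, h10, h20, h21⟩ := exists_forms_of_cyclicIdeal_eq_bot ε hJ g
  let i : K →ₐ[k] Polynomial K := Polynomial.CAlgHom
  have hX : J.rel (CommAlgCat.of k (Polynomial K)) (chartPt b (i.comp g ∘ x)) ≤
      LinearMap.ker (coeffForm ε (pencil ε ψ₁ ψ₂)) := by
    rw [← J.spanMap_rel_chartPt]
    refine Submodule.span_le.2 ?_
    rintro _ ⟨v, hv, rfl⟩
    rw [SetLike.mem_coe, LinearMap.mem_ker, scalarMap_comp, coeffForm_pencil, h1 v hv, h2 v hv,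
      map_zero, zero_mul, add_zero]
  have hK : AlgebraicIndependent k (g ∘ x ∘ t) := ht.map' hg
  have hl : AlgebraicIndependent K fun _ : Unit => pencil ε ψ₁ ψ₂ l₁ := by
    rw [algebraicIndependent_unique_type_iff]
    have hd : (pencil ε ψ₁ ψ₂ l₁).natDegree = 1 := Polynomial.natDegree_linear h21
    have := (Polynomial.transcendental_X (R := K)).aeval (pencil ε ψ₁ ψ₂ l₁)
      (by rw [hd]; exact one_ne_zero)
      (mem_nonZeroDivisors_of_ne_zero (Polynomial.leadingCoeff_ne_zero.2 fun h0 => by simp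
        [h0] at hd))
    rwa [Polynomial.aeval_X_left_apply] at this
  have hind : AlgebraicIndependent k (Sum.elim (i.comp g ∘ x) (pencil ε ψ₁ ψ₂) ∘
      Sum.elim (fun _ : Unit => Sum.inr l₁) (Sum.inl ∘ t)) := by
    convert hK.sumElim_comp hl using 1
    ext1 j
    obtain j | j := j <;> rfl
  have := J.card_le_topologicalKrullDim b ε _ _ l₀ (by simp [pencil, h10, h20]) hX _ hind
  rwa [Fintype.card_sum, Fintype.card_unit, add_comm] at this

end DimensionBound

section Hypersurface

variable {k : Type u} [Field k] {σ : Type}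

theorem exists_irreducible_dvd_of_eval_eq_zero {f : MvPolynomial σ k} (hf : f ≠ 0) {x : σ → k}
    (hx : MvPolynomial.eval x f = 0) :
    ∃ g, Irreducible g ∧ g ∣ f ∧ MvPolynomial.eval x g = 0 := by
  have h := UniqueFactorizationMonoid.factors_prod hf
  have h1 : MvPolynomial.eval x (UniqueFactorizationMonoid.factors f).prod = 0 := by
    obtain ⟨u, hu⟩ := h.symm
    rw [← hu, map_mul, hx, zero_mul]
  rw [map_multiset_prod, Multiset.prod_eq_zero_iff, Multiset.mem_map] at h1
  obtain ⟨g, hg, hgx⟩ := h1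
  exact ⟨g, UniqueFactorizationMonoid.irreducible_of_factor g hg,
    UniqueFactorizationMonoid.dvd_of_mem_factors hg, hgx⟩

/-- Through a point of a hypersurface in affine space passes an integral subscheme of the
hypersurface on which all coordinates but one are algebraically independent. -/
theorem exists_isPrime_algebraicIndependent [Nonempty σ] {f : MvPolynomial σ k} {x : σ → k}
    (hx : MvPolynomial.eval x f = 0) :
    ∃ p : Ideal (MvPolynomial σ k), p.IsPrime ∧ f ∈ p ∧ (∀ g ∈ p, MvPolynomial.eval x g = 0) ∧
      ∃ i, AlgebraicIndependent k fun j : {j // j ≠ i} =>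
        Ideal.Quotient.mkₐ k p (MvPolynomial.X j.1) := by
  suffices H : ∃ g : MvPolynomial σ k, (Ideal.span {g}).IsPrime ∧ g ∣ f ∧
      MvPolynomial.eval x g = 0 ∧ ∃ i, ∀ q, q ≠ 0 → g ∣ q → MvPolynomial.degreeOf i q ≠ 0 by
    obtain ⟨g, hg, hgf, hgx, i, hi⟩ := H
    refine ⟨_, hg, Ideal.mem_span_singleton.2 hgf, fun q hq => ?_, i, ?_⟩
    · obtain ⟨c, rfl⟩ := Ideal.mem_span_singleton.1 hq
      rw [map_mul, hgx, zero_mul]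
    · rw [algebraicIndependent_iff]
      intro q hq
      have h1 : MvPolynomial.aeval (fun j : {j // j ≠ i} =>
          Ideal.Quotient.mkₐ k (Ideal.span {g}) (MvPolynomial.X j.1)) q =
          Ideal.Quotient.mkₐ k (Ideal.span {g}) (MvPolynomial.rename Subtype.val q) := by
        rw [MvPolynomial.rename_eq_aeval]
        exact (MvPolynomial.comp_aeval_apply _ _ q).symm
      rw [h1] at hq
      have h2 := Ideal.mem_span_singleton.1 (Ideal.Quotient.eq_zero_iff_mem.1 hq)
      by_contra hq0
      refine hi _ (fun h0 => hq0 (MvPolynomial.rename_injective _ Subtype.val_injective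
        (h0.trans (map_zero _).symm))) h2 ?_
      classical
      by_contra h3
      obtain ⟨j, -, hj⟩ := Finset.mem_image.1
        (MvPolynomial.vars_rename _ _ (MvPolynomial.mem_vars_iff_degreeOf_ne_zero.2 h3))
      exact j.2 hj
  obtain rfl | hf := eq_or_ne f 0
  · obtain ⟨i⟩ := ‹Nonempty σ›
    exact ⟨0, by rw [Ideal.span_singleton_eq_bot.2 rfl]; exact Ideal.isPrime_bot, dvd_rfl,
      map_zero _, i, fun q hq h => (hq (zero_dvd_iff.1 h)).elim⟩
  · obtain ⟨g, hg, hgf, hgx⟩ := exists_irreducible_dvd_of_eval_eq_zero hf hx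
    refine ⟨g, (Ideal.span_singleton_prime hg.ne_zero).2 hg.prime, hgf, hgx, ?_⟩
    have hvars : g.vars.Nonempty := by
      rw [Finset.nonempty_iff_ne_empty, ne_eq, MvPolynomial.vars_eq_empty_iff_eq_C]
      intro h
      rw [h, MvPolynomial.eval_C] at hgx
      exact hg.ne_zero (by rw [h, hgx, map_zero])
    obtain ⟨i, hi⟩ := hvars
    rw [MvPolynomial.mem_vars_iff_degreeOf_ne_zero] at hi
    refine ⟨i, ?_⟩
    rintro _ hq ⟨c, rfl⟩
    rw [MvPolynomial.degreeOf_mul_eq (left_ne_zero_of_mul hq) (right_ne_zero_of_mul hq)]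
    omega

end Hypersurface

section Density

variable {k : Type u} [Field k]

theorem repr_scalarMap_of_forall {M : Type v} [AddCommGroup M] [Module k M] {A B : Type u}
    [CommRing A] [Algebra k A] [CommRing B] [Algebra k B] (f : A →ₐ[k] B) {ι : Type} [Fintype ι]
    {β : Module.Basis ι A (A ⊗[k] M)} {γ : Module.Basis ι B (B ⊗[k] M)}
    (h : ∀ i, scalarMap f M (β i) = γ i) (x : A ⊗[k] M) (i : ι) :
    γ.repr (scalarMap f M x) i = f (β.repr x i) := by
  have : scalarMap f M x = ∑ j, f (β.repr x j) • γ j := by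
    conv_lhs => rw [← β.sum_repr x]
    rw [map_sum]
    simp only [scalarMap_smul, h]
  rw [this, γ.repr_sum_self]

theorem map_adaptedMatrix_chartBasis {U V : Type v} [AddCommGroup U] [Module k U] [AddCommGroup V]
    [Module k V] {r s : ℕ} {ν : Type} [Fintype ν] (b : Module.Basis (Fin r ⊕ Fin s) k U)
    (c : Module.Basis ν k V) (ε : Module.Basis (Fin r × ν ⊕ Fin s × ν) k (U ⊗[k] V)) {A B : Type u}
    [CommRing A] [Algebra k A] [CommRing B] [Algebra k B] (f : A →ₐ[k] B)
    (x : Fin r × Fin s → A) :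
    (adaptedMatrix (chartBasis b x) c ε).map f = adaptedMatrix (chartBasis b (f ∘ x)) c ε := by
  have h : ∀ i, scalarMap f _ (tensorBasis (chartBasis b x) c i) =
      tensorBasis (chartBasis b (f ∘ x)) c i := by
    rintro (i | i)
    · simp [tensorBasis_inl, chartBasis_inl]
    · rw [tensorBasis_inr, tensorBasis_inr, ← tensorVec_scalarMap, scalarMap_chartBasis_inr]
  ext i j
  have := repr_scalarMap_of_forall f h (1 ⊗ₜ ε (Sum.inl j)) (Sum.inl i)
  rw [scalarMap_tmul, map_one] at this
  exact this.symm

/-- If a coherent sheaf is cyclic at no `k`-point of a neighbourhood of a point of a variety, then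
it is nowhere cyclic on the variety. -/
theorem SheafRelations.cyclicIdeal_eq_bot [IsAlgClosed k] {G : CommAlgCat.{u} k ⥤ Type (max u v)}
    {W : Type v}
    [AddCommGroup W] [Module k W] (J : SheafRelations G W) {ι : Type} [Fintype ι] [DecidableEq ι]
    (ε : Module.Basis ι k W) {D : Subfunctor G} {S : Subfunctor D.toFunctor} (hS : IsOpenSub S)
    (h : ∀ x ∈ pointsOf S, x ∉ pointsOf (J.cyclicLocus ε D)) {A : CommAlgCat.{u} k} [IsDomain A]
    [Algebra.FiniteType k A] (ξ : D.toFunctor.obj A) (φ : A →ₐ[k] k)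
    (hφ : specialize ξ φ ∈ pointsOf S) : cyclicIdeal ε (J.rel A ξ.1) = ⊥ := by
  obtain ⟨I, hI⟩ := hS A ξ
  have hk : ∀ (ψ : A →ₐ[k] k) (K : Ideal A), K.map ψ = ⊤ ↔ ∃ a ∈ K, ψ a ≠ 0 := by
    intro ψ K
    constructor
    · intro h1
      by_contra! h2
      have : K.map ψ ≤ ⊥ := Ideal.map_le_iff_le_comap.2 h2
      rw [h1, top_le_iff] at this
      exact bot_ne_top this
    · rintro ⟨a, ha, ha0⟩
      exact Ideal.eq_top_of_isUnit_mem _ (Ideal.mem_map_of_mem ψ ha) (isUnit_iff_ne_zero.2 ha0)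
  obtain ⟨c, hc, hc0⟩ := (hk φ I).1 ((hI (CommAlgCat.of k k) (CommAlgCat.ofHom φ)).1 hφ)
  rw [eq_bot_iff]
  intro a ha
  by_contra ha0
  have hca : c * a ∉ (⊥ : Ideal A) :=
    mul_ne_zero (fun h0 => hc0 (by rw [h0, map_zero])) ha0
  obtain ⟨ψ, -, hψ⟩ := exists_algHom_ne_zero (k := k) ⊥ hca
  rw [map_mul] at hψ
  refine h (specialize ξ ψ)
    ((hI (CommAlgCat.of k k) (CommAlgCat.ofHom ψ)).2
      ((hk ψ I).2 ⟨c, hc, left_ne_zero_of_mul hψ⟩)) ?_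
  change cyclicIdeal ε (J.rel _ (G.map (CommAlgCat.ofHom ψ) ξ.1)) = ⊤
  rw [J.rel_map, ← map_cyclicIdeal_eq_top_iff]
  exact (hk ψ _).2 ⟨a, ha, right_ne_zero_of_mul hψ⟩

variable {U V : Type v} [AddCommGroup U] [Module k U] [AddCommGroup V] [Module k V]
  [FiniteDimensional k U] {r s : ℕ} {L : Submodule k (U ⊗[k] V)}
  {ε : Module.Basis (Fin r × Fin (Module.finrank k V) ⊕ Fin s × Fin (Module.finrank k V)) k
    (U ⊗[k] V)}

theorem chartPt_mem_lowerD_iff [FiniteDimensional k V] (hs : Module.finrank k U - r = s)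
    (hε : L = Submodule.span k (Set.range (ε ∘ Sum.inl))) (b : Module.Basis (Fin r ⊕ Fin s) k U)
    {A : Type u} [CommRing A] [Algebra k A] (x : Fin r × Fin s → A) :
    chartPt b x ∈ (lowerD r L).obj (CommAlgCat.of k A) ↔
      (adaptedMatrix (chartBasis b x) (Module.finBasis k V) ε).det = 0 :=
  (mem_lowerD_iff (C := CommAlgCat.of k A) hs hε (chartPt b x)).trans
    (fittingVanishes_relations_iff (chartPt_toSubmodule b x) _ hε)

theorem chartPt_mem_lowerD_iff_of_algHom [FiniteDimensional k V] (hs : Module.finrank k U - r = s)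
    (hε : L = Submodule.span k (Set.range (ε ∘ Sum.inl))) (b : Module.Basis (Fin r ⊕ Fin s) k U)
    {A : Type u} [CommRing A] [Algebra k A] (f : MvPolynomial (Fin r × Fin s) k →ₐ[k] A) :
    chartPt b (f ∘ MvPolynomial.X) ∈ (lowerD r L).obj (CommAlgCat.of k A) ↔
      f (adaptedMatrix (chartBasis b MvPolynomial.X) (Module.finBasis k V) ε).det = 0 := by
  rw [chartPt_mem_lowerD_iff hs hε, ← map_adaptedMatrix_chartBasis, AlgHom.map_det]
  rfl

variable [IsAlgClosed k]

/-- If `X_L` has the expected dimension, then the locus where the cokernel of `M_L` has rank one is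
dense in the degeneracy locus. -/
theorem dense_cyclicLocus_relX [FiniteDimensional k V] [Nonempty (Fin r × Fin s)]
    [Nonempty (Fin r × Fin (Module.finrank k V))] (hs : Module.finrank k U - r = s)
    (hε : L = Submodule.span k (Set.range (ε ∘ Sum.inl)))
    (hdim : topologicalKrullDim (Points (relX r L).proj.toFunctor) < ((r * s : ℕ) : WithBot ℕ∞)) :
    Dense (pointsOf ((relX r L).cyclicLocus ε (lowerD r L))) := by
  rw [(isTopologicalBasis_points _).dense_iff]
  rintro _ ⟨S, hS, rfl⟩ ⟨N, hN⟩
  by_contra hne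
  rw [Set.not_nonempty_iff_eq_empty, Set.eq_empty_iff_forall_notMem] at hne
  obtain ⟨b, hb⟩ := exists_chartPt_zero hs (pt (A := CommAlgCat.of k k) N.1)
  set f := (adaptedMatrix (chartBasis b (MvPolynomial.X (R := k))) (Module.finBasis k V) ε).det
    with hf
  let ev : MvPolynomial (Fin r × Fin s) k →ₐ[k] k := MvPolynomial.aeval 0
  have hev : ev ∘ MvPolynomial.X = 0 := funext fun j => MvPolynomial.aeval_X _ _
  have hf0 : ev f = 0 := by
    rw [hf, ← chartPt_mem_lowerD_iff_of_algHom hs hε, hev, hb]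
    exact N.2
  obtain ⟨p, hp, hfp, hp0, i, hi⟩ := exists_isPrime_algebraicIndependent hf0
  let A := MvPolynomial (Fin r × Fin s) k ⧸ p
  let g := Ideal.Quotient.mkₐ k p
  have : Algebra.FiniteType k A := Algebra.FiniteType.of_surjective g
    (Ideal.Quotient.mkₐ_surjective k p)
  let ξ : (lowerD r L).toFunctor.obj (CommAlgCat.of k A) := ⟨chartPt b (g ∘ MvPolynomial.X),
    (chartPt_mem_lowerD_iff_of_algHom hs hε b g).2 (Ideal.Quotient.eq_zero_iff_mem.2 hfp)⟩
  let φ : A →ₐ[k] k := Ideal.Quotient.liftₐ p ev hp0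
  have hξ : specialize ξ φ = N := by
    refine Subtype.ext ?_
    change Module.Grassmannian.map φ (chartPt b (g ∘ MvPolynomial.X)) = pt
      (A := CommAlgCat.of k k) N.1
    rw [map_chartPt, ← hb, ← hev]
    rfl
  have h1 : cyclicIdeal ε ((relX r L).rel (CommAlgCat.of k A) ξ.1) = ⊥ :=
    SheafRelations.cyclicIdeal_eq_bot (A := CommAlgCat.of k A) _ ε hS
      (fun x hx hx' => hne x ⟨hx, hx'⟩) ξ φ (hξ ▸ hN)
  have h2 := (relX r L).card_lt_topologicalKrullDim b ε (g ∘ MvPolynomial.X) h1 _ hi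
  rw [Fintype.card_subtype_compl, Fintype.card_prod, Fintype.card_fin, Fintype.card_fin,
    Fintype.card_subtype_eq] at h2
  refine absurd (h2.trans_lt hdim) ?_
  rw [Nat.sub_add_cancel]
  · exact lt_irrefl _
  · have := Fintype.card_pos (α := Fin r × Fin s)
    rwa [Fintype.card_prod, Fintype.card_fin, Fintype.card_fin] at this

/-- If `X_L` is zero-dimensional, then the cokernel of `M_L` has rank one at all points of the
degeneracy locus. -/
theorem pointsOf_cyclicLocus_relX_eq_univ [Nonempty (Fin r × Fin (Module.finrank k V))]
    (hs : Module.finrank k U - r = s)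
    (hdim : topologicalKrullDim (Points (relX r L).proj.toFunctor) < 1) :
    pointsOf ((relX r L).cyclicLocus ε (lowerD r L)) = Set.univ := by
  refine Set.eq_univ_of_forall fun N => ?_
  obtain ⟨b, hb⟩ := exists_chartPt_zero hs (pt (A := CommAlgCat.of k k) N.1)
  by_contra h
  have h0 : cyclicIdeal ε ((relX r L).rel (CommAlgCat.of k k)
      (chartPt b (0 : Fin r × Fin s → k))) ≠ ⊤ := by
    rw [hb]
    exact h
  have := (relX r L).card_lt_topologicalKrullDim b ε _ ((Ideal.eq_bot_or_top _).resolve_right h0)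
    Empty.elim algebraicIndependent_empty_type
  exact absurd (this.trans_lt hdim) (by simp)

end Density

section Main

variable {k : Type u} [Field k]

theorem dense_pointsOf_preimage {F G : CommAlgCat.{u} k ⥤ Type w} {T : Subfunctor G}
    (hT : IsOpenSub T) (hd : Dense (pointsOf T)) (p : F ⟶ G)
    (e : (T.preimage p).toFunctor ≅ T.toFunctor) [IrreducibleSpace (Points F)] :
    Dense (pointsOf (T.preimage p)) := by
  refine (hT.preimage p).isOpen.dense ?_
  obtain ⟨x⟩ := (inferInstance : Nonempty (Points F))
  have : Nonempty (Points G) := ⟨p.app (CommAlgCat.of k k) x⟩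
  obtain ⟨y, hy⟩ := hd.nonempty
  exact ⟨_, (e.inv.app (CommAlgCat.of k k) ⟨y, hy⟩).2⟩

theorem dense_pointsOf_preimage_of_eq_univ {F G : CommAlgCat.{u} k ⥤ Type w} {T : Subfunctor G}
    (h : pointsOf T = Set.univ) (p : F ⟶ G) : Dense (pointsOf (T.preimage p)) := by
  have : pointsOf (T.preimage p) = Set.univ :=
    Set.eq_univ_of_forall fun x => h.ge (Set.mem_univ (p.app (CommAlgCat.of k k) x))
  rw [this]
  exact dense_univ

variable [IsAlgClosed k] {U V : Type v} [AddCommGroup U] [Module k U] [AddCommGroup V] [Module k V]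
  [FiniteDimensional k U] [FiniteDimensional k V] {r s : ℕ} {L : Submodule k (U ⊗[k] V)}
  {ε : Module.Basis (Fin r × Fin (Module.finrank k V) ⊕ Fin s × Fin (Module.finrank k V)) k
    (U ⊗[k] V)}

theorem birational_of_dim_lt (hr : 0 < r) (hs0 : 0 < s) (hn : 0 < Module.finrank k V)
    (hs : Module.finrank k U - r = s) (hε : L = Submodule.span k (Set.range (ε ∘ Sum.inl)))
    (hdim : topologicalKrullDim (Points (linX r L).toFunctor) < ((r * s : ℕ) : WithBot ℕ∞))
    (hirr : 1 < r * s → IrreducibleSpace (Points (linX r L).toFunctor) ∧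
      IrreducibleSpace (Points (linY r L).toFunctor)) :
    Birational (linX r L).toFunctor (lowerD r L).toFunctor ∧
      Birational (linY r L).toFunctor (lowerD r L).toFunctor ∧
        Birational (linX r L).toFunctor (linY r L).toFunctor := by
  have : NeZero r := ⟨hr.ne'⟩
  have : NeZero s := ⟨hs0.ne'⟩
  have : NeZero (Module.finrank k V) := ⟨hn.ne'⟩
  rw [linX_eq_proj] at hdim hirr ⊢
  rw [linY_eq_proj] at hirr ⊢
  let T := (relX r L).cyclicLocus ε (lowerD r L)
  have hT : IsOpenSub T := (relX r L).isOpenSub_cyclicLocus ε _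
  have hd : Dense (pointsOf T) := dense_cyclicLocus_relX hs hε hdim
  have hX := lowerD_eq_support_relX hs hε
  have hY := lowerD_eq_support_relY hs hε
  let eX : (T.preimage ((relX r L).projHom hX)).toFunctor ≅ T.toFunctor := (relX r L).projIso hX
  obtain ⟨eY⟩ : Nonempty ((T.preimage ((relY r L).projHom hY)).toFunctor ≅ T.toFunctor) := by
    have := (relY r L).projIso hY
    rw [cyclicLocus_relY hs (Nat.mul_pos hr hn) hε] at this
    exact ⟨this⟩
  refine Birational.of_isOpenSub hT hd _ _ eX eY ?_ ?_
  all_goals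
    obtain h | h : 1 < r * s ∨ r * s = 1 := by
      have := Nat.mul_pos hr hs0
      omega
  · have := (hirr h).1
    exact dense_pointsOf_preimage hT hd _ eX
  · rw [h] at hdim
    exact dense_pointsOf_preimage_of_eq_univ (pointsOf_cyclicLocus_relX_eq_univ hs hdim) _
  · have := (hirr h).2
    exact dense_pointsOf_preimage hT hd _ eY
  · rw [h] at hdim
    exact dense_pointsOf_preimage_of_eq_univ (pointsOf_cyclicLocus_relX_eq_univ hs hdim) _

end Main

end DetBirational

theorem mainTheorem6 {k : Type u} [Field k] [IsAlgClosed k] [CharZero k]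
    {U V : Type v} [AddCommGroup U] [Module k U] [FiniteDimensional k U]
    [AddCommGroup V] [Module k V] [FiniteDimensional k V]
    (hmn : Module.finrank k U ≤ Module.finrank k V)
    (r : ℕ) (hr : 1 ≤ r) (hrm : r < Module.finrank k U)
    (L : Submodule k (U ⊗[k] V)) (hc : Module.finrank k L = Module.finrank k V * r) :
    DetBirational.lowerD r L = DetBirational.upperD r L ∧
      (DetBirational.Admissible r L →
        (1 < r * (Module.finrank k U - r) →
          IrreducibleSpace (DetBirational.Points (DetBirational.linX r L).toFunctor) ∧
          IrreducibleSpace (DetBirational.Points (DetBirational.linY r L).toFunctor)) →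
        DetBirational.Birational (DetBirational.linX r L).toFunctor
            (DetBirational.lowerD r L).toFunctor ∧
          DetBirational.Birational (DetBirational.linY r L).toFunctor
            (DetBirational.lowerD r L).toFunctor ∧
          DetBirational.Birational (DetBirational.linX r L).toFunctor
            (DetBirational.linY r L).toFunctor) := by
  obtain ⟨s, hs⟩ : ∃ s, Module.finrank k U - r = s := ⟨_, rfl⟩
  obtain ⟨ε, hε⟩ := DetBirational.exists_basis_extending L
    (I := Fin r × Fin (Module.finrank k V)) (J := Fin s × Fin (Module.finrank k V))
    (by simp [hc, mul_comm])
    (by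
      simp only [Module.finrank_tensorProduct, Fintype.card_prod, Fintype.card_fin]
      rw [← add_mul, ← hs, Nat.add_sub_cancel' hrm.le])
  refine ⟨DetBirational.lowerD_eq_upperD hs hε, fun hL hirr => ?_⟩
  rw [hs] at hirr
  refine DetBirational.birational_of_dim_lt hr (by omega) (by omega) hs hε ?_ hirr
  have hdim := hL.1
  rw [hc, hs] at hdim
  by_contra hle
  have hlt := hdim ▸ add_le_add_left (not_lt.1 hle)
    ((Module.finrank k V * r + 1 : ℕ) : WithBot ℕ∞)
  norm_cast at hlt
  nlinarith
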